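/- An instance of 3-DSR-Poset consists of a finite set $A$ of agents, a partial order $\succeq_{\mathrm{ML}}$ on $A$ (the master poset), and for every agent $a\in A$ a strict linear order $\succ_a$ (complete preferences) of the set $\binom{A\setminus\{a\}}{2}$ of all 2-sets of other agents that is derived from the master poset: whenever $\{x_1,x_2\},\{y_1,y_2\}\in\binom{A\setminus\{a\}}{2}$ satisfy $x_1\succeq_{\mathrm{ML}}y_1$ and $x_2\succeq_{\mathrm{ML}}y_2$, then $\{x_1,x_2\}\succeq_a\{y_1,y_2\}$. A matching is a set $M$ of pairwise disjoint 3-subsets of $A$. A 3-subset $S$ of $A$ blocks $M$ if every $a\in S$ either lies in no member of $M$, or lies in some $T\in M$ with $S\setminus\{a\}\succ_a T\setminus\{a\}$. A matching is stable if no 3-subset of $A$ blocks it. The question is whether the instance admits a stable matching. The width of the master poset is the maximum size of an antichain. A parameterized reduction from a parameterized language $L\subseteq\Sigma^*\times\mathbb{N}$ to a parameterized language $L'\subseteq\Sigma'^*\times\mathbb{N}$ (with finite alphabets $\Sigma,\Sigma'$) is an algorithm that maps every $(w,k)$ to some $(w',k')$ with $(w,k)\in L\iff(w',k')\in L'$ and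 $k'\le g(k)$ in time $f(k)\cdot(|w|+k+1)^{c}$, for some computable functions $f,g$ and a constant $c$. The class $\mathrm{W}[1]$ consists of the parameterized languages that have a parameterized reduction to Clique parameterized by solution size, and a parameterized language is $\mathrm{W}[1]$-hard if every language in $\mathrm{W}[1]$ has a parameterized reduction to it. **Theorem.** 3-DSR-Poset parameterized by the width of the master poset is $\mathrm{W}[1]$-hard. -/

import Mathlib

/-! ## Programs with a step count

Data are binary trees with a single atom.  Programs are the imperative `WHILE` programs over such
trees (variables, `cons`, head, tail, test for `nil`, sequencing, branching, `while` loops), and a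
run is charged one unit for every elementary operation carried out.  This cost model is
polynomially equivalent to that of multi-tape Turing machines: trees are shared by reference, so
that every elementary operation is a constant number of pointer operations. -/

namespace While

/-- Binary trees over one atom. -/
inductive Tree : Type
  | nil : Tree
  | cons : Tree → Tree → Tree

namespace Tree

def hd : Tree → Tree
  | nil => nil
  | cons x _ => x

def tl : Tree → Tree
  | nil => nil
  | cons _ y => y

/-- Unary numerals. -/
def ofNat : ℕ → Tree
  | 0 => nil
  | m + 1 => cons nil (ofNat m)

/-- `nil`-terminated lists. -/
def ofList : List Tree → Tree
  | [] => nil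
  | x :: l => cons x (ofList l)

end Tree

abbrev Store := ℕ → Tree

inductive Expr : Type
  | var : ℕ → Expr
  | nil : Expr
  | cons : Expr → Expr → Expr
  | hd : Expr → Expr
  | tl : Expr → Expr

namespace Expr

def eval (σ : Store) : Expr → Tree
  | var x => σ x
  | nil => Tree.nil
  | cons e f => Tree.cons (e.eval σ) (f.eval σ)
  | hd e => (e.eval σ).hd
  | tl e => (e.eval σ).tl

/-- The number of operations needed to evaluate an expression. -/
def cost : Expr → ℕ
  | var _ => 1
  | nil => 1
  | cons e f => 1 + e.cost + f.cost
  | hd e => 1 + e.cost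
  | tl e => 1 + e.cost

end Expr

inductive Cmd : Type
  | assign : ℕ → Expr → Cmd
  | seq : Cmd → Cmd → Cmd
  | ite : Expr → Cmd → Cmd → Cmd
  | loop : Expr → Cmd → Cmd

/-- `Runs c σ τ t`: started in the store `σ`, the program `c` halts in the store `τ` after exactly
`t` steps.  A test succeeds if its value is not `nil`. -/
inductive Runs : Cmd → Store → Store → ℕ → Prop
  | assign (x : ℕ) (e : Expr) (σ : Store) :
      Runs (.assign x e) σ (Function.update σ x (e.eval σ)) (1 + e.cost)
  | seq {c d : Cmd} {σ τ ρ : Store} {s t : ℕ} :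
      Runs c σ τ s → Runs d τ ρ t → Runs (.seq c d) σ ρ (1 + s + t)
  | ite_true {e : Expr} {c d : Cmd} {σ τ : Store} {t : ℕ} :
      e.eval σ ≠ Tree.nil → Runs c σ τ t → Runs (.ite e c d) σ τ (1 + e.cost + t)
  | ite_false {e : Expr} {c d : Cmd} {σ τ : Store} {t : ℕ} :
      e.eval σ = Tree.nil → Runs d σ τ t → Runs (.ite e c d) σ τ (1 + e.cost + t)
  | loop_done {e : Expr} {c : Cmd} {σ : Store} :
      e.eval σ = Tree.nil → Runs (.loop e c) σ σ (1 + e.cost)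
  | loop_step {e : Expr} {c : Cmd} {σ τ ρ : Store} {s t : ℕ} :
      e.eval σ ≠ Tree.nil → Runs c σ τ s → Runs (.loop e c) τ ρ t →
      Runs (.loop e c) σ ρ (1 + e.cost + s + t)

/-- The initial store: the input is in variable `0`, all other variables are `nil`. -/
def initStore (x : Tree) : Store := fun i => if i = 0 then x else Tree.nil

/-- On input `x` the program halts within `T` steps with output `y` (read off variable `0`). -/
def OutputsWithin (c : Cmd) (x y : Tree) (T : ℕ) : Prop :=
  ∃ (τ : Store) (t : ℕ), Runs c (initStore x) τ t ∧ τ 0 = y ∧ t ≤ T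

end While

/-! ## Parameterized complexity -/

namespace Parameterized

/-- Parameterized languages over the alphabet `{0, …, s - 1}`. -/
abbrev Lang (s : ℕ) := Set (List (Fin s) × ℕ)

/-- The tree that represents the pair of a string and a parameter: the list of the letters,
together with the parameter in unary. -/
def toTree {s : ℕ} (w : List (Fin s)) (k : ℕ) : While.Tree :=
  .cons (.ofList (w.map fun a => .ofNat a)) (.ofNat k)

/-- There is a parameterized reduction from `L` to `L'`: a program that maps `(w, k)` to an
equivalent `(w', k')` with `k' ≤ g k` in time `f k * (|w| + k + 1) ^ c`, where `f` and `g` are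
computable.  (The summand `1` only matters for the empty string with parameter `0`.) -/
def Reduces {s r : ℕ} (L : Lang s) (L' : Lang r) : Prop :=
  ∃ (p : While.Cmd) (f g : ℕ → ℕ) (c : ℕ), Computable f ∧ Computable g ∧
    ∀ (w : List (Fin s)) (k : ℕ), ∃ (w' : List (Fin r)) (k' : ℕ),
      While.OutputsWithin p (toTree w k) (toTree w' k') (f k * (w.length + k + 1) ^ c) ∧
      k' ≤ g k ∧ ((w, k) ∈ L ↔ (w', k') ∈ L')

/-- The self-delimiting binary string `1 … 1 0` for a natural number. -/
def encNat (m : ℕ) : List (Fin 2) := List.replicate m 1 ++ [0]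

open Classical in
/-- The `n × n` matrix of a binary relation, row by row. -/
noncomputable def encRel {n : ℕ} (r : Fin n → Fin n → Prop) : List (Fin 2) :=
  (List.finRange n).flatMap fun a => (List.finRange n).map fun b => if r a b then 1 else 0

/-- A graph is given by its number of vertices and its adjacency matrix. -/
noncomputable def encGraph {n : ℕ} (G : SimpleGraph (Fin n)) : List (Fin 2) :=
  encNat n ++ encRel G.Adj

/-- `Clique`, parameterized by the solution size. -/
def Clique : Lang 2 :=
  {x | ∃ (n : ℕ) (G : SimpleGraph (Fin n)),
    x.1 = encGraph G ∧ ∃ S : Finset (Fin n), G.IsNClique x.2 S}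

/-- The class `W[1]`: the parameterized languages that reduce to `Clique`. -/
def InW1 {s : ℕ} (L : Lang s) : Prop := Reduces L Clique

/-- `L` is `W[1]`-hard: every language in `W[1]`, over whatever finite alphabet, reduces to `L`. -/
def W1Hard {s : ℕ} (L : Lang s) : Prop :=
  ∀ (r : ℕ) (L' : Lang r), InW1 L' → Reduces L' L

end Parameterized

/-! ## Multidimensional stable roommates with a master poset -/

namespace Roommates

/-- Instances of `d`-dimensional stable roommates.  The preference list of `a` enumerates all
`(d - 1)`-sets of other agents, the best one first. -/
structure DSR (d : ℕ) where
  n : ℕ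
  pref : Fin n → List (Finset (Fin n))
  pref_nodup : ∀ a, (pref a).Nodup
  mem_pref : ∀ a t, t ∈ pref a ↔ t.card + 1 = d ∧ a ∉ t

namespace DSR

variable {d : ℕ}

/-- `a` strictly prefers `t` to `u` (both in its preference list). -/
def Prefers (I : DSR d) (a : Fin I.n) (t u : Finset (Fin I.n)) : Prop :=
  (I.pref a).idxOf t < (I.pref a).idxOf u

/-- Matchings are sets of pairwise disjoint `d`-sets of agents. -/
def IsMatching (I : DSR d) (M : Finset (Finset (Fin I.n))) : Prop :=
  (∀ T ∈ M, T.card = d) ∧ ∀ T ∈ M, ∀ U ∈ M, T ≠ U → Disjoint T U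

/-- `S` is a blocking `d`-set for `M`. -/
def Blocks (I : DSR d) (M : Finset (Finset (Fin I.n))) (S : Finset (Fin I.n)) : Prop :=
  S.card = d ∧ ∀ a ∈ S,
    (∀ T ∈ M, a ∉ T) ∨ ∃ T ∈ M, a ∈ T ∧ I.Prefers a (S.erase a) (T.erase a)

def HasStableMatching (I : DSR d) : Prop :=
  ∃ M, I.IsMatching M ∧ ∀ S, ¬ I.Blocks M S

/-- The preferences of `v` are derived from the relation `ge` on the agents: if `xᵢ ⪰ yᵢ` for all
`i`, then `v` does not prefer the `(d - 1)`-set of the `yᵢ` to that of the `xᵢ`. -/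
def DerivedFrom (I : DSR d) (ge : Fin I.n → Fin I.n → Prop) (v : Fin I.n) : Prop :=
  ∀ x y : Fin (d - 1) → Fin I.n, Function.Injective x → Function.Injective y →
    (∀ i, x i ≠ v) → (∀ i, y i ≠ v) → (∀ i, ge (x i) (y i)) →
    ¬ I.Prefers v (Finset.univ.image y) (Finset.univ.image x)

end DSR

/-- Instances of `d`-DSR-Poset: `ge a b` means `a ⪰ b` in the master poset. -/
structure DSRPoset (d : ℕ) extends DSR d where
  ge : Fin n → Fin n → Prop
  ge_refl : ∀ a, ge a a
  ge_antisymm : ∀ a b, ge a b → ge b a → a = b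
  ge_trans : ∀ a b c, ge a b → ge b c → ge a c
  derived : ∀ v, toDSR.DerivedFrom ge v

namespace DSRPoset

variable {d : ℕ}

open Classical in
/-- The width of the master poset: the maximum size of an antichain. -/
noncomputable def width (I : DSRPoset d) : ℕ :=
  (Finset.univ.filter fun S : Finset (Fin I.n) => IsAntichain I.ge (S : Set (Fin I.n))).sup
    Finset.card

/-- An instance is given by the number of agents, the matrix of the master poset, and the complete
preference lists of all agents.  For fixed `d` the lengths of these lists and of their entries
depend on the number of agents only, so that no further separators are needed. -/
noncomputable def enc (I : DSRPoset d) : List (Fin 2) :=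
  Parameterized.encNat I.n ++ Parameterized.encRel I.ge ++
    (List.finRange I.n).flatMap fun a => (I.pref a).flatMap fun t =>
      (t.sort (· ≤ ·)).flatMap fun b => Parameterized.encNat b

end DSRPoset

/-- `d`-DSR-Poset, parameterized by the width of the master poset. -/
def dsrPosetByWidth (d : ℕ) : Parameterized.Lang 2 :=
  {x | ∃ I : DSRPoset d, x.1 = I.enc ∧ x.2 = I.width ∧ I.HasStableMatching}

end Roommates

/-! It suffices to map Clique to the roommates problem in polynomial time so that the parameter `k`
becomes at most `12 * k ^ 2`. A language in W[1] reduces to Clique by definition, and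
`Reduces.trans_polyTime` appends such a map to any parameterized reduction.

The instance consists of `2 * S` systems. A system has three chains of agents x, y, z with levels
below `N`, and one selector s. Lower levels are better, and x, y, z of equal level form a natural
triple. In a stable matching the natural triples are matched up to some level; at the first level
`c` where this fails, the selector takes x and y (`selector_matched`), and z is set free. So a
system chooses a number `sel π < N` although it contributes only four chains to the width.

Two kinds of constraints link these numbers. The systems `2 * τ` and `2 * τ + 1` share four gadget
agents whose triples block each other cyclically. Hence the last of them must be matched outside the
gadget, with one z from each system at levels of sum below `N` (`demand_matched`); since a free z is
never below the selected level, `sel (2 * τ) + sel (2 * τ + 1) < N`. Moreover, the selector of `π`,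
its y and the selected z of another system `ρ` block the matching if that z lies below a threshold
`b π (sel π) ρ`. Preferring low levels up to a threshold is compatible with the master poset, so
arbitrary lower bounds can be imposed. Conversely, each selection that obeys these constraints gives
a stable matching: `Blocking.elim` excludes every blocking triple. Together this is
`hasStableMatching_iff`.

Cliques are expressed by such selections (`exists_selection_iff`). Take `S = k * k`, one slot for
each pair of positions. The number `sel (2 * τ)` holds two vertices as digits in base `n + 1`, and
inadmissible pairs are punished by an unattainable bound. Lower bounds `a` and `N - 1 - a` on the
two systems of a slot force the first number to be `a`; so the slot `(p, q)` can force the diagonal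
slots `(p, p)` and `(q, q)` to hold its vertices. There are `12 * S` chains, whence the width `12 *
k ^ 2`.

The program is assembled from closure properties of `PolyTime`. As trees are shared, running time
does not bound the size of a tree. Inside the calculus a size bound is therefore part of `PolyTime`;
for the unknown first reduction the height of its output is bounded instead (`Runs.height_le`). -/

namespace While

/-! ## Encoded types and polynomial bounds -/

/-- The number of nodes of a tree. -/
def Tree.size : Tree → ℕ
  | .nil => 1
  | .cons x y => x.size + y.size + 1

/-- Types whose elements are represented by trees. -/
class Enc (α : Type) where
  enc : α → Tree

open Enc

instance : Enc ℕ := ⟨Tree.ofNat⟩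
instance : Enc Unit := ⟨fun _ => .nil⟩
instance : Enc Bool := ⟨fun b => if b then .cons .nil .nil else .nil⟩
instance {α β : Type} [Enc α] [Enc β] : Enc (α × β) := ⟨fun p => .cons (enc p.1) (enc p.2)⟩
instance {α : Type} [Enc α] : Enc (List α) := ⟨fun l => .ofList (l.map enc)⟩

/-- The size of the representation of `a`. -/
def len {α : Type} [Enc α] (a : α) : ℕ := (enc a).size

section

variable {α β γ δ : Type} [Enc α] [Enc β] [Enc γ] [Enc δ]

theorem len_prod (p : α × β) : len p = len p.1 + len p.2 + 1 := rfl

theorem len_nil : len ([] : List α) = 1 := rfl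

theorem len_cons (a : α) (l : List α) : len (a :: l) = len a + len l + 1 := rfl

theorem len_nat (n : ℕ) : len n = 2 * n + 1 := by
  induction n with
  | zero => rfl
  | succ n ih =>
    have : len (n + 1) = 1 + len n + 1 := rfl
    omega

theorem len_bool (b : Bool) : len b ≤ 3 := by
  cases b <;> simp [len, enc, Tree.size]

theorem len_append (l₁ l₂ : List α) : len (l₁ ++ l₂) + 1 = len l₁ + len l₂ := by
  induction l₁ with
  | nil => simp [len_nil]; omega
  | cons a l ih => simp only [List.cons_append, len_cons]; omega

theorem len_le_of_mem {a : α} {l : List α} (h : a ∈ l) : len a ≤ len l := by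
  induction l with
  | nil => simp at h
  | cons b l ih =>
    rw [len_cons]
    rcases List.mem_cons.1 h with rfl | h
    · omega
    · have := ih h
      omega

theorem length_le_len (l : List α) : l.length ≤ len l := by
  induction l with
  | nil => simp
  | cons b l ih =>
    rw [len_cons, List.length_cons]
    omega

theorem len_le_of_prefix {l₁ l : List α} (h : l₁ <+: l) : len l₁ ≤ len l := by
  obtain ⟨l₂, rfl⟩ := h
  have h₁ := len_append l₁ l₂
  have h₂ : 1 ≤ len l₂ := by
    cases l₂ with
    | nil => exact le_rfl
    | cons b l => rw [len_cons]; omega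
  omega

theorem len_le_of_forall {l : List α} {B : ℕ} (h : ∀ a ∈ l, len a ≤ B) :
    len l ≤ l.length * (B + 1) + 1 := by
  induction l with
  | nil => simp [len_nil]
  | cons b l ih =>
    have h₁ := ih fun a ha => h a (List.mem_cons_of_mem _ ha)
    have h₂ := h b List.mem_cons_self
    rw [len_cons, List.length_cons, Nat.add_mul]
    omega

/-- Functions bounded by a polynomial in the size of the argument. -/
def PolyBounded (h : α → ℕ) : Prop := ∃ c, ∀ a, h a ≤ (len a + 2) ^ c

theorem PolyBounded.mono {h h' : α → ℕ} (hh : PolyBounded h) (hle : ∀ a, h' a ≤ h a) :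
    PolyBounded h' :=
  hh.imp fun _ hc a => (hle a).trans (hc a)

/-- The base `len a + 2` is at least `2` and `n < 2 ^ n`, so no separate constant term is needed in
`PolyBounded`. -/
theorem PolyBounded.const (n : ℕ) : PolyBounded fun _ : α => n :=
  ⟨n, fun a => Nat.lt_two_pow_self.le.trans (Nat.pow_le_pow_left (by omega) n)⟩

theorem PolyBounded.len : PolyBounded (len : α → ℕ) :=
  ⟨1, fun a => by simp⟩

theorem PolyBounded.mul {h h' : α → ℕ} (hh : PolyBounded h) (hh' : PolyBounded h') :
    PolyBounded fun a => h a * h' a := by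
  obtain ⟨c, hc⟩ := hh
  obtain ⟨c', hc'⟩ := hh'
  exact ⟨c + c', fun a => by rw [pow_add]; exact Nat.mul_le_mul (hc a) (hc' a)⟩

theorem PolyBounded.add {h h' : α → ℕ} (hh : PolyBounded h) (hh' : PolyBounded h') :
    PolyBounded fun a => h a + h' a := by
  obtain ⟨c, hc⟩ := hh
  obtain ⟨c', hc'⟩ := hh'
  refine ⟨c + c' + 1, fun a => ?_⟩
  have h₁ : (While.len a + 2) ^ c ≤ (While.len a + 2) ^ (c + c') :=
    Nat.pow_le_pow_right (by omega) (by omega)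
  have h₂ : (While.len a + 2) ^ c' ≤ (While.len a + 2) ^ (c + c') :=
    Nat.pow_le_pow_right (by omega) (by omega)
  calc h a + h' a ≤ (While.len a + 2) ^ (c + c') * 2 := by have := hc a; have := hc' a; omega
    _ ≤ (While.len a + 2) ^ (c + c') * (While.len a + 2) := Nat.mul_le_mul_left _ (by omega)
    _ = _ := (pow_succ _ _).symm

theorem PolyBounded.pow {h : α → ℕ} (hh : PolyBounded h) (n : ℕ) :
    PolyBounded fun a => h a ^ n := by
  obtain ⟨c, hc⟩ := hh
  exact ⟨c * n, fun a => by rw [pow_mul]; exact Nat.pow_le_pow_left (hc a) n⟩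

theorem PolyBounded.comp {h : β → ℕ} {f : α → β} (hh : PolyBounded h)
    (hf : PolyBounded fun a => While.len (f a)) : PolyBounded fun a => h (f a) := by
  obtain ⟨c, hc⟩ := hh
  exact ((hf.add (.const 2)).pow c).mono fun a => hc _

/-! ## Functions computable in polynomial time -/

/-- The program `F d` replaces the content of register `d`, which represents `a`, by `f a`.  It
leaves the registers below `d` alone and makes no assumption on those above `d`. -/
def Computes (F : ℕ → Cmd) (f : α → β) (T : α → ℕ) : Prop :=
  ∀ (d : ℕ) (σ : Store) (a : α), σ d = enc a →
    ∃ τ t, Runs (F d) σ τ t ∧ τ d = enc (f a) ∧ (∀ i < d, τ i = σ i) ∧ t ≤ T a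

/-- `f` is computable in polynomial time. -/
def PolyTime (f : α → β) : Prop :=
  (PolyBounded fun a => len (f a)) ∧ ∃ F T, PolyBounded T ∧ Computes F f T

theorem PolyTime.of_expr {f : α → β} (e : ℕ → Expr) (n : ℕ) (he : ∀ d, (e d).cost ≤ n)
    (hf : ∀ d σ a, σ d = enc a → (e d).eval σ = enc (f a))
    (hb : PolyBounded fun a => len (f a)) : PolyTime f := by
  refine ⟨hb, fun d => .assign d (e d), fun _ => 1 + n, .const _, fun d σ a h => ?_⟩
  refine ⟨_, _, Runs.assign _ _ _, by simp [hf d σ a h], fun i hi => ?_, ?_⟩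
  · simp [Function.update_of_ne hi.ne]
  · have := he d
    simp only
    omega

theorem PolyTime.congr {f g : α → β} (hf : PolyTime f) (h : ∀ a, f a = g a) : PolyTime g := by
  obtain rfl : f = g := funext h
  exact hf

/-- The running time of the second program is measured in the size of `f a`. This is why `PolyTime`
carries a size bound: `cons x x` doubles a tree in one step, so the time spent on `f` would not
suffice. -/
theorem PolyTime.comp {g : β → γ} {f : α → β} (hg : PolyTime g) (hf : PolyTime f) :
    PolyTime fun a => g (f a) := by
  obtain ⟨bf, F, T, hT, hF⟩ := hf
  obtain ⟨bg, G, U, hU, hG⟩ := hg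
  refine ⟨bg.comp bf, fun d => .seq (F d) (G d), fun a => 1 + T a + U (f a),
    ((PolyBounded.const 1).add hT).add (hU.comp bf), fun d σ a h => ?_⟩
  obtain ⟨τ, t, h₁, h₂, h₃, h₄⟩ := hF d σ a h
  obtain ⟨ρ, u, g₁, g₂, g₃, g₄⟩ := hG d τ _ h₂
  exact ⟨ρ, _, .seq h₁ g₁, g₂, fun i hi => (g₃ i hi).trans (h₃ i hi),
    by simp only; omega⟩

theorem PolyTime.id : PolyTime fun a : α => a :=
  .of_expr (fun d => .var d) 1 (fun _ => le_rfl) (fun _ _ _ h => h) .len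

theorem PolyTime.pair {f : α → β} {g : α → γ} (hf : PolyTime f) (hg : PolyTime g) :
    PolyTime fun a => (f a, g a) := by
  obtain ⟨bf, F, T, hT, hF⟩ := hf
  obtain ⟨bg, G, U, hU, hG⟩ := hg
  refine ⟨((bf.add bg).add (.const 1)).mono fun a => (len_prod _).le,
    -- Register `d` keeps the argument until both results are present in `d + 1` and `d + 2`.
    fun d => .seq (.assign (d + 1) (.var d)) (.seq (F (d + 1)) (.seq (.assign (d + 2) (.var d))
      (.seq (G (d + 2)) (.assign d (.cons (.var (d + 1)) (.var (d + 2))))))),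
    fun a => T a + U a + 12, (hT.add hU).add (.const 12), fun d σ a h => ?_⟩
  obtain ⟨τ, t, h₁, h₂, h₃, h₄⟩ := hF (d + 1) (Function.update σ (d + 1) (σ d)) a (by simp [h])
  obtain ⟨ρ, u, g₁, g₂, g₃, g₄⟩ := hG (d + 2) (Function.update τ (d + 2) (τ d)) a
    (by rw [Function.update_self, h₃ d (by omega), Function.update_of_ne (by omega), h])
  refine ⟨_, _, .seq (.assign _ _ _) (.seq h₁ (.seq (.assign _ _ _) (.seq g₁ (.assign _ _ _)))),
    ?_, fun i hi => ?_, ?_⟩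
  · rw [Function.update_self]
    simp only [Expr.eval]
    rw [g₂, g₃ (d + 1) (by omega), Function.update_of_ne (by omega), h₂]
    rfl
  · rw [Function.update_of_ne (by omega), g₃ i (by omega), Function.update_of_ne (by omega),
      h₃ i (by omega), Function.update_of_ne (by omega)]
  · simp only [Expr.cost]
    omega

/-- Constants are built by one assignment. -/
def Expr.ofTree : Tree → Expr
  | .nil => .nil
  | .cons x y => .cons (ofTree x) (ofTree y)

theorem Expr.eval_ofTree (σ : Store) (x : Tree) : (Expr.ofTree x).eval σ = x := by
  induction x with
  | nil => rfl
  | cons x y hx hy => simp [ofTree, eval, hx, hy]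

theorem PolyTime.const (b : β) : PolyTime fun _ : α => b :=
  .of_expr (fun _ => .ofTree (enc b)) (Expr.ofTree (enc b)).cost (fun _ => le_rfl)
    (fun _ _ _ _ => Expr.eval_ofTree _ _) (.const _)

theorem PolyTime.fst {f : α → β × γ} (hf : PolyTime f) : PolyTime fun a => (f a).1 :=
  comp (g := Prod.fst) (.of_expr (fun d => .hd (.var d)) 2 (fun _ => le_rfl)
    (fun d σ a h => by simp only [Expr.eval, h]; rfl)
    (PolyBounded.len.mono fun a => by rw [len_prod]; omega)) hf

theorem PolyTime.snd {f : α → β × γ} (hf : PolyTime f) : PolyTime fun a => (f a).2 :=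
  comp (g := Prod.snd) (.of_expr (fun d => .tl (.var d)) 2 (fun _ => le_rfl)
    (fun d σ a h => by simp only [Expr.eval, h]; rfl)
    (PolyBounded.len.mono fun a => by rw [len_prod]; omega)) hf

/-- A nonempty list and the pair of its head and tail are the same tree, so copying suffices. -/
theorem PolyTime.cons {f : α → β} {g : α → List β} (hf : PolyTime f) (hg : PolyTime g) :
    PolyTime fun a => f a :: g a :=
  comp (g := fun x : β × List β => x.1 :: x.2) (.of_expr (fun d => .var d) 1 (fun _ => le_rfl)
    (fun _ _ _ h => h) .len) (hf.pair hg)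

theorem PolyTime.tail {f : α → List β} (hf : PolyTime f) : PolyTime fun a => (f a).tail :=
  comp (g := List.tail) (.of_expr (fun d => .tl (.var d)) 2 (fun _ => le_rfl)
    (fun d σ a h => by simp only [Expr.eval, h]; cases a <;> rfl)
    (PolyBounded.len.mono fun a => by
      cases a with
      | nil => exact le_rfl
      | cons b l => rw [len_cons, List.tail_cons]; omega)) hf

theorem PolyTime.headD_zero {f : α → List ℕ} (hf : PolyTime f) :
    PolyTime fun a => (f a).headD 0 :=
  comp (g := fun l : List ℕ => l.headD 0) (.of_expr (fun d => .hd (.var d)) 2 (fun _ => le_rfl)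
    (fun d σ a h => by simp only [Expr.eval, h]; cases a <;> rfl)
    (PolyBounded.len.mono fun a => by
      cases a with
      | nil => exact le_rfl
      | cons b l => rw [len_cons, List.headD_cons]; omega)) hf

theorem PolyTime.succ {f : α → ℕ} (hf : PolyTime f) : PolyTime fun a => f a + 1 :=
  comp (g := fun n => n + 1) (.of_expr (fun d => .cons .nil (.var d)) 3 (fun _ => le_rfl)
    (fun d σ a h => by simp only [Expr.eval, h]; rfl)
    ((PolyBounded.len.add (.const 2)).mono fun a => by simp only [len_nat]; omega)) hf

theorem PolyTime.pred {f : α → ℕ} (hf : PolyTime f) : PolyTime fun a => f a - 1 :=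
  comp (g := fun n => n - 1) (.of_expr (fun d => .tl (.var d)) 2 (fun _ => le_rfl)
    (fun d σ a h => by simp only [Expr.eval, h]; cases a <;> rfl)
    (PolyBounded.len.mono fun a => by simp only [len_nat]; omega)) hf

theorem ofList_replicate_nil (n : ℕ) : Tree.ofList (List.replicate n .nil) = .ofNat n := by
  induction n with
  | zero => rfl
  | succ n ih => simp [List.replicate_succ, Tree.ofList, Tree.ofNat, ih]

/-- A unary numeral is the same tree as a list of units. Hence a number can drive a fold, and the
length of a list is obtained by mapping it to units. -/
theorem enc_replicate_unit (n : ℕ) : enc (List.replicate n ()) = enc n := by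
  simp only [enc, List.map_replicate, ofList_replicate_nil]

theorem PolyTime.replicate_unit {f : α → ℕ} (hf : PolyTime f) :
    PolyTime fun a => List.replicate (f a) () :=
  comp (g := fun n => List.replicate n ()) (.of_expr (fun d => .var d) 1 (fun _ => le_rfl)
    (fun d σ a h => by simp only [Expr.eval, h, enc_replicate_unit])
    (PolyBounded.len.mono fun a => by simp only [len, enc_replicate_unit, le_refl])) hf

theorem PolyTime.length_unit {f : α → List Unit} (hf : PolyTime f) :
    PolyTime fun a => (f a).length :=
  comp (g := List.length) (.of_expr (fun d => .var d) 1 (fun _ => le_rfl)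
    (fun d σ a h => by
      rw [Expr.eval, h, ← enc_replicate_unit]; congr
      exact List.eq_replicate_length.2 fun b _ => rfl)
    (PolyBounded.len.mono fun a => by
      rw [len, ← enc_replicate_unit, len]
      exact le_of_eq (by congr; exact (List.eq_replicate_length.2 fun b _ => rfl).symm))) hf

/-! ### Decisions -/

/-- `p` is decidable in polynomial time. -/
def PolyDec (p : α → Prop) : Prop := ∃ f : α → Bool, PolyTime f ∧ ∀ a, f a = true ↔ p a

theorem PolyTime.cond {f : α → Bool} {g h : α → β} (hf : PolyTime f) (hg : PolyTime g)
    (hh : PolyTime h) : PolyTime fun a => if f a then g a else h a := by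
  obtain ⟨_, F, T, hT, hF⟩ := hf
  obtain ⟨bg, G, U, hU, hG⟩ := hg
  obtain ⟨bh, H, V, hV, hH⟩ := hh
  refine ⟨(bg.add bh).mono fun a => by simp only; split <;> omega,
    fun d => .seq (.assign (d + 1) (.var d)) (.seq (F (d + 1)) (.ite (.var (d + 1)) (G d) (H d))),
    fun a => T a + U a + V a + 8, ((hT.add hU).add hV).add (.const 8), fun d σ a h => ?_⟩
  obtain ⟨τ, t, h₁, h₂, h₃, h₄⟩ := hF (d + 1) (Function.update σ (d + 1) (σ d)) a (by simp [h])
  have h₅ : τ d = enc a := by rw [h₃ d (by omega), Function.update_of_ne (by omega), h]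
  cases hfa : f a with
  | true =>
    obtain ⟨ρ, u, g₁, g₂, g₃, g₄⟩ := hG d τ a h₅
    refine ⟨ρ, _, .seq (.assign _ _ _) (.seq h₁ (.ite_true ?_ g₁)), by simpa [hfa] using g₂,
      fun i hi => ?_, ?_⟩
    · simp [Expr.eval, h₂, hfa, enc]
    · rw [g₃ i hi, h₃ i (by omega), Function.update_of_ne (by omega)]
    · simp only [Expr.cost]
      omega
  | false =>
    obtain ⟨ρ, u, g₁, g₂, g₃, g₄⟩ := hH d τ a h₅
    refine ⟨ρ, _, .seq (.assign _ _ _) (.seq h₁ (.ite_false ?_ g₁)), by simpa [hfa] using g₂,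
      fun i hi => ?_, ?_⟩
    · simp [Expr.eval, h₂, hfa, enc]
    · rw [g₃ i hi, h₃ i (by omega), Function.update_of_ne (by omega)]
    · simp only [Expr.cost]
      omega

theorem PolyTime.ite {p : α → Prop} [DecidablePred p] {g h : α → β} (hp : PolyDec p)
    (hg : PolyTime g) (hh : PolyTime h) : PolyTime fun a => if p a then g a else h a := by
  obtain ⟨f, hf, hfp⟩ := hp
  exact (hf.cond hg hh).congr fun a => by simp only [hfp]

theorem PolyDec.congr {p q : α → Prop} (hp : PolyDec p) (h : ∀ a, p a ↔ q a) : PolyDec q := by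
  obtain rfl : p = q := funext fun a => propext (h a)
  exact hp

theorem PolyDec.not {p : α → Prop} (hp : PolyDec p) : PolyDec fun a => ¬ p a := by
  obtain ⟨f, hf, hfp⟩ := hp
  exact ⟨_, hf.cond (.const false) (.const true), fun a => by simp [← hfp]⟩

theorem PolyDec.and {p q : α → Prop} (hp : PolyDec p) (hq : PolyDec q) :
    PolyDec fun a => p a ∧ q a := by
  obtain ⟨f, hf, hfp⟩ := hp
  obtain ⟨g, hg, hgq⟩ := hq
  exact ⟨_, hf.cond hg (.const false), fun a => by simp [← hfp, ← hgq]⟩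

theorem PolyDec.comp {p : β → Prop} {f : α → β} (hp : PolyDec p) (hf : PolyTime f) :
    PolyDec fun a => p (f a) := by
  obtain ⟨g, hg, hgp⟩ := hp
  exact ⟨_, hg.comp hf, fun a => hgp _⟩

theorem PolyDec.eq_zero {f : α → ℕ} (hf : PolyTime f) : PolyDec fun a => f a = 0 := by
  have h : PolyDec fun n : ℕ => n ≠ 0 := by
    refine ⟨fun n => decide (n ≠ 0), ⟨(PolyBounded.const 3).mono fun a => len_bool _,
      fun d => .ite (.var d) (.assign d (.cons .nil .nil)) (.assign d .nil), fun _ => 20,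
      .const _, fun d σ a h => ?_⟩, fun a => by simp⟩
    cases a with
    | zero =>
      refine ⟨_, _, .ite_false h (.assign _ _ _), by rw [Function.update_self]; rfl,
        fun i hi => ?_, by simp only [Expr.cost]; omega⟩
      rw [Function.update_of_ne (by omega)]
    | succ a =>
      refine ⟨_, _, .ite_true (by simp [Expr.eval, h, enc, Tree.ofNat]) (.assign _ _ _),
        by rw [Function.update_self]; rfl,
        fun i hi => ?_, by simp only [Expr.cost]; omega⟩
      rw [Function.update_of_ne (by omega)]
  exact (h.comp hf).not.congr fun a => not_not

/-! ### Recursion over lists -/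

/-- The loop that folds a list: the parameter is in register `d`, the list in register `d + 1` and
the state in register `d + 2`. -/
def foldLoop (F : ℕ → Cmd) (d : ℕ) : Cmd :=
  .loop (.var (d + 1))
    (.seq (.assign (d + 3) (.cons (.var d) (.cons (.var (d + 2)) (.hd (.var (d + 1))))))
      (.seq (F (d + 3)) (.seq (.assign (d + 2) (.var (d + 3)))
        (.assign (d + 1) (.tl (.var (d + 1)))))))

/-- The cost of the step need only be bounded at states that occur, namely the folds of prefixes of
`l`. The `18` covers the loop's own operations in one round. -/
theorem runs_foldLoop {F : ℕ → Cmd} {step : α → γ → β → γ} {T : α × γ × β → ℕ}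
    (hF : Computes F (fun x : α × γ × β => step x.1 x.2.1 x.2.2) T) (K d : ℕ) (a : α)
    (l : List β) (s : γ) (σ : Store) (h₀ : σ d = enc a) (h₁ : σ (d + 1) = enc l)
    (h₂ : σ (d + 2) = enc s)
    (hK : ∀ l₁ b l₂, l = l₁ ++ b :: l₂ → T (a, l₁.foldl (step a) s, b) ≤ K) :
    ∃ τ t, Runs (foldLoop F d) σ τ t ∧ τ (d + 2) = enc (l.foldl (step a) s) ∧
      (∀ i < d, τ i = σ i) ∧ t ≤ l.length * (K + 18) + 2 := by
  induction l generalizing s σ with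
  | nil =>
    refine ⟨σ, _, .loop_done h₁, h₂, fun _ _ => rfl, by simp [Expr.cost]⟩
  | cons b l ih =>
    obtain ⟨τ, t, r₁, r₂, r₃, r₄⟩ := hF (d + 3)
      (Function.update σ (d + 3) (.cons (σ d) (.cons (σ (d + 2)) (σ (d + 1)).hd))) (a, s, b)
      (by rw [Function.update_self, h₀, h₁, h₂]; rfl)
    have q₀ : τ d = enc a := by rw [r₃ d (by omega), Function.update_of_ne (by omega), h₀]
    have q₁ : τ (d + 1) = enc (b :: l) := by
      rw [r₃ (d + 1) (by omega), Function.update_of_ne (by omega), h₁]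
    obtain ⟨ρ, u, g₁, g₂, g₃, g₄⟩ := ih (step a s b)
      (Function.update (Function.update τ (d + 2) (τ (d + 3))) (d + 1) (τ (d + 1)).tl)
      (by rw [Function.update_of_ne (by omega), Function.update_of_ne (by omega), q₀])
      (by rw [Function.update_self, q₁]; rfl)
      (by rw [Function.update_of_ne (by omega), Function.update_self, r₂])
      (fun l₁ b' l₂ e => hK (b :: l₁) b' l₂ (by rw [e]; rfl))
    refine ⟨ρ, _, .loop_step (t := u) ?_ (.seq (.assign _ _ _) (.seq r₁ (.seq (.assign _ _ _)
      (.assign _ _ _)))) ?_, g₂, fun i hi => ?_, ?_⟩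
    · rw [Expr.eval, h₁]
      exact Tree.noConfusion
    · simpa [Expr.eval, foldLoop] using g₁
    · rw [g₃ i hi, Function.update_of_ne (by omega), Function.update_of_ne (by omega),
        r₃ i (by omega), Function.update_of_ne (by omega)]
    · have := hK [] b l rfl
      rw [List.foldl_nil] at this
      simp only [Expr.cost, List.length_cons, Nat.add_mul]
      omega

/-- A polynomial-time step may double the state in every round, so a bound `B` on all intermediate
states has to be supplied. Given it, there are polynomially many rounds of polynomial cost. -/
theorem PolyTime.foldl {l : α → List β} {start : α → γ} {step : α → γ → β → γ} {B : α → ℕ}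
    (hl : PolyTime l) (hi : PolyTime start)
    (hs : PolyTime fun x : α × γ × β => step x.1 x.2.1 x.2.2) (hB : PolyBounded B)
    (hb : ∀ a l₁, l₁ <+: l a → len (l₁.foldl (step a) (start a)) ≤ B a) :
    PolyTime fun a => (l a).foldl (step a) (start a) := by
  obtain ⟨bl, L, T, hT, hL⟩ := hl
  obtain ⟨bi, I, U, hU, hI⟩ := hi
  obtain ⟨-, F, V, ⟨c, hc⟩, hF⟩ := hs
  -- The `4` is made of two units for the two pairings in `(a, s, b)` and of the `2` in
  -- `PolyBounded`.
  have hK : PolyBounded fun a => (len a + B a + len (l a) + 4) ^ c :=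
    (((PolyBounded.len.add hB).add bl).add (.const 4)).pow c
  refine ⟨hB.mono fun a => hb a _ (List.prefix_refl _),
    fun d => .seq (.assign (d + 1) (.var d)) (.seq (L (d + 1)) (.seq (.assign (d + 2) (.var d))
      (.seq (I (d + 2)) (.seq (foldLoop F d) (.assign d (.var (d + 2))))))),
    fun a => T a + U a + len (l a) * ((len a + B a + len (l a) + 4) ^ c + 18) + 20,
    ((hT.add hU).add (bl.mul (hK.add (.const 18)))).add (.const 20), fun d σ a h => ?_⟩
  obtain ⟨τ, t, h₁, h₂, h₃, h₄⟩ := hL (d + 1) (Function.update σ (d + 1) (σ d)) a (by simp [h])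
  have h₅ : τ d = enc a := by rw [h₃ d (by omega), Function.update_of_ne (by omega), h]
  obtain ⟨ρ, u, g₁, g₂, g₃, g₄⟩ := hI (d + 2) (Function.update τ (d + 2) (τ d)) a
    (by rw [Function.update_self, h₅])
  obtain ⟨μ, v, k₁, k₂, k₃, k₄⟩ := runs_foldLoop hF ((len a + B a + len (l a) + 4) ^ c) d a (l a)
    (start a) ρ (by rw [g₃ d (by omega), Function.update_of_ne (by omega), h₅])
    (by rw [g₃ (d + 1) (by omega), Function.update_of_ne (by omega), h₂]) g₂
    (fun l₁ b l₂ e => (hc _).trans (Nat.pow_le_pow_left (by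
      have e₁ := hb a l₁ (e ▸ List.prefix_append _ _)
      have e₂ : len b ≤ len (l a) := len_le_of_mem (e ▸ by simp)
      simp only [len_prod]
      omega) _))
  refine ⟨_, _, .seq (.assign _ _ _) (.seq h₁ (.seq (.assign _ _ _) (.seq g₁ (.seq k₁
    (.assign _ _ _))))), ?_, fun i hi => ?_, ?_⟩
  · rw [Function.update_self, Expr.eval, k₂]
  · rw [Function.update_of_ne (by omega), k₃ i hi, g₃ i (by omega),
      Function.update_of_ne (by omega), h₃ i (by omega), Function.update_of_ne (by omega)]
  · have := Nat.mul_le_mul_right ((len a + B a + len (l a) + 4) ^ c + 18) (length_le_len (l a))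
    simp only [Expr.cost]
    omega

theorem foldl_cons_eq {ι : Type} (l s : List ι) :
    l.foldl (fun s b => b :: s) s = l.reverse ++ s := by
  induction l generalizing s with
  | nil => rfl
  | cons b l ih => simp [ih]

theorem len_reverse (l : List α) : len l.reverse = len l := by
  induction l with
  | nil => rfl
  | cons b l ih =>
    have := len_append l.reverse [b]
    rw [List.reverse_cons, len_cons]
    simp only [len_cons, len_nil] at this
    omega

theorem PolyTime.reverse {l : α → List β} (hl : PolyTime l) :
    PolyTime fun a => (l a).reverse := by
  refine (PolyTime.foldl (step := fun _ s b => b :: s) (start := fun _ => []) hl (.const _)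
    (PolyTime.id.snd.snd.cons PolyTime.id.snd.fst) hl.1 fun a l₁ h => ?_).congr
    fun a => by simp
  rw [foldl_cons_eq, List.append_nil, len_reverse]
  exact len_le_of_prefix h

theorem PolyTime.append {l l' : α → List β} (hl : PolyTime l) (hl' : PolyTime l') :
    PolyTime fun a => l a ++ l' a := by
  refine (PolyTime.foldl (step := fun _ s b => b :: s) hl.reverse hl'
    (PolyTime.id.snd.snd.cons PolyTime.id.snd.fst) (hl.1.add hl'.1) fun a l₁ h => ?_).congr
    fun a => by simp
  rw [foldl_cons_eq]
  have h₁ := len_append l₁.reverse (l' a)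
  have h₂ := len_le_of_prefix h
  rw [len_reverse] at h₁ h₂
  omega

theorem foldl_map_cons {ι κ : Type} (g : ι → κ) (l : List ι) (s : List κ) :
    l.foldl (fun s b => g b :: s) s = (l.map g).reverse ++ s := by
  induction l generalizing s with
  | nil => rfl
  | cons b l ih => simp [ih]

theorem PolyTime.map {l : α → List β} {g : α → β → γ} (hl : PolyTime l)
    (hg : PolyTime fun x : α × β => g x.1 x.2) : PolyTime fun a => (l a).map (g a) := by
  obtain ⟨c, hc⟩ := hg.1
  have hK : PolyBounded fun a => (len a + len (l a) + 3) ^ c :=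
    ((PolyBounded.len.add hl.1).add (.const 3)).pow c
  refine (PolyTime.foldl (l := l) (start := fun _ => ([] : List γ))
    (step := fun a s b => g a b :: s) hl (.const _)
    ((hg.comp (PolyTime.id.fst.pair PolyTime.id.snd.snd)).cons PolyTime.id.snd.fst)
    ((hl.1.mul (hK.add (.const 1))).add (.const 1)) fun a l₁ h => ?_).reverse.congr
    fun a => by rw [foldl_map_cons]; simp
  rw [foldl_map_cons, List.append_nil, len_reverse]
  refine (len_le_of_forall (B := (len a + len (l a) + 3) ^ c) fun y hy => ?_).trans ?_
  · obtain ⟨b, hb, rfl⟩ := List.mem_map.1 hy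
    refine (hc (a, b)).trans (Nat.pow_le_pow_left ?_ _)
    have := len_le_of_mem (h.subset hb)
    rw [len_prod]
    simp only
    omega
  · have h₁ : l₁.length ≤ len (l a) := h.length_le.trans (length_le_len _)
    rw [List.length_map]
    have := Nat.mul_le_mul_right ((len a + len (l a) + 3) ^ c + 1) h₁
    omega

theorem PolyTime.flatten {l : α → List (List β)} (hl : PolyTime l) :
    PolyTime fun a => (l a).flatten := by
  have key : ∀ (l : List (List β)) (s : List β),
      l.foldl (fun s b => s ++ b) s = s ++ l.flatten := by
    intro l
    induction l with
    | nil => simp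
    | cons b l ih => intro s; simp [ih]
  have key' : ∀ l : List (List β), len l.flatten ≤ len l := by
    intro l
    induction l with
    | nil => exact le_rfl
    | cons b l ih =>
      have := len_append b l.flatten
      rw [List.flatten_cons, len_cons]
      omega
  refine (PolyTime.foldl (step := fun _ s b => s ++ b) (start := fun _ => []) hl (.const _)
    (PolyTime.id.snd.fst.append PolyTime.id.snd.snd) hl.1 fun a l₁ h => ?_).congr
    fun a => by simp [key]
  rw [key, List.nil_append]
  exact (key' _).trans (len_le_of_prefix h)

theorem PolyTime.flatMap {l : α → List β} {g : α → β → List γ} (hl : PolyTime l)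
    (hg : PolyTime fun x : α × β => g x.1 x.2) : PolyTime fun a => (l a).flatMap (g a) :=
  (hl.map hg).flatten.congr fun _ => rfl

theorem PolyTime.filter {l : α → List β} {p : α → β → Prop} [∀ a, DecidablePred (p a)]
    (hl : PolyTime l) (hp : PolyDec fun x : α × β => p x.1 x.2) :
    PolyTime fun a => (l a).filter fun b => p a b := by
  classical
  refine (hl.flatMap (g := fun a b => if p a b then [b] else [])
    (.ite hp (PolyTime.id.snd.cons (.const _)) (.const _))).congr fun a => ?_
  induction l a with
  | nil => rfl
  | cons b l ih => by_cases h : p a b <;> simp [h, ih]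

theorem PolyTime.length {l : α → List β} (hl : PolyTime l) : PolyTime fun a => (l a).length :=
  (hl.map (g := fun _ _ => ()) (.const _)).length_unit.congr fun a => by simp

/-! ### Arithmetic -/

theorem foldl_replicate_unit {ι : Type} (g : ι → ι) (n : ℕ) (s : ι) :
    (List.replicate n ()).foldl (fun s _ => g s) s = g^[n] s := by
  induction n generalizing s with
  | zero => rfl
  | succ n ih => simp [List.replicate_succ, ih]

theorem PolyTime.iterate {n : α → ℕ} {start : α → γ} {step : α → γ → γ} {B : α → ℕ}
    (hn : PolyTime n) (hi : PolyTime start) (hs : PolyTime fun x : α × γ => step x.1 x.2)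
    (hB : PolyBounded B) (hb : ∀ a, ∀ i ≤ n a, len ((step a)^[i] (start a)) ≤ B a) :
    PolyTime fun a => (step a)^[n a] (start a) := by
  refine (PolyTime.foldl (step := fun a s (_ : Unit) => step a s) hn.replicate_unit hi
    (hs.comp (PolyTime.id.fst.pair PolyTime.id.snd.fst)) hB fun a l₁ h => ?_).congr
    fun a => foldl_replicate_unit _ _ _
  obtain ⟨h₁, h₂⟩ := List.prefix_replicate_iff.1 h
  rw [h₂, foldl_replicate_unit]
  exact hb a _ h₁

theorem PolyTime.add {f g : α → ℕ} (hf : PolyTime f) (hg : PolyTime g) :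
    PolyTime fun a => f a + g a := by
  have key : ∀ i m : ℕ, (fun s : ℕ => s + 1)^[i] m = m + i := fun i m => by
    simp
  refine (PolyTime.iterate (step := fun _ s => s + 1) hg hf PolyTime.id.snd.succ
    (hf.1.add hg.1) fun a i hi => ?_).congr fun a => key _ _
  rw [key]
  simp only [len_nat]
  omega

theorem PolyTime.sub {f g : α → ℕ} (hf : PolyTime f) (hg : PolyTime g) :
    PolyTime fun a => f a - g a := by
  have key : ∀ i m : ℕ, (fun s : ℕ => s - 1)^[i] m = m - i := fun i m => by
    induction i with
    | zero => rfl
    | succ i ih => rw [Function.iterate_succ_apply', ih]; omega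
  refine (PolyTime.iterate (step := fun _ s => s - 1) hg hf PolyTime.id.snd.pred
    hf.1 fun a i hi => ?_).congr fun a => key _ _
  rw [key]
  simp only [len_nat]
  omega

theorem PolyTime.mul {f g : α → ℕ} (hf : PolyTime f) (hg : PolyTime g) :
    PolyTime fun a => f a * g a := by
  have key : ∀ m i : ℕ, (fun s : ℕ => s + m)^[i] 0 = m * i := fun m i => by
    induction i with
    | zero => rfl
    | succ i ih => rw [Function.iterate_succ_apply', ih, Nat.mul_succ]
  refine (PolyTime.iterate (step := fun a s => s + f a) hg (.const 0)
    (PolyTime.id.snd.add (hf.comp PolyTime.id.fst))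
    (hf.1.mul hg.1) fun a i hi => ?_).congr fun a => key _ _
  rw [key]
  simp only [len_nat]
  have := Nat.mul_le_mul_left (f a) hi
  nlinarith

theorem PolyDec.le {f g : α → ℕ} (hf : PolyTime f) (hg : PolyTime g) :
    PolyDec fun a => f a ≤ g a :=
  (PolyDec.eq_zero (hf.sub hg)).congr fun _ => Nat.sub_eq_zero_iff_le

theorem PolyDec.lt {f g : α → ℕ} (hf : PolyTime f) (hg : PolyTime g) :
    PolyDec fun a => f a < g a :=
  (PolyDec.le hf.succ hg).congr fun _ => Iff.rfl

theorem PolyDec.eq {f g : α → ℕ} (hf : PolyTime f) (hg : PolyTime g) :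
    PolyDec fun a => f a = g a :=
  ((PolyDec.le hf hg).and (PolyDec.le hg hf)).congr fun _ => le_antisymm_iff.symm

theorem PolyTime.range {f : α → ℕ} (hf : PolyTime f) : PolyTime fun a => List.range (f a) := by
  have key : ∀ i : ℕ, (fun s : List ℕ => s ++ [s.length])^[i] [] = List.range i := fun i => by
    induction i with
    | zero => rfl
    | succ i ih => rw [Function.iterate_succ_apply', ih, List.range_succ, List.length_range]
  refine (PolyTime.iterate (step := fun _ s => s ++ [s.length]) hf (.const [])
    (PolyTime.id.snd.append (PolyTime.id.snd.length.cons (.const _)))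
    ((hf.1.mul (hf.1.add (.const 1))).add (.const 1)) fun a i hi => ?_).congr fun a => key _
  rw [key]
  refine (len_le_of_forall (B := len (f a)) fun j hj => ?_).trans ?_
  · rw [List.mem_range] at hj
    simp only [len_nat]
    omega
  · rw [List.length_range]
    have : i ≤ len (f a) := by rw [len_nat]; omega
    have := Nat.mul_le_mul_right (len (f a) + 1) this
    omega

/-- The quotient counts the positive multiples of `n` up to `m`, which turns division into a filter
over a range. -/
theorem div_eq_length_filter (m n : ℕ) (hn : n ≠ 0) :
    m / n = ((List.range m).filter fun j => (j + 1) * n ≤ m).length := by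
  have hle : m / n ≤ m := Nat.div_le_self _ _
  have h : ((List.range m).filter fun j => (j + 1) * n ≤ m) = List.range (m / n) := by
    obtain ⟨r, hr⟩ := Nat.exists_eq_add_of_le hle
    conv_lhs => rw [hr, List.range_add, List.filter_append]
    rw [List.filter_eq_self.2, List.filter_eq_nil_iff.2, List.append_nil]
    · intro j hj
      obtain ⟨i, -, rfl⟩ := List.mem_map.1 hj
      simp only [decide_eq_true_eq, ← Nat.le_div_iff_mul_le (Nat.pos_of_ne_zero hn), ← hr]
      omega
    · intro j hj
      rw [List.mem_range] at hj
      simp only [decide_eq_true_eq, ← Nat.le_div_iff_mul_le (Nat.pos_of_ne_zero hn), ← hr]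
      omega
  rw [h, List.length_range]

theorem PolyTime.div {f g : α → ℕ} (hf : PolyTime f) (hg : PolyTime g) :
    PolyTime fun a => f a / g a := by
  refine (PolyTime.ite (PolyDec.eq_zero hg) (.const 0) (hf.range.filter
    (p := fun a j => (j + 1) * g a ≤ f a) (PolyDec.le (PolyTime.id.snd.succ.mul
      (hg.comp PolyTime.id.fst)) (hf.comp PolyTime.id.fst))).length).congr fun a => ?_
  split_ifs with h
  · simp [h]
  · exact (div_eq_length_filter _ _ h).symm

theorem PolyTime.mod {f g : α → ℕ} (hf : PolyTime f) (hg : PolyTime g) :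
    PolyTime fun a => f a % g a :=
  (hf.sub (hg.mul (hf.div hg))).congr fun a => by
    have := Nat.div_add_mod (f a) (g a)
    omega

theorem PolyTime.min {f g : α → ℕ} (hf : PolyTime f) (hg : PolyTime g) :
    PolyTime fun a => min (f a) (g a) :=
  (PolyTime.ite (PolyDec.le hf hg) hf hg).congr fun _ => (min_def _ _).symm

theorem PolyTime.getD_zero {l : α → List ℕ} {i : α → ℕ} (hl : PolyTime l) (hi : PolyTime i) :
    PolyTime fun a => (l a).getD (i a) 0 := by
  have key : ∀ (l : List ℕ) (i : ℕ), List.tail^[i] l = l.drop i := fun l i => by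
    induction i with
    | zero => rfl
    | succ i ih => rw [Function.iterate_succ_apply', ih, List.tail_drop]
  refine (PolyTime.iterate (step := fun _ s => s.tail) hi hl PolyTime.id.snd.tail
    hl.1 fun a i hi => ?_).headD_zero.congr fun a => ?_
  · rw [key]
    have h₁ := len_append ((l a).take i) ((l a).drop i)
    have h₂ : 1 ≤ len ((l a).take i) := by
      cases (l a).take i with
      | nil => exact le_rfl
      | cons b l => rw [len_cons]; omega
    rw [List.take_append_drop] at h₁
    omega
  · rw [key]
    simp [List.headD_eq_head?_getD, List.head?_drop, List.getD_eq_getElem?_getD]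

theorem PolyTime.replicate {f g : α → ℕ} (hf : PolyTime f) (hg : PolyTime g) :
    PolyTime fun a => List.replicate (f a) (g a) :=
  (hf.range.map (g := fun a _ => g a) (hg.comp PolyTime.id.fst)).congr fun a => by simp

/-- Once the lengths agree, only valid positions are compared and the default value `0` does no
harm. -/
theorem list_eq_iff_getD (l l' : List ℕ) : l = l' ↔ l.length = l'.length ∧
    ((List.range l.length).filter fun i => ¬ l.getD i 0 = l'.getD i 0).length = 0 := by
  simp only [List.length_eq_zero_iff, List.filter_eq_nil_iff, List.mem_range, decide_eq_true_eq,
    not_not]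
  constructor
  · rintro rfl
    simp
  · rintro ⟨h₁, h₂⟩
    refine List.ext_getElem h₁ fun i hi hi' => ?_
    simpa [List.getD_eq_getElem, hi, hi'] using h₂ i hi

theorem PolyDec.list_eq {l l' : α → List ℕ} (hl : PolyTime l) (hl' : PolyTime l') :
    PolyDec fun a => l a = l' a :=
  ((PolyDec.eq hl.length hl'.length).and (.eq_zero (hl.length.range.filter
    (p := fun a i => ¬ (l a).getD i 0 = (l' a).getD i 0)
    (PolyDec.eq ((hl.comp PolyTime.id.fst).getD_zero PolyTime.id.snd)
      ((hl'.comp PolyTime.id.fst).getD_zero PolyTime.id.snd)).not).length)).congr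
    fun _ => (list_eq_iff_getD _ _).symm

end

end While

namespace Roommates

/-! ## Instances given by keys -/

/-- Preferences over pairs that are given by a numerical key (smaller keys are better; ties are
broken lexicographically), and a master poset that is a disjoint union of chains. -/
structure KeyInstance where
  n : ℕ
  bound : ℕ
  key : ℕ → ℕ → ℕ → ℕ
  chain : ℕ → ℕ
  key_lt : ∀ a < n, ∀ b < n, ∀ c < n, key a b c < bound
  key_comm : ∀ a b c, key a b c = key a c b
  key_mono : ∀ a < n, ∀ x < n, ∀ x' < n, ∀ y < n, ∀ y' < n, chain x = chain y →
    chain x' = chain y' → x ≤ y → x' ≤ y' → key a x x' ≤ key a y y'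

namespace KeyInstance

variable (J : KeyInstance)

/-- The pairs of agents other than `a`, the best one first. -/
def pairs (a : Fin J.n) : List (Fin J.n × Fin J.n) :=
  (List.range J.bound).flatMap fun v => (List.finRange J.n).flatMap fun b =>
    (List.finRange J.n).flatMap fun c =>
      if b < c ∧ b ≠ a ∧ c ≠ a ∧ J.key a b c = v then [(b, c)] else []

/-- The position of a pair in the preferences of `a`, up to an order isomorphism. -/
def rank (a b c : Fin J.n) : ℕ :=
  (J.key a b c * J.n + (min b c : Fin J.n)) * J.n + (max b c : Fin J.n)

/-! ### Ranks and their compatibility with the master poset -/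

theorem rank_comm (a b c : Fin J.n) : J.rank a b c = J.rank a c b := by
  rw [rank, rank, J.key_comm, min_comm, max_comm]

theorem lex_lt {n x x' y y' z z' : ℕ} (hy : y < n) (hz : z < n)
    (h : x < x' ∨ x = x' ∧ (y < y' ∨ y = y' ∧ z < z')) :
    (x * n + y) * n + z < (x' * n + y') * n + z' := by
  rcases h with h | ⟨rfl, h | ⟨rfl, h⟩⟩
  · have h₁ : x * n + y + 1 ≤ x' * n + y' := by
      have := Nat.mul_le_mul_right n (Nat.succ_le_of_lt h)
      rw [Nat.succ_mul] at this
      omega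
    have := Nat.mul_le_mul_right n h₁
    rw [Nat.succ_mul] at this
    omega
  · have h₁ : x * n + y + 1 ≤ x * n + y' := by omega
    have := Nat.mul_le_mul_right n h₁
    rw [Nat.succ_mul] at this
    omega
  · omega

theorem rank_lt_of_key_lt {a b c b' c' : Fin J.n} (h : J.key a b c < J.key a b' c') :
    J.rank a b c < J.rank a b' c' :=
  lex_lt (Fin.is_lt _) (Fin.is_lt _) (.inl h)

/-- Key, minimum and maximum of a pair are all monotone under domination, so the lexicographic
tie-breaking does not violate the master poset. -/
theorem rank_le {a x x' y y' : Fin J.n} (h : J.chain x = J.chain y) (h' : J.chain x' = J.chain y')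
    (hx : x ≤ y) (hx' : x' ≤ y') : J.rank a x x' ≤ J.rank a y y' := by
  have h₁ : (min x x' : Fin J.n).1 ≤ (min y y' : Fin J.n).1 := min_le_min hx hx'
  have h₂ : (max x x' : Fin J.n).1 ≤ (max y y' : Fin J.n).1 := max_le_max hx hx'
  exact Nat.add_le_add (Nat.mul_le_mul_right _ (Nat.add_le_add (Nat.mul_le_mul_right _
    (J.key_mono a a.2 x x.2 x' x'.2 y y.2 y' y'.2 h h' hx hx')) h₁)) h₂

/-- Strictness comes from tie-breaking: if the keys agree, a larger agent raises the minimum of the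
pair, or keeps it and raises the maximum. -/
theorem rank_lt {a b c c' : Fin J.n} (h : J.chain c = J.chain c') (hc : c < c') :
    J.rank a b c < J.rank a b c' := by
  have h₁ : J.key a b c ≤ J.key a b c' :=
    J.key_mono a a.2 b b.2 c c.2 b b.2 c' c'.2 rfl h le_rfl hc.le
  refine lex_lt (Fin.is_lt _) (Fin.is_lt _) ?_
  rcases h₁.lt_or_eq with h₁ | h₁
  · exact .inl h₁
  refine .inr ⟨h₁, ?_⟩
  rw [Fin.val_inj, Fin.val_fin_lt, Fin.val_fin_lt]
  rcases le_total b c with h | h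
  · rw [min_eq_left h, min_eq_left (h.trans hc.le), max_eq_right h, max_eq_right (h.trans hc.le)]
    exact .inr ⟨rfl, hc⟩
  · rw [min_eq_right h, max_eq_left h]
    rcases h.lt_or_eq with h | rfl
    · exact .inl (lt_min h hc)
    · exact .inr ⟨(min_eq_left hc.le).symm, by rwa [max_eq_right hc.le]⟩

theorem mem_pairs {a b c : Fin J.n} : (b, c) ∈ J.pairs a ↔ b < c ∧ b ≠ a ∧ c ≠ a := by
  simp only [pairs, List.mem_flatMap, List.mem_range, List.mem_finRange, true_and]
  constructor
  · rintro ⟨v, -, b', c', h⟩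
    split_ifs at h with h'
    · obtain ⟨rfl, rfl⟩ := Prod.mk.inj (List.mem_singleton.1 h)
      exact ⟨h'.1, h'.2.1, h'.2.2.1⟩
    · simp at h
  · rintro ⟨h₁, h₂, h₃⟩
    exact ⟨_, J.key_lt a a.2 b b.2 c c.2, b, c, by simp [h₁, h₂, h₃]⟩

theorem pairwise_pairs (a : Fin J.n) :
    (J.pairs a).Pairwise fun p q => J.rank a p.1 p.2 < J.rank a q.1 q.2 := by
  have hm : ∀ {v : ℕ} {b c : Fin J.n} {p : Fin J.n × Fin J.n},
      (p ∈ if b < c ∧ b ≠ a ∧ c ≠ a ∧ J.key a b c = v then [(b, c)] else []) →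
      p = (b, c) ∧ b < c ∧ J.key a b c = v := by
    intro v b c p h
    split_ifs at h with h'
    · exact ⟨List.mem_singleton.1 h, h'.1, h'.2.2.2⟩
    · simp at h
  have hf : (List.finRange J.n).Pairwise (· < ·) := List.pairwise_lt_finRange _
  refine List.pairwise_flatMap.2 ⟨fun v _ => List.pairwise_flatMap.2 ⟨fun b _ =>
    List.pairwise_flatMap.2 ⟨fun c _ => by split_ifs <;> simp, ?_⟩, ?_⟩, ?_⟩
  · refine hf.imp fun {c c'} hc p hp q hq => ?_
    obtain ⟨rfl, h₁, h₂⟩ := hm hp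
    obtain ⟨rfl, h₃, h₄⟩ := hm hq
    refine lex_lt (Fin.is_lt _) (Fin.is_lt _) (.inr ⟨h₂.trans h₄.symm, .inr ⟨?_, ?_⟩⟩)
    · simp only [min_eq_left h₁.le, min_eq_left h₃.le]
    · simpa only [max_eq_right h₁.le, max_eq_right h₃.le, Fin.lt_def] using hc
  · refine hf.imp fun {b b'} hb p hp q hq => ?_
    obtain ⟨c, -, hp⟩ := List.mem_flatMap.1 hp
    obtain ⟨c', -, hq⟩ := List.mem_flatMap.1 hq
    obtain ⟨rfl, h₁, h₂⟩ := hm hp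
    obtain ⟨rfl, h₃, h₄⟩ := hm hq
    refine lex_lt (Fin.is_lt _) (Fin.is_lt _) (.inr ⟨h₂.trans h₄.symm, .inl ?_⟩)
    simpa only [min_eq_left h₁.le, min_eq_left h₃.le, Fin.lt_def] using hb
  · refine List.pairwise_lt_range.imp fun {v v'} hv p hp q hq => ?_
    obtain ⟨b, -, hp⟩ := List.mem_flatMap.1 hp
    obtain ⟨c, -, hp⟩ := List.mem_flatMap.1 hp
    obtain ⟨b', -, hq⟩ := List.mem_flatMap.1 hq
    obtain ⟨c', -, hq⟩ := List.mem_flatMap.1 hq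
    obtain ⟨rfl, h₁, h₂⟩ := hm hp
    obtain ⟨rfl, h₃, h₄⟩ := hm hq
    exact J.rank_lt_of_key_lt (by rw [h₂, h₄]; exact hv)

theorem pair_inj {m : ℕ} {p q : Fin m × Fin m} (hp : p.1 < p.2) (hq : q.1 < q.2)
    (h : ({p.1, p.2} : Finset (Fin m)) = {q.1, q.2}) : p = q := by
  have h₁ : p.1 ∈ ({q.1, q.2} : Finset (Fin m)) := h ▸ by simp
  have h₂ : p.2 ∈ ({q.1, q.2} : Finset (Fin m)) := h ▸ by simp
  have h₃ : q.1 ∈ ({p.1, p.2} : Finset (Fin m)) := h ▸ by simp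
  have h₄ : q.2 ∈ ({p.1, p.2} : Finset (Fin m)) := h ▸ by simp
  simp only [Finset.mem_insert, Finset.mem_singleton] at h₁ h₂ h₃ h₄
  ext <;> omega

theorem nodup_map_pairs (a : Fin J.n) :
    ((J.pairs a).map fun p => ({p.1, p.2} : Finset (Fin J.n))).Nodup := by
  refine List.Nodup.map_on (fun p hp q hq h => ?_) ?_
  · exact pair_inj (J.mem_pairs.1 hp).1 (J.mem_pairs.1 hq).1 h
  · exact (J.pairwise_pairs a).imp fun h e => by simp [e] at h

theorem pairwise_map_idxOf_lt {ι κ : Type*} [DecidableEq κ] {r : ι → ℕ} {f : ι → κ} {l : List ι}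
    (h : l.Pairwise fun p q => r p < r q) (hn : (l.map f).Nodup) {p q : ι} (hp : p ∈ l)
    (hq : q ∈ l) : (l.map f).idxOf (f p) < (l.map f).idxOf (f q) ↔ r p < r q := by
  obtain ⟨i, hi, rfl⟩ := List.getElem_of_mem hp
  obtain ⟨j, hj, rfl⟩ := List.getElem_of_mem hq
  have e : ∀ (i : ℕ) (hi : i < l.length), (l.map f).idxOf (f l[i]) = i := fun i hi => by
    have := hn.idxOf_getElem i (by simpa using hi)
    simpa using this
  rw [e i hi, e j hj]
  have hlt := List.pairwise_iff_getElem.1 h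
  constructor
  · exact hlt i j hi hj
  · intro h'
    by_contra h₂
    rcases (not_lt.1 h₂).lt_or_eq with h₃ | rfl
    · exact (hlt j i hj hi h₃).not_ge h'.le
    · exact lt_irrefl _ h'

/-- The underlying instance without the poset. -/
def toDSR : DSR 3 where
  n := J.n
  pref a := (J.pairs a).map fun p => {p.1, p.2}
  pref_nodup := J.nodup_map_pairs
  mem_pref a t := by
    simp only [List.mem_map, Prod.exists]
    constructor
    · rintro ⟨b, c, h, rfl⟩
      obtain ⟨h₁, h₂, h₃⟩ := J.mem_pairs.1 h
      exact ⟨by rw [Finset.card_pair h₁.ne], by simp [h₂.symm, h₃.symm]⟩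
    · rintro ⟨h₁, h₂⟩
      obtain ⟨b, c, hbc, rfl⟩ := Finset.card_eq_two.1 (show t.card = 2 by omega)
      simp only [Finset.mem_insert, Finset.mem_singleton, not_or] at h₂
      rcases hbc.lt_or_gt with h | h
      · exact ⟨b, c, J.mem_pairs.2 ⟨h, Ne.symm h₂.1, Ne.symm h₂.2⟩, rfl⟩
      · exact ⟨c, b, J.mem_pairs.2 ⟨h, Ne.symm h₂.2, Ne.symm h₂.1⟩, Finset.pair_comm _ _⟩

theorem exists_mem_pairs {a b c : Fin J.n} (h : b ≠ c) (hb : b ≠ a) (hc : c ≠ a) :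
    ∃ p ∈ J.pairs a, ({b, c} : Finset (Fin J.n)) = {p.1, p.2} ∧
      J.rank a b c = J.rank a p.1 p.2 := by
  rcases h.lt_or_gt with h | h
  · exact ⟨(b, c), J.mem_pairs.2 ⟨h, hb, hc⟩, rfl, rfl⟩
  · exact ⟨(c, b), J.mem_pairs.2 ⟨h, hc, hb⟩, Finset.pair_comm _ _, J.rank_comm _ _ _⟩

/-- This replaces positions in preference lists by comparisons of numbers. -/
theorem prefers_iff {a b c b' c' : Fin J.n} (h : b ≠ c) (hb : b ≠ a) (hc : c ≠ a) (h' : b' ≠ c')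
    (hb' : b' ≠ a) (hc' : c' ≠ a) :
    J.toDSR.Prefers a {b, c} {b', c'} ↔ J.rank a b c < J.rank a b' c' := by
  obtain ⟨p, hp, e, e'⟩ := J.exists_mem_pairs h hb hc
  obtain ⟨q, hq, f, f'⟩ := J.exists_mem_pairs h' hb' hc'
  rw [e', f', ← pairwise_map_idxOf_lt (J.pairwise_pairs a) (J.nodup_map_pairs a) hp hq]
  rw [← e, ← f]
  rfl

/-- The instance of `3`-DSR-Poset. -/
def toDSRPoset : DSRPoset 3 where
  toDSR := J.toDSR
  ge (a b : Fin J.n) := J.chain a = J.chain b ∧ a ≤ b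
  ge_refl _ := ⟨rfl, le_rfl⟩
  ge_antisymm _ _ h h' := le_antisymm h.2 h'.2
  ge_trans _ _ _ h h' := ⟨h.1.trans h'.1, h.2.trans h'.2⟩
  derived v x y hx hy hxv hyv hge := by
    have im : ∀ z : Fin 2 → Fin J.n, Finset.univ.image z = {z 0, z 1} := fun z => by
      ext w
      simp [Fin.exists_fin_two, eq_comm]
    intro h
    have h' : J.toDSR.Prefers v {y 0, y 1} {x 0, x 1} := by
      have ex := im x
      have ey := im y
      exact ex ▸ ey ▸ h
    exact ((J.prefers_iff (hy.ne (by decide)) (hyv _) (hyv _) (hx.ne (by decide)) (hxv _)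
      (hxv _)).1 h').not_ge (J.rank_le (hge 0).1 (hge 1).1 (hge 0).2 (hge 1).2)

/-- An antichain contains at most one agent of each chain, and one representative of each chain
gives an antichain. -/
theorem width_toDSRPoset {w : ℕ} (h₁ : ∀ a < J.n, J.chain a < w)
    (h₂ : ∀ v < w, ∃ a < J.n, J.chain a = v) : J.toDSRPoset.width = w := by
  classical
  refine le_antisymm (Finset.sup_le fun A hA => ?_) ?_
  · have hA' : IsAntichain J.toDSRPoset.ge (A : Set (Fin J.toDSRPoset.n)) :=
      (Finset.mem_filter.1 hA).2
    have := Finset.card_le_card_of_injOn (s := (A : Finset (Fin J.n)))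
      (t := Finset.range w) (fun a => J.chain a)
      (fun a _ => Finset.mem_coe.2 (Finset.mem_range.2 (h₁ a a.2))) fun a ha b hb e => by
        by_contra hab
        rcases le_total a b with h | h
        · exact hA' ha hb hab ⟨e, h⟩
        · exact hA' hb ha (Ne.symm hab) ⟨Eq.symm e, h⟩
    simpa using this
  · choose f hf hf' using h₂
    let g : Fin w → Fin J.n := fun v => ⟨f v v.2, hf v v.2⟩
    have hg : Function.Injective g := fun u v e => by
      have := congrArg (fun a : Fin J.n => J.chain a) e
      simp only [g, hf'] at this
      exact Fin.ext this
    have : (Finset.univ.image g).card = w := by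
      rw [Finset.card_image_of_injective _ hg, Finset.card_univ, Fintype.card_fin]
    refine this.symm.le.trans (Finset.le_sup (f := Finset.card) (Finset.mem_filter.2
      ⟨Finset.mem_univ _, ?_⟩))
    intro a ha b hb hab h
    obtain ⟨u, -, rfl⟩ := Finset.mem_image.1 (Finset.mem_coe.1 ha)
    obtain ⟨v, -, rfl⟩ := Finset.mem_image.1 (Finset.mem_coe.1 hb)
    have : J.chain (g u) = J.chain (g v) := h.1
    simp only [g, hf'] at this
    exact hab (congrArg g (Fin.ext this))

/-- The string that represents the instance, in terms of lists of natural numbers. -/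
def code : List ℕ :=
  (List.replicate J.n 1 ++ [0]) ++
  ((List.range J.n).flatMap fun a => (List.range J.n).map fun b =>
    if J.chain a = J.chain b ∧ a ≤ b then 1 else 0) ++
  (List.range J.n).flatMap fun a => (List.range J.bound).flatMap fun v =>
    (List.range J.n).flatMap fun b => (List.range J.n).flatMap fun c =>
      if b < c ∧ b ≠ a ∧ c ≠ a ∧ J.key a b c = v then
        (List.replicate b 1 ++ [0]) ++ (List.replicate c 1 ++ [0]) else []

/-! ### The encoding of an instance as a list of numbers -/

theorem range_flatMap {κ : Type*} (m : ℕ) (f : ℕ → List κ) :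
    (List.range m).flatMap f = (List.finRange m).flatMap fun a : Fin m => f a := by
  rw [← List.map_coe_finRange_eq_range, List.flatMap_map]

theorem range_map {κ : Type*} (m : ℕ) (f : ℕ → κ) :
    (List.range m).map f = (List.finRange m).map fun a : Fin m => f a := by
  rw [← List.map_coe_finRange_eq_range, List.map_map]
  rfl

theorem map_val_encNat (m : ℕ) :
    (Parameterized.encNat m).map Fin.val = List.replicate m 1 ++ [0] := by
  simp [Parameterized.encNat]

theorem sort_pair {m : ℕ} {b c : Fin m} (h : b < c) :
    ({b, c} : Finset (Fin m)).sort (· ≤ ·) = [b, c] := by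
  rw [Finset.sort_insert (r := (· ≤ ·)) (a := b) (s := {c}) (by simp [h.le]) (by simp [h.ne]),
    Finset.sort_singleton]

/-- Pairs are generated with `b < c`, so listing `b` before `c` agrees with the sorting in the
encoding; the program can emit the string without sorting. -/
theorem map_val_enc : J.toDSRPoset.enc.map Fin.val = J.code := by
  rw [DSRPoset.enc, code, List.map_append, List.map_append, map_val_encNat]
  congr 1
  · congr 1
    rw [range_flatMap, Parameterized.encRel, List.map_flatMap]
    refine List.flatMap_congr fun a _ => ?_
    rw [range_map, List.map_map]
    refine List.map_congr_left fun b _ => ?_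
    simp only [Function.comp_apply]
    have e : J.toDSRPoset.ge a b ↔ J.chain a.1 = J.chain b.1 ∧ a.1 ≤ b.1 := Iff.rfl
    by_cases h : J.chain a.1 = J.chain b.1 ∧ a.1 ≤ b.1
    · rw [if_pos h, if_pos (e.2 h)]
      rfl
    · rw [if_neg h, if_neg (fun h' => h (e.1 h'))]
      rfl
  · rw [range_flatMap, List.map_flatMap]
    refine List.flatMap_congr fun a _ => ?_
    change List.map Fin.val (((J.pairs a).map fun p => ({p.1, p.2} : Finset (Fin J.n))).flatMap
      fun t => (t.sort (· ≤ ·) >>= fun b => pure b.1).flatMap Parameterized.encNat) = _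
    simp only [pairs, List.map_flatMap, List.flatMap_assoc, range_flatMap J.n, List.flatMap_map]
    refine List.flatMap_congr fun v _ => List.flatMap_congr fun b _ =>
      List.flatMap_congr fun c _ => ?_
    by_cases h : b < c ∧ b ≠ a ∧ c ≠ a ∧ J.key a b c = v
    · have h' : b.1 < c.1 ∧ b.1 ≠ a.1 ∧ c.1 ≠ a.1 ∧ J.key a b c = v :=
        ⟨h.1, Fin.val_ne_of_ne h.2.1, Fin.val_ne_of_ne h.2.2.1, h.2.2.2⟩
      rw [if_pos h, if_pos h']
      simp [sort_pair h.1, map_val_encNat]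
    · have h' : ¬ (b.1 < c.1 ∧ b.1 ≠ a.1 ∧ c.1 ≠ a.1 ∧ J.key a b c = v) := fun h' =>
        h ⟨h'.1, fun e => h'.2.1 (congrArg _ e), fun e => h'.2.2.1 (congrArg _ e), h'.2.2.2⟩
      rw [if_neg h, if_neg h']
      rfl

end KeyInstance

end Roommates

namespace Roommates

namespace Gadget

/-! ## The agents

An agent is described by its kind, an index and a level.  Agents of the kinds `0`, `1`, `2`
(written `x`, `y`, `z` below) form chains of length `N`, one chain of each kind for each of the
`2 * S` systems.  Each system has a selector (kind `3`, written `s`), and the systems `2 * τ` and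
`2 * τ + 1` share a gadget of four agents (kinds `4` to `7`).  All agents of kind at least `3` are
chains of their own. -/

abbrev Agent := ℕ × ℕ × ℕ

/-- The value of a pair that is of no interest. -/
def bad (N : ℕ) : ℕ := 3 * N + 5

/-- Preferences inside the gadget of four agents; no matching of the four is stable. -/
def gadgetKey (N κ κ₁ κ₂ : ℕ) : ℕ :=
  if κ = 4 then
    if κ₁ = 5 ∧ κ₂ = 6 then 0 else if κ₁ = 5 ∧ κ₂ = 7 then 1
    else if κ₁ = 6 ∧ κ₂ = 7 then 2 else bad N
  else if κ = 5 then
    if κ₁ = 6 ∧ κ₂ = 7 then 0 else if κ₁ = 4 ∧ κ₂ = 6 then 1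
    else if κ₁ = 4 ∧ κ₂ = 7 then 2 else bad N
  else if κ = 6 then
    if κ₁ = 4 ∧ κ₂ = 7 then 0 else if κ₁ = 5 ∧ κ₂ = 7 then 1
    else if κ₁ = 4 ∧ κ₂ = 5 then 2 else bad N
  else
    if κ₁ = 4 ∧ κ₂ = 5 then 1 else if κ₁ = 4 ∧ κ₂ = 6 then 2
    else if κ₁ = 5 ∧ κ₂ = 6 then 3 else bad N

/-- The key of the pair `p`, `q` for the agent `u`, when the pair is listed in the right order. -/
def orderedKey (N : ℕ) (b : ℕ → ℕ → ℕ → ℕ) (u p q : Agent) : ℕ :=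
  if u.1 = 0 then
    -- A lower y always wins; for the same y the selector is better than a z, so that x gladly joins
    -- the selector at the selected level.
    if p.1 = 1 ∧ p.2.1 = u.2.1 ∧ p.2.2 ≤ u.2.2 ∧ q.2.1 = u.2.1 ∧ q.1 = 3 then 2 * p.2.2
    else if p.1 = 1 ∧ p.2.1 = u.2.1 ∧ p.2.2 ≤ u.2.2 ∧ q.2.1 = u.2.1 ∧ q.1 = 2 then 2 * p.2.2 + 1
    else bad N
  else if u.1 = 1 then
    -- The value for x with the selector is the worst of the three: a selected y can still be lured
    -- away by its selector and a foreign z.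
    if p.1 = 0 ∧ p.2.1 = u.2.1 ∧ q.2.1 = u.2.1 ∧ q.1 = 2 ∧ p.2.2 ≤ u.2.2 then p.2.2
    else if p.1 = 0 ∧ p.2.1 = u.2.1 ∧ q.2.1 = u.2.1 ∧ q.1 = 3 then N + 1
    else if p.1 = 3 ∧ p.2.1 = u.2.1 ∧ q.1 = 2 ∧ q.2.1 ≠ u.2.1 then N
    else bad N
  else if u.1 = 2 then
    -- The last agent of the gadget is the last resort of a z, which it accepts only if its own x
    -- and y are not available.
    if p.1 = 0 ∧ q.1 = 1 ∧ p.2.1 = u.2.1 ∧ q.2.1 = u.2.1 ∧ p.2.2 ≤ u.2.2 then p.2.2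
    else if p.1 = 3 ∧ q.1 = 1 ∧ p.2.1 = q.2.1 ∧ p.2.1 ≠ u.2.1 then N
    else if p.1 = 7 ∧ q.1 = 2 ∧ p.2.1 = u.2.1 / 2 ∧ q.2.1 / 2 = u.2.1 / 2 ∧ q.2.1 ≠ u.2.1 then N + 1
    else bad N
  else if u.1 = 3 then
    -- For a fixed y, the own x lies between the foreign z below the threshold and those from the
    -- threshold on.
    if p.1 = 1 ∧ p.2.1 = u.2.1 ∧ q.1 = 0 ∧ q.2.1 = u.2.1 then 3 * p.2.2 + 1
    else if p.1 = 1 ∧ p.2.1 = u.2.1 ∧ q.1 = 2 ∧ q.2.1 ≠ u.2.1 then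
      if q.2.2 < b u.2.1 p.2.2 q.2.1 then 3 * p.2.2 else 3 * p.2.2 + 2
    else bad N
  else if u.1 = 7 ∧ p.1 = 2 ∧ q.1 = 2 then
    if p.2.1 / 2 = u.2.1 ∧ q.2.1 / 2 = u.2.1 ∧ p.2.1 ≠ q.2.1 ∧ p.2.2 + q.2.2 < N then 0 else bad N
  else if p.2.1 = u.2.1 ∧ q.2.1 = u.2.1 then gadgetKey N u.1 p.1 q.1
  else bad N

/-- The key of the pair `{p, q}` for the agent `u`. -/
def key (N : ℕ) (b : ℕ → ℕ → ℕ → ℕ) (u p q : Agent) : ℕ :=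
  min (orderedKey N b u p q) (orderedKey N b u q p)

/-- The numbering of the agents. -/
def decode (S N a : ℕ) : Agent :=
  if a < 6 * S * N then (a / N % 3, a / N / 3, a % N)
  else if a < 6 * S * N + 2 * S then (3, a - 6 * S * N, 0)
  else (4 + (a - (6 * S * N + 2 * S)) % 4, (a - (6 * S * N + 2 * S)) / 4, 0)

def encode (S N : ℕ) (u : Agent) : ℕ :=
  if u.1 < 3 then (3 * u.2.1 + u.1) * N + u.2.2
  else if u.1 = 3 then 6 * S * N + u.2.1
  else 6 * S * N + 2 * S + 4 * u.2.1 + (u.1 - 4)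

/-- Every chain is an interval of consecutive numbers. The `6 * S` long chains are followed by `2 *
S` selectors and `4 * S` gadget agents, each a chain of its own. -/
def chain (S N a : ℕ) : ℕ := if a < 6 * S * N then a / N else 6 * S + (a - 6 * S * N)

def Valid (S N : ℕ) (u : Agent) : Prop :=
  u.1 < 3 ∧ u.2.1 < 2 * S ∧ u.2.2 < N ∨ u.1 = 3 ∧ u.2.1 < 2 * S ∧ u.2.2 = 0 ∨
    4 ≤ u.1 ∧ u.1 < 8 ∧ u.2.1 < S ∧ u.2.2 = 0

variable {S N : ℕ} {b : ℕ → ℕ → ℕ → ℕ}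

/-! ### Bijectivity of the numbering, and the chains -/

theorem Valid.level_lt (hN : 0 < N) {u : Agent} (h : Valid S N u) : u.2.2 < N := by
  unfold Valid at h
  omega

theorem valid_decode {a : ℕ} (h : a < 6 * S * N + 6 * S) : Valid S N (decode S N a) := by
  unfold decode Valid
  split_ifs with h₁ h₂
  · have hN : 0 < N := Nat.pos_of_ne_zero fun e => by simp [e] at h₁
    have h₃ : a / N < 6 * S := Nat.div_lt_of_lt_mul (by rwa [Nat.mul_comm])
    have h₄ := Nat.mod_lt a hN
    exact .inl ⟨Nat.mod_lt _ (by norm_num), by simp only; omega, h₄⟩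
  · exact .inr (.inl ⟨rfl, by simp only; omega, rfl⟩)
  · exact .inr (.inr ⟨by simp only; omega, by simp only; omega, by simp only; omega, rfl⟩)

theorem encode_decode (a : ℕ) : encode S N (decode S N a) = a := by
  unfold decode
  split_ifs with h₁ h₂ <;> unfold encode <;> simp only
  · rw [if_pos (Nat.mod_lt _ (by norm_num)), Nat.div_add_mod, Nat.mul_comm, Nat.div_add_mod]
  · rw [if_neg (by omega), if_pos trivial]
    omega
  · rw [if_neg (by omega), if_neg (by omega)]
    omega

theorem encode_lt {u : Agent} (h : Valid S N u) : encode S N u < 6 * S * N + 6 * S := by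
  unfold encode
  rcases h with h | h | h
  · rw [if_pos h.1]
    have h₁ : 3 * u.2.1 + u.1 + 1 ≤ 6 * S := by omega
    have := Nat.mul_le_mul_right N h₁
    rw [Nat.succ_mul] at this
    omega
  · rw [if_neg (by omega), if_pos h.1]
    omega
  · rw [if_neg (by omega), if_neg (by omega)]
    omega

theorem decode_encode {u : Agent} (h : Valid S N u) : decode S N (encode S N u) = u := by
  obtain ⟨κ, π, i⟩ := u
  unfold encode
  rcases h with h | h | h <;> simp only at h
  · have hN : 0 < N := by omega
    have h₁ : 3 * π + κ + 1 ≤ 6 * S := by omega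
    have h₂ := Nat.mul_le_mul_right N h₁
    rw [Nat.succ_mul] at h₂
    simp only [h.1, if_true]
    unfold decode
    rw [if_pos (by omega)]
    have h₃ : ((3 * π + κ) * N + i) / N = 3 * π + κ := by
      rw [Nat.mul_comm, Nat.mul_add_div hN, Nat.div_eq_of_lt h.2.2, Nat.add_zero]
    have h₄ : ((3 * π + κ) * N + i) % N = i := by
      rw [Nat.mul_comm, Nat.mul_add_mod, Nat.mod_eq_of_lt h.2.2]
    rw [h₃, h₄]
    ext <;> simp only <;> omega
  · obtain ⟨rfl, h₁, rfl⟩ := h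
    simp only [show ¬ (3 < 3) by omega, if_false, if_true]
    unfold decode
    rw [if_neg (by omega), if_pos (by omega)]
    ext <;> simp only
    omega
  · obtain ⟨h₀, h₀', h₁, rfl⟩ := h
    simp only [show ¬ (κ < 3) by omega, show ¬ (κ = 3) by omega, if_false]
    unfold decode
    rw [if_neg (by omega), if_neg (by omega)]
    ext <;> simp only <;> omega

theorem decode_of_chain_eq {a a' : ℕ} (ha' : a' < 6 * S * N + 6 * S)
    (h : chain S N a = chain S N a') (hle : a ≤ a') :
    (decode S N a).1 = (decode S N a').1 ∧ (decode S N a).2.1 = (decode S N a').2.1 ∧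
      (decode S N a).2.2 ≤ (decode S N a').2.2 := by
  unfold chain at h
  by_cases h₁ : a' < 6 * S * N
  · rw [if_pos h₁, if_pos (by omega)] at h
    unfold decode
    rw [if_pos h₁, if_pos (show a < 6 * S * N by omega), h]
    refine ⟨rfl, rfl, ?_⟩
    have := Nat.div_add_mod a N
    have := Nat.div_add_mod a' N
    rw [h] at *
    simp only
    omega
  · by_cases h₂ : a < 6 * S * N
    · rw [if_neg h₁, if_pos h₂] at h
      have h₃ : a / N < 6 * S := Nat.div_lt_of_lt_mul (by rwa [Nat.mul_comm])
      omega
    · rw [if_neg h₁, if_neg h₂] at h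
      obtain rfl : a = a' := by omega
      exact ⟨rfl, rfl, le_rfl⟩

theorem chain_lt {a : ℕ} (h : a < 6 * S * N + 6 * S) : chain S N a < 12 * S := by
  unfold chain
  split_ifs with h₁
  · have h₃ : a / N < 6 * S := Nat.div_lt_of_lt_mul (by rwa [Nat.mul_comm])
    omega
  · omega

theorem exists_chain_eq (hN : 0 < N) {v : ℕ} (h : v < 12 * S) :
    ∃ a < 6 * S * N + 6 * S, chain S N a = v := by
  by_cases h₁ : v < 6 * S
  · have h₂ : v * N < 6 * S * N := Nat.mul_lt_mul_of_pos_right h₁ hN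
    refine ⟨v * N, by omega, ?_⟩
    rw [chain, if_pos h₂, Nat.mul_div_cancel _ hN]
  · refine ⟨6 * S * N + (v - 6 * S), by omega, ?_⟩
    rw [chain, if_neg (by omega)]
    omega

theorem chain_encode_eq {u v : Agent} (hu : Valid S N u) (hv : Valid S N v) (h₁ : u.1 = v.1)
    (h₂ : u.2.1 = v.2.1) : chain S N (encode S N u) = chain S N (encode S N v) := by
  obtain ⟨κ, π, i⟩ := u
  obtain ⟨κ', π', j⟩ := v
  obtain rfl : κ = κ' := h₁
  obtain rfl : π = π' := h₂
  unfold encode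
  by_cases h : κ < 3
  · have h₃ : 3 * π + κ + 1 ≤ 6 * S := by simp only [Valid] at hu; omega
    have h₄ := Nat.mul_le_mul_right N h₃
    rw [Nat.succ_mul] at h₄
    have hi : i < N := by simp only [Valid] at hu; omega
    have hj : j < N := by simp only [Valid] at hv; omega
    have h₅ : ∀ i < N, ((3 * π + κ) * N + i) / N = 3 * π + κ := fun i hi => by
      rw [Nat.mul_comm, Nat.mul_add_div (by omega), Nat.div_eq_of_lt hi, Nat.add_zero]
    simp only [h, if_true]
    unfold chain
    rw [if_pos (by omega), if_pos (by omega), h₅ i hi, h₅ j hj]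
  · simp only [h, if_false]

/-! ### Monotonicity of the keys -/

theorem gadgetKey_le (κ κ₁ κ₂ : ℕ) : gadgetKey N κ κ₁ κ₂ ≤ bad N := by
  unfold gadgetKey bad
  split_ifs <;> omega

theorem orderedKey_le {u p q : Agent} (hp : p.2.2 < N) : orderedKey N b u p q ≤ bad N := by
  have := gadgetKey_le (N := N) u.1 p.1 q.1
  unfold orderedKey
  unfold bad at *
  split_ifs <;> omega

/-- Levels enter the conditions only through upper bounds, so raising a level can only turn a good
pair into a bad one; within a branch the values grow with the level of `p`. -/
theorem orderedKey_mono {u p q p' q' : Agent} (hp : p'.2.2 < N) (h₁ : p.1 = p'.1)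
    (h₂ : p.2.1 = p'.2.1) (h₃ : p.2.2 ≤ p'.2.2) (h₄ : q.1 = q'.1) (h₅ : q.2.1 = q'.2.1)
    (h₆ : q.2.2 ≤ q'.2.2) : orderedKey N b u p q ≤ orderedKey N b u p' q' := by
  obtain ⟨κ, π, i⟩ := p
  obtain ⟨κ', π', j⟩ := q
  obtain ⟨_, _, i'⟩ := p'
  obtain ⟨_, _, j'⟩ := q'
  simp only at hp h₁ h₂ h₃ h₄ h₅ h₆
  subst h₁ h₂ h₄ h₅
  have := gadgetKey_le (N := N) u.1 κ κ'
  unfold bad at this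
  unfold orderedKey bad
  simp only
  -- The threshold `b` depends on the level of `p`. For equal levels it is the same number on both
  -- sides; otherwise `3 * c + 2 < 3 * (c + 1)` decides.
  rcases h₃.lt_or_eq with h₃ | rfl <;> split_ifs <;> omega

theorem key_comm (u p q : Agent) : key N b u p q = key N b u q p := min_comm _ _

theorem key_mono {u p q p' q' : Agent} (hp : p'.2.2 < N) (hq : q'.2.2 < N) (h₁ : p.1 = p'.1)
    (h₂ : p.2.1 = p'.2.1) (h₃ : p.2.2 ≤ p'.2.2) (h₄ : q.1 = q'.1) (h₅ : q.2.1 = q'.2.1)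
    (h₆ : q.2.2 ≤ q'.2.2) : key N b u p q ≤ key N b u p' q' :=
  min_le_min (orderedKey_mono hp h₁ h₂ h₃ h₄ h₅ h₆) (orderedKey_mono hq h₄ h₅ h₆ h₁ h₂ h₃)

/-- The instance with `S` pairs of systems, chains of length `N`, and lower bounds `b`. -/
def inst (S N : ℕ) (hN : 0 < N) (b : ℕ → ℕ → ℕ → ℕ) : KeyInstance where
  n := 6 * S * N + 6 * S
  bound := bad N + 1
  key a a₁ a₂ := key N b (decode S N a) (decode S N a₁) (decode S N a₂)
  chain := chain S N
  key_lt _ _ _ h _ _ :=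
    Nat.lt_succ_of_le ((min_le_left _ _).trans (orderedKey_le ((valid_decode h).level_lt hN)))
  key_comm _ _ _ := key_comm _ _ _
  key_mono a _ x _ x' _ y hy y' hy' h h' hx hx' := by
    obtain ⟨h₁, h₂, h₃⟩ := decode_of_chain_eq hy h hx
    obtain ⟨h₄, h₅, h₆⟩ := decode_of_chain_eq hy' h' hx'
    exact key_mono ((valid_decode hy).level_lt hN) ((valid_decode hy').level_lt hN)
      h₁ h₂ h₃ h₄ h₅ h₆

theorem width_inst (hN : 0 < N) : (inst S N hN b).toDSRPoset.width = 12 * S :=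
  (inst S N hN b).width_toDSRPoset (fun _ => chain_lt) fun _ => exists_chain_eq hN

/-- The number of an agent. -/
def num {hN : 0 < N} {u : Agent} (hu : Valid S N u) : Fin (inst S N hN b).n :=
  ⟨encode S N u, encode_lt hu⟩

/-- The position of the pair `{v, w}` in the preferences of `u`. -/
def rank (S N : ℕ) (b : ℕ → ℕ → ℕ → ℕ) (u v w : Agent) : ℕ :=
  (key N b u v w * (6 * S * N + 6 * S) + min (encode S N v) (encode S N w)) *
    (6 * S * N + 6 * S) + max (encode S N v) (encode S N w)

theorem rank_comm (u v w : Agent) : rank S N b u v w = rank S N b u w v := by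
  rw [rank, rank, key_comm, min_comm, max_comm]

theorem rank_decode (hN : 0 < N) (a₁ a₂ a₃ : Fin (inst S N hN b).n) :
    (inst S N hN b).rank a₁ a₂ a₃ =
      rank S N b (decode S N a₁) (decode S N a₂) (decode S N a₃) := by
  rw [rank, encode_decode, encode_decode, KeyInstance.rank]
  have h₁ : ((min a₂ a₃ : Fin (inst S N hN b).n) : ℕ) = min a₂.1 a₃.1 :=
    Fin.val_strictMono.monotone.map_min
  have h₂ : ((max a₂ a₃ : Fin (inst S N hN b).n) : ℕ) = max a₂.1 a₃.1 :=
    Fin.val_strictMono.monotone.map_max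
  rw [h₁, h₂]
  rfl

theorem key_le_of_rank_le {u v w v' w' : Agent} (hv : Valid S N v) (hw : Valid S N w)
    (h : rank S N b u v' w' ≤ rank S N b u v w) : key N b u v' w' ≤ key N b u v w := by
  by_contra h'
  exact (KeyInstance.lex_lt (min_lt_of_left_lt (encode_lt hv))
    (max_lt (encode_lt hv) (encode_lt hw)) (.inl (not_le.1 h'))).not_ge h

theorem rank_num {hN : 0 < N} {u v w : Agent} (hu : Valid S N u) (hv : Valid S N v)
    (hw : Valid S N w) :
    (inst S N hN b).rank (num hu) (num hv) (num hw) = rank S N b u v w := by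
  rw [rank_decode]
  simp only [num, decode_encode, hu, hv, hw]

/-- This is needed where the key ignores the level of `w`: the tie-break still prefers the lower
level. -/
theorem rank_lt_of_level_lt {u v w w' : Agent} (hu : Valid S N u) (hv : Valid S N v)
    (hw : Valid S N w) (hw' : Valid S N w') (h₁ : w.1 = w'.1) (h₂ : w.2.1 = w'.2.1)
    (h : w.2.2 < w'.2.2) : rank S N b u v w < rank S N b u v w' := by
  have h₃ : w.1 < 3 := by
    unfold Valid at hw hw'
    omega
  have hN : 0 < N := by
    unfold Valid at hw
    omega
  rw [← rank_num (hN := hN) hu hv hw, ← rank_num (hN := hN) hu hv hw']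
  refine (inst S N hN b).rank_lt (chain_encode_eq hw hw' h₁ h₂) ?_
  rw [Fin.lt_def]
  simp only [num, encode, h₃, if_true, ← h₁, ← h₂]
  omega

/-! ## The form of the pairs with a good key -/

theorem of_orderedKey_x {π i : ℕ} {p q : Agent} (h : orderedKey N b (0, π, i) p q < bad N) :
    ∃ a l, a ≤ i ∧ p = (1, π, a) ∧ (q = (3, π, l) ∧ orderedKey N b (0, π, i) p q = 2 * a ∨
      q = (2, π, l) ∧ orderedKey N b (0, π, i) p q = 2 * a + 1) := by
  obtain ⟨κ, ρ, j⟩ := p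
  obtain ⟨κ', ρ', j'⟩ := q
  unfold orderedKey at *
  simp only [if_true] at *
  split_ifs at h ⊢ with h₁ h₂
  · obtain ⟨rfl, rfl, h₃, rfl, rfl⟩ := h₁
    exact ⟨j, j', h₃, rfl, .inl ⟨rfl, rfl⟩⟩
  · obtain ⟨rfl, rfl, h₃, rfl, rfl⟩ := h₂
    exact ⟨j, j', h₃, rfl, .inr ⟨rfl, rfl⟩⟩
  · exact absurd h (lt_irrefl _)

theorem of_orderedKey_y {π i : ℕ} {p q : Agent} (h : orderedKey N b (1, π, i) p q < bad N) :
    (∃ a l, a ≤ i ∧ p = (0, π, a) ∧ q = (2, π, l) ∧ orderedKey N b (1, π, i) p q = a) ∨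
    (∃ a l, p = (0, π, a) ∧ q = (3, π, l) ∧ orderedKey N b (1, π, i) p q = N + 1) ∨
    ∃ l ρ j, ρ ≠ π ∧ p = (3, π, l) ∧ q = (2, ρ, j) ∧ orderedKey N b (1, π, i) p q = N := by
  obtain ⟨κ, ρ, j⟩ := p
  obtain ⟨κ', ρ', j'⟩ := q
  unfold orderedKey at *
  simp only [one_ne_zero, if_true, if_false] at *
  split_ifs at h ⊢ with h₁ h₂ h₃
  · obtain ⟨rfl, rfl, rfl, rfl, h₃⟩ := h₁
    exact .inl ⟨j, j', h₃, rfl, rfl, rfl⟩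
  · obtain ⟨rfl, rfl, rfl, rfl⟩ := h₂
    exact .inr (.inl ⟨j, j', rfl, rfl, rfl⟩)
  · obtain ⟨rfl, rfl, rfl, h₄⟩ := h₃
    exact .inr (.inr ⟨j, ρ', j', h₄, rfl, rfl, rfl⟩)
  · exact absurd h (lt_irrefl _)

theorem of_orderedKey_z {π i : ℕ} {p q : Agent} (h : orderedKey N b (2, π, i) p q < bad N) :
    (∃ a l, a ≤ i ∧ p = (0, π, a) ∧ q = (1, π, l) ∧ orderedKey N b (2, π, i) p q = a) ∨
    (∃ ρ l c, ρ ≠ π ∧ p = (3, ρ, l) ∧ q = (1, ρ, c) ∧ orderedKey N b (2, π, i) p q = N) ∨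
    ∃ l ρ j, ρ / 2 = π / 2 ∧ ρ ≠ π ∧ p = (7, π / 2, l) ∧ q = (2, ρ, j) ∧
      orderedKey N b (2, π, i) p q = N + 1 := by
  obtain ⟨κ, ρ, j⟩ := p
  obtain ⟨κ', ρ', j'⟩ := q
  unfold orderedKey at *
  simp only [OfNat.ofNat_ne_zero, OfNat.ofNat_ne_one, if_true, if_false] at *
  split_ifs at h ⊢ with h₁ h₂ h₃
  · obtain ⟨rfl, rfl, rfl, rfl, h₃⟩ := h₁
    exact .inl ⟨j, j', h₃, rfl, rfl, rfl⟩
  · obtain ⟨rfl, rfl, rfl, h₃⟩ := h₂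
    exact .inr (.inl ⟨ρ, j, j', h₃, rfl, rfl, rfl⟩)
  · obtain ⟨rfl, rfl, rfl, h₄, h₅⟩ := h₃
    exact .inr (.inr ⟨j, ρ', j', h₄, h₅, rfl, rfl, rfl⟩)
  · exact absurd h (lt_irrefl _)

theorem of_orderedKey_s {π i : ℕ} {p q : Agent} (h : orderedKey N b (3, π, i) p q < bad N) :
    (∃ c a, p = (1, π, c) ∧ q = (0, π, a) ∧ orderedKey N b (3, π, i) p q = 3 * c + 1) ∨
    ∃ c ρ j, ρ ≠ π ∧ p = (1, π, c) ∧ q = (2, ρ, j) ∧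
      (j < b π c ρ ∧ orderedKey N b (3, π, i) p q = 3 * c ∨
        orderedKey N b (3, π, i) p q = 3 * c + 2) := by
  obtain ⟨κ, ρ, j⟩ := p
  obtain ⟨κ', ρ', j'⟩ := q
  unfold orderedKey at *
  simp only [OfNat.ofNat_ne_zero, OfNat.ofNat_ne_one, show (3 : ℕ) ≠ 2 by decide, if_true,
    if_false] at *
  split_ifs at h ⊢ with h₁ h₂ h₃
  · obtain ⟨rfl, rfl, rfl, rfl⟩ := h₁
    exact .inl ⟨j, j', rfl, rfl, rfl⟩
  · obtain ⟨rfl, rfl, rfl, h₄⟩ := h₂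
    exact .inr ⟨j, ρ', j', h₄, rfl, rfl, .inl ⟨h₃, rfl⟩⟩
  · obtain ⟨rfl, rfl, rfl, h₄⟩ := h₂
    exact .inr ⟨j, ρ', j', h₄, rfl, rfl, .inr rfl⟩
  · exact absurd h (lt_irrefl _)

theorem of_orderedKey_t {τ i : ℕ} {p q : Agent} (h : orderedKey N b (7, τ, i) p q < bad N) :
    (∃ π π' j j', π / 2 = τ ∧ π' / 2 = τ ∧ π ≠ π' ∧ j + j' < N ∧ p = (2, π, j) ∧ q = (2, π', j')) ∨
    (∃ l l', p = (4, τ, l) ∧ q = (5, τ, l') ∧ orderedKey N b (7, τ, i) p q = 1) ∨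
    (∃ l l', p = (4, τ, l) ∧ q = (6, τ, l') ∧ orderedKey N b (7, τ, i) p q = 2) ∨
    ∃ l l', p = (5, τ, l) ∧ q = (6, τ, l') ∧ orderedKey N b (7, τ, i) p q = 3 := by
  obtain ⟨κ, ρ, j⟩ := p
  obtain ⟨κ', ρ', j'⟩ := q
  unfold orderedKey gadgetKey at *
  simp only [OfNat.ofNat_ne_zero, OfNat.ofNat_ne_one, show (7 : ℕ) ≠ 2 by decide,
    show (7 : ℕ) ≠ 3 by decide, show (7 : ℕ) ≠ 4 by decide, show (7 : ℕ) ≠ 5 by decide,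
    show (7 : ℕ) ≠ 6 by decide, true_and, if_false] at *
  split_ifs at h ⊢ with h₁ h₂ h₃ h₄ h₅ h₆
  · obtain ⟨rfl, rfl⟩ := h₁
    exact .inl ⟨ρ, ρ', j, j', h₂.1, h₂.2.1, h₂.2.2.1, h₂.2.2.2, rfl, rfl⟩
  · exact absurd h (lt_irrefl _)
  · obtain ⟨rfl, rfl⟩ := h₃
    obtain ⟨rfl, rfl⟩ := h₄
    exact .inr (.inl ⟨j, j', rfl, rfl, rfl⟩)
  · obtain ⟨rfl, rfl⟩ := h₃
    obtain ⟨rfl, rfl⟩ := h₅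
    exact .inr (.inr (.inl ⟨j, j', rfl, rfl, rfl⟩))
  · obtain ⟨rfl, rfl⟩ := h₃
    obtain ⟨rfl, rfl⟩ := h₆
    exact .inr (.inr (.inr ⟨j, j', rfl, rfl, rfl⟩))
  · exact absurd h (lt_irrefl _)
  · exact absurd h (lt_irrefl _)

theorem of_orderedKey_gadget {κ τ i : ℕ} (hκ : κ = 4 ∨ κ = 5 ∨ κ = 6) {p q : Agent}
    (h : orderedKey N b (κ, τ, i) p q < bad N) :
    ∃ κ₁ κ₂ l l', p = (κ₁, τ, l) ∧ q = (κ₂, τ, l') ∧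
      orderedKey N b (κ, τ, i) p q = gadgetKey N κ κ₁ κ₂ := by
  obtain ⟨κ₁, ρ, j⟩ := p
  obtain ⟨κ₂, ρ', j'⟩ := q
  unfold orderedKey at *
  simp only [show κ ≠ 0 by omega, show κ ≠ 1 by omega, show κ ≠ 2 by omega, show κ ≠ 3 by omega,
    show κ ≠ 7 by omega, false_and, if_false] at *
  split_ifs at h ⊢ with h₁
  · obtain ⟨rfl, rfl⟩ := h₁
    exact ⟨κ₁, κ₂, j, j', rfl, rfl, rfl⟩
  · exact absurd h (lt_irrefl _)

end Gadget

end Roommates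

namespace Roommates

namespace Gadget

variable {S N : ℕ} {b : ℕ → ℕ → ℕ → ℕ}

/-! ## Stable matchings yield selections -/

/-- A selection of one level for each system that respects the lower bounds `b`. -/
def Selection (S N : ℕ) (b : ℕ → ℕ → ℕ → ℕ) (sel : ℕ → ℕ) : Prop :=
  (∀ π < 2 * S, sel π < N) ∧ (∀ τ < S, sel (2 * τ) + sel (2 * τ + 1) < N) ∧
    ∀ π < 2 * S, ∀ ρ < 2 * S, ρ ≠ π → b π (sel π) ρ ≤ sel ρ

/-- `u` has partners in `m` that it likes at least as much as `v` and `w`. -/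
def Content (S N : ℕ) (b : ℕ → ℕ → ℕ → ℕ) (m : Agent → Agent → Agent → Prop) (u v w : Agent) :
    Prop :=
  ∃ p q, m u p q ∧ rank S N b u p q ≤ rank S N b u v w

/-- The relation `m u v w` (`{u, v, w}` is a member of the matching) for a stable matching. -/
structure IsStable (S N : ℕ) (b : ℕ → ℕ → ℕ → ℕ) (m : Agent → Agent → Agent → Prop) : Prop where
  valid : ∀ {u v w}, m u v w → Valid S N u
  rot : ∀ {u v w}, m u v w → m v w u
  swap : ∀ {u v w}, m u v w → m u w v
  uniq : ∀ {u v w v' w'}, m u v w → m u v' w' → v' = v ∧ w' = w ∨ v' = w ∧ w' = v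
  stable : ∀ {u v w}, Valid S N u → Valid S N v → Valid S N w → u ≠ v → v ≠ w → u ≠ w →
    ¬ m u v w → Content S N b m u v w ∨ Content S N b m v w u ∨ Content S N b m w u v

namespace IsStable

variable {m : Agent → Agent → Agent → Prop}

/-- The key of a pair is a minimum over its two orders; as `m` is symmetric in the partners, the
order attaining it can be chosen. -/
theorem exists_orderedKey_le (hm : IsStable S N b m) {u v w : Agent}
    (hv : Valid S N v) (hw : Valid S N w)
    (h : Content S N b m u v w) :
    ∃ p q, m u p q ∧ rank S N b u p q ≤ rank S N b u v w ∧
      orderedKey N b u p q ≤ key N b u v w := by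
  obtain ⟨p, q, h₁, h₂⟩ := h
  rcases min_le_iff.1 (key_le_of_rank_le hv hw h₂) with h₃ | h₃
  · exact ⟨p, q, h₁, h₂, h₃⟩
  · exact ⟨q, p, hm.swap h₁, by rwa [rank_comm], h₃⟩

theorem not_mem_of_uniq (hm : IsStable S N b m) {u v w p q : Agent} (h : m u v w)
    (h' : m u p q) (h₁ : p ≠ v) (h₂ : p ≠ w) : False := by
  rcases hm.uniq h h' with h₃ | h₃
  · exact h₁ h₃.1
  · exact h₂ h₃.1

/-- At the first level whose `x`, `y`, `z` are not matched together, `x` and `y` are with the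
selector. -/
theorem selector_matched (hm : IsStable S N b m) {π c : ℕ} (hπ : π < 2 * S) (hc : c < N)
    (hlt : ∀ j < c, m (0, π, j) (1, π, j) (2, π, j)) (h : ¬ m (0, π, c) (1, π, c) (2, π, c)) :
    m (0, π, c) (1, π, c) (3, π, 0) := by
  have vx : Valid S N (0, π, c) := .inl ⟨by simp, hπ, hc⟩
  have vy : Valid S N (1, π, c) := .inl ⟨by simp, hπ, hc⟩
  have vz : Valid S N (2, π, c) := .inl ⟨by simp, hπ, hc⟩
  have hx : ∀ {a p q}, a < c → m (0, π, a) p q → p = (1, π, a) ∨ p = (2, π, a) := by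
    intro a p q ha h'
    rcases hm.uniq (hlt a ha) h' with h | h
    · exact .inl h.1
    · exact .inr h.1
  have hy : ∀ {a p q}, a < c → m (1, π, a) p q → p = (2, π, a) ∨ p = (0, π, a) := by
    intro a p q ha h'
    rcases hm.uniq (hm.rot (hlt a ha)) h' with h | h
    · exact .inl h.1
    · exact .inr h.1
  have hz : ∀ {a p q}, a < c → m (2, π, a) p q → p = (0, π, a) ∨ p = (1, π, a) := by
    intro a p q ha h'
    rcases hm.uniq (hm.rot (hm.rot (hlt a ha))) h' with h | h
    · exact .inl h.1
    · exact .inr h.1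
  -- The natural triple of level `c` does not block, so one of its members is content. Good partners
  -- below level `c` are used up by their own triples, and replacing the third agent by one above
  -- level `c` loses the tie-break. Only x with y and the selector survives.
  rcases hm.stable vx vy vz (by simp) (by simp) (by simp) h with h₁ | h₁ | h₁
  · obtain ⟨p, q, h₁, h₂, h₃⟩ := hm.exists_orderedKey_le vy vz h₁
    have h₄ : orderedKey N b (0, π, c) p q ≤ 2 * c + 1 :=
      h₃.trans ((min_le_left _ _).trans (by simp [orderedKey]))
    obtain ⟨a, l, ha, rfl, h₅⟩ := of_orderedKey_x (lt_of_le_of_lt h₄ (by unfold bad; omega))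
    rcases ha.lt_or_eq with ha | rfl
    · rcases hy ha (hm.swap (hm.rot h₁)) with h | h <;> simp at h
      · omega
    · rcases h₅ with ⟨rfl, -⟩ | ⟨rfl, -⟩
      · have := hm.valid (hm.rot (hm.rot h₁))
        obtain rfl : l = 0 := by
          rcases this with h | h | h <;> simp at h
          exact h.2
        exact h₁
      · exfalso
        rcases lt_trichotomy l a with hl | rfl | hl
        · rcases hz hl (hm.rot (hm.rot h₁)) with h | h <;> simp at h
          · omega
        · exact h h₁
        · exact (rank_lt_of_level_lt vx vy vz (hm.valid (hm.rot (hm.rot h₁))) rfl rfl hl).not_ge h₂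
  · exfalso
    obtain ⟨p, q, h₁, h₂, h₃⟩ := hm.exists_orderedKey_le vz vx h₁
    have h₄ : orderedKey N b (1, π, c) p q ≤ c :=
      h₃.trans ((min_le_right _ _).trans (by simp [orderedKey]))
    rcases of_orderedKey_y (lt_of_le_of_lt h₄ (by unfold bad; omega)) with
      ⟨a, l, ha, rfl, rfl, -⟩ | ⟨a, l, -, -, h₅⟩ | ⟨l, ρ, j, -, -, -, h₅⟩
    · rcases ha.lt_or_eq with ha | rfl
      · rcases hx ha (hm.swap (hm.rot h₁)) with h | h <;> simp at h
        · omega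
      · rcases lt_trichotomy l a with hl | rfl | hl
        · rcases hz hl (hm.rot (hm.rot h₁)) with h | h <;> simp at h
          · omega
        · exact h (hm.swap (hm.rot h₁))
        · rw [rank_comm _ (2, π, a)] at h₂
          exact (rank_lt_of_level_lt vy vx vz (hm.valid (hm.rot (hm.rot h₁))) rfl rfl hl).not_ge h₂
    · omega
    · omega
  · exfalso
    obtain ⟨p, q, h₁, h₂, h₃⟩ := hm.exists_orderedKey_le vx vy h₁
    have h₄ : orderedKey N b (2, π, c) p q ≤ c :=
      h₃.trans ((min_le_left _ _).trans (by simp [orderedKey]))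
    rcases of_orderedKey_z (lt_of_le_of_lt h₄ (by unfold bad; omega)) with
      ⟨a, l, ha, rfl, rfl, -⟩ | ⟨ρ, l, j, -, -, -, h₅⟩ | ⟨l, ρ, j, -, -, -, -, h₅⟩
    · rcases ha.lt_or_eq with ha | rfl
      · rcases hx ha (hm.swap (hm.rot h₁)) with h | h <;> simp at h
        · omega
      · rcases lt_trichotomy l a with hl | rfl | hl
        · rcases hy hl (hm.rot (hm.rot h₁)) with h | h <;> simp at h
          · omega
        · exact h (hm.rot h₁)
        · exact (rank_lt_of_level_lt vz vx vy (hm.valid (hm.rot (hm.rot h₁))) rfl rfl hl).not_ge h₂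
    · omega
    · omega

/-- The first three agents of a gadget have good pairs only inside it, so their contentment concerns
just the triples of that gadget. -/
theorem gadget_content (hm : IsStable S N b m) {κ τ r : ℕ} (hκ : κ = 4 ∨ κ = 5 ∨ κ = 6)
    {v w : Agent} (hv : Valid S N v) (hw : Valid S N w) (h : Content S N b m (κ, τ, 0) v w)
    (hr : key N b (κ, τ, 0) v w ≤ r) (hr' : r < bad N) :
    ∃ κ₁ κ₂, m (κ, τ, 0) (κ₁, τ, 0) (κ₂, τ, 0) ∧ gadgetKey N κ κ₁ κ₂ ≤ r := by
  obtain ⟨p, q, h₁, -, h₃⟩ := hm.exists_orderedKey_le hv hw h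
  obtain ⟨κ₁, κ₂, l, l', rfl, rfl, h₄⟩ := of_orderedKey_gadget hκ (lt_of_le_of_lt (h₃.trans hr) hr')
  have h₅ : gadgetKey N κ κ₁ κ₂ ≤ r := by omega
  have h₆ : 4 ≤ κ₁ ∧ 4 ≤ κ₂ := by
    unfold gadgetKey at h₅
    split_ifs at h₅ <;> omega
  have h₇ := hm.valid (hm.rot h₁)
  have h₈ := hm.valid (hm.rot (hm.rot h₁))
  simp only [Valid] at h₇ h₈
  obtain rfl : l = 0 := by omega
  obtain rfl : l' = 0 := by omega
  exact ⟨κ₁, κ₂, h₁, h₅⟩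

theorem content_four (hm : IsStable S N b m) {τ r : ℕ} {v w : Agent} (hv : Valid S N v)
    (hw : Valid S N w) (h : Content S N b m (4, τ, 0) v w) (hr : key N b (4, τ, 0) v w ≤ r)
    (hr' : r < bad N) :
    m (4, τ, 0) (5, τ, 0) (6, τ, 0) ∨ m (4, τ, 0) (5, τ, 0) (7, τ, 0) ∧ 1 ≤ r ∨
      m (4, τ, 0) (6, τ, 0) (7, τ, 0) ∧ 2 ≤ r := by
  obtain ⟨κ₁, κ₂, h₆, h₇⟩ := hm.gadget_content (by simp) hv hw h hr hr'
  unfold gadgetKey at h₇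
  simp only [if_true] at h₇
  split_ifs at h₇ with e e e
  · rw [e.1, e.2] at h₆
    exact .inl h₆
  · rw [e.1, e.2] at h₆
    exact .inr (.inl ⟨h₆, h₇⟩)
  · rw [e.1, e.2] at h₆
    exact .inr (.inr ⟨h₆, h₇⟩)
  · omega

theorem content_five (hm : IsStable S N b m) {τ r : ℕ} {v w : Agent} (hv : Valid S N v)
    (hw : Valid S N w) (h : Content S N b m (5, τ, 0) v w) (hr : key N b (5, τ, 0) v w ≤ r)
    (hr' : r < bad N) :
    m (5, τ, 0) (6, τ, 0) (7, τ, 0) ∨ m (4, τ, 0) (5, τ, 0) (6, τ, 0) ∧ 1 ≤ r ∨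
      m (4, τ, 0) (5, τ, 0) (7, τ, 0) ∧ 2 ≤ r := by
  obtain ⟨κ₁, κ₂, h₆, h₇⟩ := hm.gadget_content (by simp) hv hw h hr hr'
  unfold gadgetKey at h₇
  simp only [show (5 : ℕ) ≠ 4 by decide, if_true, if_false] at h₇
  split_ifs at h₇ with e e e
  · rw [e.1, e.2] at h₆
    exact .inl h₆
  · rw [e.1, e.2] at h₆
    exact .inr (.inl ⟨hm.swap (hm.rot h₆), h₇⟩)
  · rw [e.1, e.2] at h₆
    exact .inr (.inr ⟨hm.swap (hm.rot h₆), h₇⟩)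
  · omega

theorem content_six (hm : IsStable S N b m) {τ r : ℕ} {v w : Agent} (hv : Valid S N v)
    (hw : Valid S N w) (h : Content S N b m (6, τ, 0) v w) (hr : key N b (6, τ, 0) v w ≤ r)
    (hr' : r < bad N) :
    m (4, τ, 0) (6, τ, 0) (7, τ, 0) ∨ m (5, τ, 0) (6, τ, 0) (7, τ, 0) ∧ 1 ≤ r ∨
      m (4, τ, 0) (5, τ, 0) (6, τ, 0) ∧ 2 ≤ r := by
  obtain ⟨κ₁, κ₂, h₆, h₇⟩ := hm.gadget_content (by simp) hv hw h hr hr'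
  unfold gadgetKey at h₇
  simp only [show (6 : ℕ) ≠ 4 by decide, show (6 : ℕ) ≠ 5 by decide, if_true, if_false] at h₇
  split_ifs at h₇ with e e e
  · rw [e.1, e.2] at h₆
    exact .inl (hm.swap (hm.rot h₆))
  · rw [e.1, e.2] at h₆
    exact .inr (.inl ⟨hm.swap (hm.rot h₆), h₇⟩)
  · rw [e.1, e.2] at h₆
    exact .inr (.inr ⟨hm.rot h₆, h₇⟩)
  · omega

/-- The assumption `hcon` rules out the outside pairs, which have key `0`; the pairs inside the
gadget start at `1`. -/
theorem content_seven (hm : IsStable S N b m) {τ r : ℕ}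
    (hcon : ¬ ∃ j j', j + j' < N ∧ m (7, τ, 0) (2, 2 * τ, j) (2, 2 * τ + 1, j')) {v w : Agent}
    (hv : Valid S N v) (hw : Valid S N w) (h : Content S N b m (7, τ, 0) v w)
    (hr : key N b (7, τ, 0) v w ≤ r) (hr' : r < bad N) :
    m (4, τ, 0) (5, τ, 0) (7, τ, 0) ∧ 1 ≤ r ∨ m (4, τ, 0) (6, τ, 0) (7, τ, 0) ∧ 2 ≤ r ∨
      m (5, τ, 0) (6, τ, 0) (7, τ, 0) ∧ 3 ≤ r := by
  obtain ⟨p, q, h₁, -, h₃⟩ := hm.exists_orderedKey_le hv hw h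
  have v₁ := hm.valid (hm.rot h₁)
  have v₂ := hm.valid (hm.rot (hm.rot h₁))
  unfold Valid at v₁ v₂
  rcases of_orderedKey_t (lt_of_le_of_lt (h₃.trans hr) hr') with
    ⟨π, π', j, j', e₁, e₂, e₃, e₄, rfl, rfl⟩ | ⟨l, l', rfl, rfl, e⟩ | ⟨l, l', rfl, rfl, e⟩ |
      ⟨l, l', rfl, rfl, e⟩
  · exfalso
    have : π = 2 * τ ∧ π' = 2 * τ + 1 ∨ π = 2 * τ + 1 ∧ π' = 2 * τ := by omega
    rcases this with ⟨rfl, rfl⟩ | ⟨rfl, rfl⟩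
    · exact hcon ⟨j, j', e₄, h₁⟩
    · exact hcon ⟨j', j, by omega, hm.swap h₁⟩
  all_goals
    simp only at v₁ v₂
    obtain rfl : l = 0 := by omega
    obtain rfl : l' = 0 := by omega
    have h₆ := hm.rot h₁
  · exact .inl ⟨h₆, by omega⟩
  · exact .inr (.inl ⟨h₆, by omega⟩)
  · exact .inr (.inr ⟨h₆, by omega⟩)

/-- The last agent of each gadget is matched to agents of the two systems. -/
theorem demand_matched (hm : IsStable S N b m) {τ : ℕ} (hτ : τ < S) :
    ∃ j j', j + j' < N ∧ m (7, τ, 0) (2, 2 * τ, j) (2, 2 * τ + 1, j') := by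
  by_contra hcon
  have hv : ∀ κ, 4 ≤ κ → κ < 8 → Valid S N (κ, τ, 0) := fun κ h h' => .inr (.inr ⟨h, h', hτ, rfl⟩)
  have hb : 3 < bad N := by unfold bad; omega
  have k : ∀ u v w r, orderedKey N b u v w = r → key N b u v w ≤ r := fun u v w r h =>
    (min_le_left _ _).trans h.le
  have k' : ∀ u v w r, orderedKey N b u w v = r → key N b u v w ≤ r := fun u v w r h =>
    (min_le_right _ _).trans h.le
  -- Inside the gadget, `456` is blocked by `567`, which is blocked by `467`, which is blocked by
  -- `457`, which is blocked by `456`. Each of the following four facts says that one triple does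
  -- not block: it is matched, or another triple satisfying one of its members is. Each omits
  -- exactly the triple that it would block.
  have s₄ : m (4, τ, 0) (5, τ, 0) (6, τ, 0) ∨
      m (5, τ, 0) (6, τ, 0) (7, τ, 0) ∨
      m (4, τ, 0) (6, τ, 0) (7, τ, 0) := by
    by_contra! h
    rcases hm.stable (hv 4 (by simp) (by simp)) (hv 5 (by simp) (by simp))
      (hv 6 (by simp) (by simp)) (by simp) (by simp) (by simp) h.1 with h₁ | h₁ | h₁
    · have := hm.content_four (r := 0) (hv _ (by simp) (by simp))
        (hv _ (by simp) (by simp)) h₁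
        (k _ _ _ _ (by simp [orderedKey, gadgetKey])) (by omega)
      simp [h] at this
    · have := hm.content_five (r := 1) (hv _ (by simp) (by simp))
        (hv _ (by simp) (by simp)) h₁
        (k' _ _ _ _ (by simp [orderedKey, gadgetKey])) (by omega)
      simp [h] at this
    · have := hm.content_six (r := 2) (hv _ (by simp) (by simp))
        (hv _ (by simp) (by simp)) h₁
        (k _ _ _ _ (by simp [orderedKey, gadgetKey])) (by omega)
      simp [h] at this
  have s₁ : m (5, τ, 0) (6, τ, 0) (7, τ, 0) ∨
      m (4, τ, 0) (6, τ, 0) (7, τ, 0) ∨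
      m (4, τ, 0) (5, τ, 0) (7, τ, 0) := by
    by_contra! h
    rcases hm.stable (hv 5 (by simp) (by simp)) (hv 6 (by simp) (by simp))
      (hv 7 (by simp) (by simp)) (by simp) (by simp) (by simp) h.1 with h₁ | h₁ | h₁
    · have := hm.content_five (r := 0) (hv _ (by simp) (by simp))
        (hv _ (by simp) (by simp)) h₁
        (k _ _ _ _ (by simp [orderedKey, gadgetKey])) (by omega)
      simp [h] at this
    · have := hm.content_six (r := 1) (hv _ (by simp) (by simp))
        (hv _ (by simp) (by simp)) h₁
        (k' _ _ _ _ (by simp [orderedKey, gadgetKey])) (by omega)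
      simp [h] at this
    · have := hm.content_seven hcon (r := 3) (hv _ (by simp) (by simp))
        (hv _ (by simp) (by simp)) h₁
        (k _ _ _ _ (by simp [orderedKey, gadgetKey])) (by omega)
      simp [h] at this
  have s₂ : m (4, τ, 0) (6, τ, 0) (7, τ, 0) ∨
      m (4, τ, 0) (5, τ, 0) (7, τ, 0) ∨
      m (4, τ, 0) (5, τ, 0) (6, τ, 0) := by
    by_contra! h
    rcases hm.stable (hv 4 (by simp) (by simp)) (hv 6 (by simp) (by simp))
      (hv 7 (by simp) (by simp)) (by simp) (by simp) (by simp) h.1 with h₁ | h₁ | h₁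
    · have := hm.content_four (r := 2) (hv _ (by simp) (by simp))
        (hv _ (by simp) (by simp)) h₁
        (k _ _ _ _ (by simp [orderedKey, gadgetKey])) (by omega)
      simp [h] at this
    · have := hm.content_six (r := 0) (hv _ (by simp) (by simp))
        (hv _ (by simp) (by simp)) h₁
        (k' _ _ _ _ (by simp [orderedKey, gadgetKey])) (by omega)
      simp [h] at this
    · have := hm.content_seven hcon (r := 2) (hv _ (by simp) (by simp))
        (hv _ (by simp) (by simp)) h₁
        (k _ _ _ _ (by simp [orderedKey, gadgetKey])) (by omega)
      simp [h] at this
  have s₃ : m (4, τ, 0) (5, τ, 0) (7, τ, 0) ∨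
      m (4, τ, 0) (5, τ, 0) (6, τ, 0) ∨
      m (5, τ, 0) (6, τ, 0) (7, τ, 0) := by
    by_contra! h
    rcases hm.stable (hv 4 (by simp) (by simp)) (hv 5 (by simp) (by simp))
      (hv 7 (by simp) (by simp)) (by simp) (by simp) (by simp) h.1 with h₁ | h₁ | h₁
    · have := hm.content_four (r := 1) (hv _ (by simp) (by simp))
        (hv _ (by simp) (by simp)) h₁
        (k _ _ _ _ (by simp [orderedKey, gadgetKey])) (by omega)
      simp [h] at this
    · have := hm.content_five (r := 2) (hv _ (by simp) (by simp))
        (hv _ (by simp) (by simp)) h₁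
        (k' _ _ _ _ (by simp [orderedKey, gadgetKey])) (by omega)
      simp [h] at this
    · have := hm.content_seven hcon (r := 1) (hv _ (by simp) (by simp))
        (hv _ (by simp) (by simp)) h₁
        (k _ _ _ _ (by simp [orderedKey, gadgetKey])) (by omega)
      simp [h] at this
  -- Any two triples out of four agents meet, so at most one is matched.
  have e₄₃ : m (4, τ, 0) (5, τ, 0) (6, τ, 0) → m (4, τ, 0) (5, τ, 0) (7, τ, 0) → False :=
    fun h h' => by
    rcases hm.uniq h h' with h | h <;> simp at h
  have e₄₂ : m (4, τ, 0) (5, τ, 0) (6, τ, 0) → m (4, τ, 0) (6, τ, 0) (7, τ, 0) → False :=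
    fun h h' => by
    rcases hm.uniq h h' with h | h <;> simp at h
  have e₄₁ : m (4, τ, 0) (5, τ, 0) (6, τ, 0) → m (5, τ, 0) (6, τ, 0) (7, τ, 0) → False :=
    fun h h' => by
    rcases hm.uniq (hm.rot h) h' with h | h <;> simp at h
  have e₃₂ : m (4, τ, 0) (5, τ, 0) (7, τ, 0) → m (4, τ, 0) (6, τ, 0) (7, τ, 0) → False :=
    fun h h' => by
    rcases hm.uniq h h' with h | h <;> simp at h
  have e₃₁ : m (4, τ, 0) (5, τ, 0) (7, τ, 0) → m (5, τ, 0) (6, τ, 0) (7, τ, 0) → False :=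
    fun h h' => by
    rcases hm.uniq (hm.rot h) h' with h | h <;> simp at h
  have e₂₁ : m (4, τ, 0) (6, τ, 0) (7, τ, 0) → m (5, τ, 0) (6, τ, 0) (7, τ, 0) → False :=
    fun h h' => by
    rcases hm.uniq (hm.rot h) (hm.rot h') with h | h <;> simp at h
  -- Whichever triple is matched, the fact that omits it produces a second one.
  rcases s₄ with h | h | h
  · rcases s₁ with h' | h' | h'
    exacts [e₄₁ h h', e₄₂ h h', e₄₃ h h']
  · rcases s₂ with h' | h' | h'
    exacts [e₂₁ h' h, e₃₁ h' h, e₄₁ h' h]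
  · rcases s₃ with h' | h' | h'
    exacts [e₃₂ h' h, e₄₂ h' h, e₂₁ h h']

theorem exists_selection (hm : IsStable S N b m) : ∃ sel, Selection S N b sel := by
  classical
  -- There is no agent of level `N`, so a first broken level exists. That it is below `N` follows
  -- only from the gadgets.
  have hex : ∀ π, ∃ i, ¬ m (0, π, i) (1, π, i) (2, π, i) := fun π => ⟨N, fun h => by
    have := hm.valid h
    simp [Valid] at this⟩
  -- A z matched outside its natural triple is at or above the first broken level.
  have hnot : ∀ {π j p q}, m (2, π, j) p q → p ≠ (0, π, j) → p ≠ (1, π, j) →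
      Nat.find (hex π) ≤ j := fun h h₁ h₂ =>
    Nat.find_min' _ fun h' => hm.not_mem_of_uniq (hm.rot (hm.rot h')) h h₁ h₂
  have hsum : ∀ τ < S, Nat.find (hex (2 * τ)) + Nat.find (hex (2 * τ + 1)) < N := by
    intro τ hτ
    obtain ⟨j, j', h, h'⟩ := hm.demand_matched hτ
    have h₁ := hnot (hm.rot h') (by simp) (by simp)
    have h₂ := hnot (hm.rot (hm.rot h')) (by simp) (by simp)
    omega
  have hlt : ∀ π < 2 * S, Nat.find (hex π) < N := by
    intro π hπ
    have := hsum (π / 2) (by omega)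
    rcases Nat.mod_two_eq_zero_or_one π with h | h
    · rw [show 2 * (π / 2) = π by omega] at this
      omega
    · rw [show 2 * (π / 2) + 1 = π by omega] at this
      omega
  have hs : ∀ π < 2 * S, m (0, π, Nat.find (hex π)) (1, π, Nat.find (hex π)) (3, π, 0) :=
    fun π hπ => hm.selector_matched hπ (hlt π hπ)
      (fun j hj => not_not.1 (Nat.find_min (hex π) hj)) (Nat.find_spec (hex π))
  refine ⟨fun π => Nat.find (hex π), hlt, hsum, fun π hπ ρ hρ hne => ?_⟩
  -- The selector of `π`, its y and the selected z of `ρ` would block: the selector improves from `3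
  -- * c + 1` to `3 * c` and y from `N + 1` to `N`. For z, every pair of key at most `N` contains an
  -- x of its own system up to level `c'` or a foreign selector, and those are matched elsewhere.
  by_contra! hb
  set c := Nat.find (hex π)
  set c' := Nat.find (hex ρ)
  have hc : c < N := hlt π hπ
  have hc' : c' < N := hlt ρ hρ
  have vs : Valid S N (3, π, 0) := .inr (.inl ⟨rfl, hπ, rfl⟩)
  have vy : Valid S N (1, π, c) := .inl ⟨by simp, hπ, hc⟩
  have vz : Valid S N (2, ρ, c') := .inl ⟨by simp, hρ, hc'⟩
  have h₁ := hs π hπ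
  have h₂ : ¬ m (3, π, 0) (1, π, c) (2, ρ, c') := fun h => by
    rcases hm.uniq (hm.rot (hm.rot h₁)) h with h | h <;> simp at h
  rcases hm.stable vs vy vz (by simp) (by simp) (by simp) h₂ with h | h | h
  · obtain ⟨p, q, h₃, h₄⟩ := h
    have h₅ := key_le_of_rank_le vy vz h₄
    have h₆ : key N b (3, π, 0) (1, π, c) (2, ρ, c') ≤ 3 * c :=
      (min_le_left _ _).trans (by simp [orderedKey, hne, hb])
    have h₇ : key N b (3, π, 0) p q = 3 * c + 1 := by
      rcases hm.uniq (hm.rot (hm.rot h₁)) h₃ with ⟨rfl, rfl⟩ | ⟨rfl, rfl⟩ <;>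
        simp [key, orderedKey, bad] <;> omega
    omega
  · obtain ⟨p, q, h₃, h₄⟩ := h
    have h₅ := key_le_of_rank_le vz vs h₄
    have h₆ : key N b (1, π, c) (2, ρ, c') (3, π, 0) ≤ N :=
      (min_le_right _ _).trans (by simp [orderedKey, hne])
    have h₇ : key N b (1, π, c) p q = N + 1 := by
      rcases hm.uniq (hm.rot h₁) h₃ with ⟨rfl, rfl⟩ | ⟨rfl, rfl⟩ <;>
        simp [key, orderedKey, bad] <;> omega
    omega
  · obtain ⟨p, q, h₃, -, h₅⟩ := hm.exists_orderedKey_le vs vy h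
    have h₆ : orderedKey N b (2, ρ, c') p q ≤ N :=
      h₅.trans ((min_le_left _ _).trans (by simp [orderedKey, hne.symm]))
    rcases of_orderedKey_z (lt_of_le_of_lt h₆ (by unfold bad; omega)) with
      ⟨a, l, ha, rfl, rfl, -⟩ | ⟨σ, l, j, -, rfl, rfl, -⟩ | ⟨l, σ, j, -, -, -, -, h₇⟩
    · rcases ha.lt_or_eq with ha | rfl
      · have := not_not.1 (Nat.find_min (hex ρ) ha)
        rcases hm.uniq this (hm.rot h₃) with h | h <;> simp at h
        · omega
      · rcases hm.uniq (hs ρ hρ) (hm.rot h₃) with h | h <;> simp at h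
    · have h₇ := hm.valid (hm.rot h₃)
      simp only [Valid] at h₇
      obtain ⟨rfl, h₈⟩ : l = 0 ∧ σ < 2 * S := by omega
      rcases hm.uniq (hm.rot (hm.rot (hs σ h₈))) (hm.rot h₃) with h | h <;> simp at h
    · omega

end IsStable

end Gadget

end Roommates

namespace Roommates

namespace Gadget

variable {S N : ℕ} {b : ℕ → ℕ → ℕ → ℕ}

/-! ## Selections yield stable matchings -/

/-- The other system that belongs to the same gadget. -/
def dual (π : ℕ) : ℕ := if π % 2 = 0 then π + 1 else π - 1

theorem dual_div_two (π : ℕ) : dual π / 2 = π / 2 := by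
  unfold dual
  split_ifs <;> omega

theorem dual_ne (π : ℕ) : dual π ≠ π := by
  unfold dual
  split_ifs <;> omega

theorem eq_dual {π ρ : ℕ} (h : ρ / 2 = π / 2) (hne : ρ ≠ π) : ρ = dual π := by
  unfold dual
  split_ifs <;> omega

/-- The label of the triple that contains the agent `u` in the matching for a selection. -/
def label (sel : ℕ → ℕ) (u : Agent) : ℕ × ℕ × ℕ :=
  if u.1 < 2 then (0, u.2.1, u.2.2)
  else if u.1 = 2 then
    if u.2.2 = sel u.2.1 then (1, u.2.1 / 2, 0) else (0, u.2.1, u.2.2)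
  else if u.1 = 3 then (0, u.2.1, sel u.2.1)
  else if u.1 = 7 then (1, u.2.1, 0)
  else (2, u.2.1, 0)

/-- The partners of the agent `u` in the matching for a selection. -/
def mates (sel : ℕ → ℕ) (u : Agent) : Agent × Agent :=
  if u.1 = 0 then
    ((1, u.2.1, u.2.2), if u.2.2 = sel u.2.1 then (3, u.2.1, 0) else (2, u.2.1, u.2.2))
  else if u.1 = 1 then
    ((0, u.2.1, u.2.2), if u.2.2 = sel u.2.1 then (3, u.2.1, 0) else (2, u.2.1, u.2.2))
  else if u.1 = 2 then
    if u.2.2 = sel u.2.1 then ((7, u.2.1 / 2, 0), (2, dual u.2.1, sel (dual u.2.1)))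
    else ((0, u.2.1, u.2.2), (1, u.2.1, u.2.2))
  else if u.1 = 3 then ((0, u.2.1, sel u.2.1), (1, u.2.1, sel u.2.1))
  else if u.1 = 4 then ((5, u.2.1, 0), (6, u.2.1, 0))
  else if u.1 = 5 then ((4, u.2.1, 0), (6, u.2.1, 0))
  else if u.1 = 6 then ((4, u.2.1, 0), (5, u.2.1, 0))
  else ((2, 2 * u.2.1, sel (2 * u.2.1)), (2, 2 * u.2.1 + 1, sel (2 * u.2.1 + 1)))

theorem valid_mates {sel : ℕ → ℕ} (hs : Selection S N b sel) {u : Agent} (hu : Valid S N u) :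
    Valid S N (mates sel u).1 ∧ Valid S N (mates sel u).2 ∧ u ≠ (mates sel u).1 ∧
      u ≠ (mates sel u).2 ∧ (mates sel u).1 ≠ (mates sel u).2 := by
  obtain ⟨κ, π, i⟩ := u
  have h₁ := hs.1 π
  have h₂ := hs.1 (dual π)
  have h₃ := dual_div_two π
  have h₄ := hs.1 (2 * π)
  have h₅ := hs.1 (2 * π + 1)
  have h₆ := dual_ne π
  unfold mates
  simp only [Valid] at hu ⊢
  split_ifs <;> simp only [ne_eq, Prod.mk.injEq] <;> grind

-- The classes of equal label are the intended triples. Describing triples by labels makes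
-- disjointness automatic.
set_option maxHeartbeats 4000000 in
theorem label_eq_iff {sel : ℕ → ℕ} {u v : Agent} (hu : Valid S N u) (hv : Valid S N v) :
    label sel v = label sel u ↔ v = u ∨ v = (mates sel u).1 ∨ v = (mates sel u).2 := by
  obtain ⟨κ, π, i⟩ := u
  obtain ⟨κ', ρ, j⟩ := v
  have h₁ : ρ / 2 = π / 2 → ρ ≠ π → ρ = dual π := eq_dual
  have h₂ := dual_div_two π
  have h₃ : κ < 8 := by simp only [Valid] at hu; omega
  have h₄ : κ' < 8 := by simp only [Valid] at hv; omega
  simp only [Valid] at hu hv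
  interval_cases κ <;> interval_cases κ' <;> simp [mates, label] <;> grind

/-- `u` prefers `{v, w}` to its partners in the matching for a selection. -/
def Wants (S N : ℕ) (b : ℕ → ℕ → ℕ → ℕ) (sel : ℕ → ℕ) (u v w : Agent) : Prop :=
  rank S N b u v w < rank S N b u (mates sel u).1 (mates sel u).2

/-- `{u, v, w}` blocks the matching for a selection. -/
structure Blocking (S N : ℕ) (b : ℕ → ℕ → ℕ → ℕ) (sel : ℕ → ℕ) (u v w : Agent) : Prop where
  valid₁ : Valid S N u
  valid₂ : Valid S N v
  valid₃ : Valid S N w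
  wants₁ : Wants S N b sel u v w
  wants₂ : Wants S N b sel v w u
  wants₃ : Wants S N b sel w u v

namespace Blocking

variable {sel : ℕ → ℕ}

theorem rot {u v w : Agent} (h : Blocking S N b sel u v w) : Blocking S N b sel v w u :=
  ⟨h.valid₂, h.valid₃, h.valid₁, h.wants₂, h.wants₃, h.wants₁⟩

theorem swap {u v w : Agent} (h : Blocking S N b sel u v w) : Blocking S N b sel u w v := by
  refine ⟨h.valid₁, h.valid₃, h.valid₂, ?_, ?_, ?_⟩ <;> unfold Wants <;> rw [rank_comm]
  exacts [h.wants₁, h.wants₃, h.wants₂]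

theorem exists_orderedKey_le (hs : Selection S N b sel) {u v w : Agent} {r : ℕ}
    (h : Blocking S N b sel u v w)
    (hr : orderedKey N b u (mates sel u).1 (mates sel u).2 ≤ r ∨
      orderedKey N b u (mates sel u).2 (mates sel u).1 ≤ r) :
    orderedKey N b u v w ≤ r ∨ orderedKey N b u w v ≤ r := by
  have hm := valid_mates hs h.valid₁
  exact min_le_iff.1 ((key_le_of_rank_le hm.1 hm.2.1 h.wants₁.le).trans (min_le_iff.2 hr))

/-- The sharper bound at the selected level reflects that this x holds the selector; no z of its
system can then tempt it at the same y. -/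
theorem x_le (hs : Selection S N b sel) {π i : ℕ} {v w : Agent}
    (h : Blocking S N b sel (0, π, i) v w) :
    (orderedKey N b (0, π, i) v w ≤ 2 * i + 1 ∨ orderedKey N b (0, π, i) w v ≤ 2 * i + 1) ∧
    (i = sel π →
      orderedKey N b (0, π, i) v w ≤ 2 * i ∨ orderedKey N b (0, π, i) w v ≤ 2 * i) := by
  by_cases hi : i = sel π
  · have := h.exists_orderedKey_le hs (r := 2 * i) (.inl (by simp [mates, orderedKey, ← hi]))
    exact ⟨this.imp (fun h => h.trans (by omega)) (fun h => h.trans (by omega)), fun _ => this⟩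
  · exact ⟨h.exists_orderedKey_le hs (.inl (by simp [mates, orderedKey, hi])),
      fun h => absurd h hi⟩

theorem y_le (hs : Selection S N b sel) {π i : ℕ} {v w : Agent}
    (h : Blocking S N b sel (1, π, i) v w) :
    (orderedKey N b (1, π, i) v w ≤ N + 1 ∨ orderedKey N b (1, π, i) w v ≤ N + 1) ∧
    (i ≠ sel π → orderedKey N b (1, π, i) v w < N ∨ orderedKey N b (1, π, i) w v < N) := by
  have hi' : i < N := by
    have := h.valid₁
    simp only [Valid] at this
    omega
  by_cases hi : i = sel π
  · exact ⟨h.exists_orderedKey_le hs (.inl (by simp [mates, orderedKey, ← hi])),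
      fun h => absurd hi h⟩
  · have := h.exists_orderedKey_le hs (r := i) (.inl (by simp [mates, orderedKey, hi]))
    exact ⟨this.imp (fun h => h.trans (by omega)) (fun h => h.trans (by omega)),
      fun _ => this.imp (fun h => by omega) (fun h => by omega)⟩

theorem z_le (hs : Selection S N b sel) {π i : ℕ} {v w : Agent}
    (h : Blocking S N b sel (2, π, i) v w) :
    (orderedKey N b (2, π, i) v w ≤ N + 1 ∨ orderedKey N b (2, π, i) w v ≤ N + 1) ∧
    (i ≠ sel π → orderedKey N b (2, π, i) v w < N ∨ orderedKey N b (2, π, i) w v < N) := by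
  have hi' : i < N := by
    have := h.valid₁
    simp only [Valid] at this
    omega
  by_cases hi : i = sel π
  · exact ⟨h.exists_orderedKey_le hs (.inl (by
      simp [mates, orderedKey, ← hi, dual_div_two, dual_ne])), fun h => absurd hi h⟩
  · have := h.exists_orderedKey_le hs (r := i) (.inl (by simp [mates, orderedKey, hi]))
    exact ⟨this.imp (fun h => h.trans (by omega)) (fun h => h.trans (by omega)),
      fun _ => this.imp (fun h => by omega) (fun h => by omega)⟩

/-- An agent `z` that is not selected only joins agents `x` and `y`. -/
theorem z_kind (hs : Selection S N b sel) {π i : ℕ} {v w : Agent}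
    (h : Blocking S N b sel (2, π, i) v w) (hi : i ≠ sel π) : v.1 < 2 ∧ w.1 < 2 := by
  rcases (h.z_le hs).2 hi with h | h <;>
  · rcases of_orderedKey_z (h.trans (by unfold bad; omega)) with
      ⟨a, l, -, rfl, rfl, -⟩ | ⟨_, _, _, _, _, _, h'⟩ | ⟨_, _, _, _, _, _, _, h'⟩
    · simp
    · omega
    · omega

/-- An agent `y` that is not selected only joins agents `x` and `z`. -/
theorem y_kind (hs : Selection S N b sel) {π i : ℕ} {v w : Agent}
    (h : Blocking S N b sel (1, π, i) v w) (hi : i ≠ sel π) : v.1 < 3 ∧ w.1 < 3 := by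
  rcases (h.y_le hs).2 hi with h | h <;>
  · rcases of_orderedKey_y (h.trans (by unfold bad; omega)) with
      ⟨a, l, -, rfl, rfl, -⟩ | ⟨_, _, _, _, h'⟩ | ⟨_, _, _, _, _, _, h'⟩
    · simp
    · omega
    · omega

/-- The last gadget agent already has key `0`, so only two z could tempt it. By `z_kind` both are
selected, and then they are its present partners. -/
theorem not_t (hs : Selection S N b sel) {τ i : ℕ} {v w : Agent}
    (h : Blocking S N b sel (7, τ, i) v w) : False := by
  have hτ : τ < S := by
    have := h.valid₁
    simp only [Valid] at this
    omega
  have key : ∀ {v w}, Blocking S N b sel (7, τ, i) v w → ¬ orderedKey N b (7, τ, i) v w ≤ 0 := by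
    intro v w h h'
    rcases of_orderedKey_t (lt_of_le_of_lt h' (by unfold bad; omega)) with
      ⟨π, π', j, j', e₁, e₂, e₃, e₄, rfl, rfl⟩ | ⟨_, _, _, _, e⟩ | ⟨_, _, _, _, e⟩ |
        ⟨_, _, _, _, e⟩
    · have h₁ : j = sel π := by
        by_contra hj
        have := h.rot.z_kind hs hj
        simp at this
      have h₂ : j' = sel π' := by
        by_contra hj
        have := h.rot.rot.z_kind hs hj
        simp at this
      have h₃ := h.wants₁
      unfold Wants at h₃
      have : π = 2 * τ ∧ π' = 2 * τ + 1 ∨ π = 2 * τ + 1 ∧ π' = 2 * τ := by omega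
      rcases this with ⟨rfl, rfl⟩ | ⟨rfl, rfl⟩
      · simp [mates, h₁, h₂] at h₃
      · rw [rank_comm] at h₃
        simp [mates, h₁, h₂] at h₃
    all_goals omega
  rcases h.exists_orderedKey_le hs (r := 0) (.inl (by
    have := hs.2.1 τ hτ
    simp [mates, orderedKey, this]
    intro h
    omega)) with h' | h'
  · exact key h h'
  · exact key h.swap h'

/-- In the triple `456` agent `κ` has key `κ - 4`, and every better pair contains the last agent,
which `not_t` excludes. -/
theorem not_gadget (hs : Selection S N b sel) {κ τ i : ℕ} (hκ : κ = 4 ∨ κ = 5 ∨ κ = 6)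
    {v w : Agent} (h : Blocking S N b sel (κ, τ, i) v w) : False := by
  have key : ∀ {v w}, Blocking S N b sel (κ, τ, i) v w →
      ¬ orderedKey N b (κ, τ, i) v w ≤ κ - 4 := by
    intro v w h h'
    obtain ⟨κ₁, κ₂, l, l', rfl, rfl, e⟩ :=
      of_orderedKey_gadget hκ (lt_of_le_of_lt h' (by unfold bad; omega))
    rw [e] at h'
    have h₁ := h.wants₁
    have v₁ := h.valid₂
    have v₂ := h.valid₃
    simp only [Valid] at v₁ v₂
    unfold Wants at h₁
    unfold gadgetKey bad at h'
    by_cases h₇ : κ₂ = 7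
    · subst h₇
      exact h.rot.rot.not_t hs
    rcases hκ with rfl | rfl | rfl
    all_goals
      simp only [h₇, and_false, Nat.reduceEqDiff, if_false, if_true] at h'
      split_ifs at h' with e₁
    all_goals first | omega | skip
    all_goals
      obtain ⟨rfl, rfl⟩ := ‹κ₁ = _ ∧ κ₂ = _›
      obtain rfl : l = 0 := by omega
      obtain rfl : l' = 0 := by omega
      simp [mates] at h₁
  rcases h.exists_orderedKey_le hs (r := κ - 4) (.inl (by
    rcases hκ with rfl | rfl | rfl <;> simp [mates, orderedKey, gadgetKey])) with h' | h'
  · exact key h h'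
  · exact key h.swap h'

/-- By `y_kind` only the selected y can join. With an x, the tie-break requires one below the
selected level, which rejects a y above itself. With a foreign z, that z must be selected and lie
below the threshold, against the selection's lower bound. -/
theorem not_s (hs : Selection S N b sel) {π i : ℕ} {v w : Agent}
    (h : Blocking S N b sel (3, π, i) v w) : False := by
  have hπ : π < 2 * S := by
    have := h.valid₁
    simp only [Valid] at this
    omega
  have hlt := hs.1 π hπ
  have key : ∀ {v w}, Blocking S N b sel (3, π, i) v w →
      ¬ orderedKey N b (3, π, i) v w ≤ 3 * sel π + 1 := by
    intro v w h h'
    have aux : ∀ {c w}, Blocking S N b sel (3, π, i) (1, π, c) w → c = sel π := by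
      intro c w h
      by_contra hc
      have := h.rot.y_kind hs hc
      simp at this
    rcases of_orderedKey_s (lt_of_le_of_lt h' (by unfold bad; omega)) with
      ⟨c, a, rfl, rfl, e⟩ | ⟨c, ρ, j, hne, rfl, rfl, e⟩
    · obtain rfl := aux h
      have h₁ : a < sel π := by
        by_contra ha
        have h₂ := h.wants₁
        unfold Wants at h₂
        simp only [mates, OfNat.ofNat_ne_zero, OfNat.ofNat_ne_one, Nat.reduceEqDiff,
          if_false, if_true] at h₂
        rw [rank_comm _ (0, π, sel π)] at h₂
        rcases (not_lt.1 ha).lt_or_eq with ha | rfl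
        · exact (rank_lt_of_level_lt (w := (0, π, sel π)) h.valid₁ h.valid₂
            (.inl ⟨by simp, hπ, hlt⟩) h.valid₃ rfl rfl ha).not_gt h₂
        · exact lt_irrefl _ h₂
      have ha : a < N := by omega
      rcases (h.rot.rot.x_le hs).1 with h₂ | h₂
      · obtain ⟨_, _, _, h₃, _⟩ := of_orderedKey_x (lt_of_le_of_lt h₂ (by unfold bad; omega))
        simp at h₃
      · obtain ⟨_, _, h₄, h₃, _⟩ := of_orderedKey_x (lt_of_le_of_lt h₂ (by unfold bad; omega))
        simp at h₃
        omega
    · obtain rfl := aux h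
      rcases e with ⟨e₁, e₂⟩ | e
      · have hρ : ρ < 2 * S := by
          have := h.valid₃
          simp only [Valid] at this
          omega
        have h₁ : j = sel ρ := by
          by_contra hj
          have := h.rot.rot.z_kind hs hj
          simp at this
        have := hs.2.2 π hπ ρ hρ hne
        omega
      · omega
  rcases h.exists_orderedKey_le hs (r := 3 * sel π + 1) (.inr (by simp [mates, orderedKey]))
    with h' | h'
  · exact key h h'
  · exact key h.swap h'

/-- Here y accepts only x up to its level and x only y up to its own, so the two levels agree. At
the selected level x prefers its selector; elsewhere z has at least that level, which is no
improvement. -/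
theorem not_xyz (hs : Selection S N b sel) {π i j l : ℕ}
    (h : Blocking S N b sel (0, π, i) (1, π, j) (2, π, l)) : False := by
  have hi : i < N := by
    have := h.valid₁
    simp only [Valid] at this
    omega
  have hy : i ≤ j := by
    rcases (h.rot.y_le hs).1 with h₁ | h₁
    · rcases of_orderedKey_y (lt_of_le_of_lt h₁ (by unfold bad; omega)) with
        ⟨_, _, _, e, _⟩ | ⟨_, _, e, _⟩ | ⟨_, _, _, _, e, _⟩ <;> simp at e
    · rcases of_orderedKey_y (lt_of_le_of_lt h₁ (by unfold bad; omega)) with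
        ⟨_, _, _, e, _⟩ | ⟨_, _, _, e, _⟩ | ⟨_, _, _, _, e, _⟩ <;> simp at e
      omega
  have hz : i ≤ l := by
    rcases (h.rot.rot.z_le hs).1 with h₁ | h₁
    · rcases of_orderedKey_z (lt_of_le_of_lt h₁ (by unfold bad; omega)) with
        ⟨_, _, _, e, _⟩ | ⟨_, _, _, _, e, _⟩ | ⟨_, _, _, _, _, e, _⟩ <;> simp at e
      omega
    · rcases of_orderedKey_z (lt_of_le_of_lt h₁ (by unfold bad; omega)) with
        ⟨_, _, _, e, _⟩ | ⟨_, _, _, _, e, _⟩ | ⟨_, _, _, _, _, e, _⟩ <;> simp at e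
  have hx : ∀ {r}, r < bad N → (orderedKey N b (0, π, i) (1, π, j) (2, π, l) ≤ r ∨
      orderedKey N b (0, π, i) (2, π, l) (1, π, j) ≤ r) → j ≤ i ∧ 2 * j + 1 ≤ r := by
    intro r hr h
    rcases h with h | h
    · obtain ⟨a, _, h₁, h₂, h₃⟩ := of_orderedKey_x (lt_of_le_of_lt h hr)
      obtain rfl : j = a := by simpa using h₂
      rcases h₃ with h₃ | h₃
      · simp at h₃
      · exact ⟨h₁, h₃.2 ▸ h⟩
    · obtain ⟨a, _, h₁, h₂, h₃⟩ := of_orderedKey_x (lt_of_le_of_lt h hr)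
      simp at h₂
  have h₁ := hx (by unfold bad; omega) (h.x_le hs).1
  obtain rfl : i = j := by omega
  have h₂ : i ≠ sel π := fun e => by
    have := hx (by unfold bad; omega) ((h.x_le hs).2 e)
    omega
  have h₃ := h.wants₁
  unfold Wants at h₃
  simp only [mates, h₂, if_true, if_false] at h₃
  rcases hz.lt_or_eq with hz | rfl
  · refine (rank_lt_of_level_lt (w := (2, π, i)) h.valid₁ h.valid₂ ?_ h.valid₃ rfl rfl hz).not_gt h₃
    have := h.valid₁
    simp only [Valid] at this ⊢
    omega
  · exact lt_irrefl _ h₃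

theorem kind_lt (hs : Selection S N b sel) {u v w : Agent} (h : Blocking S N b sel u v w) :
    u.1 < 3 := by
  obtain ⟨κ, π, i⟩ := u
  have := h.valid₁
  simp only [Valid] at this
  by_contra hκ
  simp only at hκ
  have : κ = 3 ∨ (κ = 4 ∨ κ = 5 ∨ κ = 6) ∨ κ = 7 := by omega
  rcases this with rfl | h' | rfl
  · exact h.not_s hs
  · exact h.not_gadget hs h'
  · exact h.not_t hs

/-- Without selectors and gadget agents, the only good pairs for x, y or z complete a triple of one
system, which `not_xyz` excludes. -/
theorem elim (hs : Selection S N b sel) {u v w : Agent} (h : Blocking S N b sel u v w) : False := by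
  have hv := h.rot.kind_lt hs
  have hw := h.rot.rot.kind_lt hs
  have hu := h.kind_lt hs
  obtain ⟨κ, π, i⟩ := u
  have hi : i < N := by
    have := h.valid₁
    simp only [Valid] at this hu
    omega
  have : κ = 0 ∨ κ = 1 ∨ κ = 2 := by
    simp only at hu
    omega
  rcases this with rfl | rfl | rfl
  · have key : ∀ {v w}, Blocking S N b sel (0, π, i) v w → w.1 < 3 →
        ¬ orderedKey N b (0, π, i) v w ≤ 2 * i + 1 := by
      intro v w h hw h'
      obtain ⟨a, l, _, rfl, ⟨rfl, _⟩ | ⟨rfl, _⟩⟩ :=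
        of_orderedKey_x (lt_of_le_of_lt h' (by unfold bad; omega))
      · simp at hw
      · exact h.not_xyz hs
    rcases (h.x_le hs).1 with h' | h'
    · exact key h hw h'
    · exact key h.swap hv h'
  · have key : ∀ {v w}, Blocking S N b sel (1, π, i) v w → v.1 < 3 → w.1 < 3 →
        ¬ orderedKey N b (1, π, i) v w ≤ N + 1 := by
      intro v w h hv hw h'
      rcases of_orderedKey_y (lt_of_le_of_lt h' (by unfold bad; omega)) with
        ⟨_, _, _, rfl, rfl, _⟩ | ⟨_, _, rfl, rfl, _⟩ | ⟨_, _, _, _, rfl, rfl, _⟩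
      · exact h.rot.swap.not_xyz hs
      · simp at hw
      · simp at hv
    rcases (h.y_le hs).1 with h' | h'
    · exact key h hv hw h'
    · exact key h.swap hw hv h'
  · have key : ∀ {v w}, Blocking S N b sel (2, π, i) v w → v.1 < 3 → w.1 < 3 →
        ¬ orderedKey N b (2, π, i) v w ≤ N + 1 := by
      intro v w h hv hw h'
      rcases of_orderedKey_z (lt_of_le_of_lt h' (by unfold bad; omega)) with
        ⟨_, _, _, rfl, rfl, _⟩ | ⟨_, _, _, _, rfl, rfl, _⟩ | ⟨_, _, _, _, _, rfl, rfl, _⟩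
      · exact h.rot.not_xyz hs
      · simp at hv
      · simp at hv
    rcases (h.z_le hs).1 with h' | h'
    · exact key h hv hw h'
    · exact key h.swap hw hv h'

end Blocking

end Gadget

end Roommates

namespace Roommates

namespace Gadget

variable {S N : ℕ} {b : ℕ → ℕ → ℕ → ℕ}

/-! ## Stable matchings of the instance -/

theorem decode_injective {a a' : ℕ} (h : decode S N a = decode S N a') : a = a' := by
  rw [← encode_decode (S := S) (N := N) a, h, encode_decode]

theorem exists_erase_eq_pair {n : ℕ} {T : Finset (Fin n)} (hT : T.card = 3) {d : Fin n}
    (hd : d ∈ T) : ∃ p q, p ≠ q ∧ p ≠ d ∧ q ≠ d ∧ T.erase d = {p, q} ∧ T = {d, p, q} := by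
  obtain ⟨p, q, hpq, h⟩ := Finset.card_eq_two.1
    (show (T.erase d).card = 2 by rw [Finset.card_erase_of_mem hd, hT])
  have hp : p ∈ T.erase d := h ▸ by simp
  have hq : q ∈ T.erase d := h ▸ by simp
  refine ⟨p, q, hpq, Finset.ne_of_mem_erase hp, Finset.ne_of_mem_erase hq, h, ?_⟩
  rw [← Finset.insert_erase hd, h]

theorem ne_of_card_eq_three {α : Type*} [DecidableEq α] {x y z : α}
    (h : ({x, y, z} : Finset α).card = 3) : x ≠ y ∧ x ≠ z ∧ y ≠ z := by
  refine ⟨?_, ?_, ?_⟩ <;> rintro rfl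
  · rw [Finset.insert_eq_of_mem (by simp)] at h
    have := Finset.card_le_two (a := x) (b := z)
    omega
  · rw [Finset.insert_eq_of_mem (by simp)] at h
    have := Finset.card_le_two (a := y) (b := x)
    omega
  · rw [Finset.pair_eq_singleton] at h
    have := Finset.card_le_two (a := x) (b := y)
    omega

theorem erase_triple {α : Type*} [DecidableEq α] {x y z : α} (hxy : x ≠ y) (hxz : x ≠ z)
    (hyz : y ≠ z) : ({x, y, z} : Finset α).erase x = {y, z} ∧
      ({x, y, z} : Finset α).erase y = {z, x} ∧ ({x, y, z} : Finset α).erase z = {x, y} := by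
  refine ⟨?_, ?_, ?_⟩ <;> ext a <;>
    simp only [Finset.mem_erase, Finset.mem_insert, Finset.mem_singleton] <;> grind

theorem prefers_inst_iff {hN : 0 < N} {d p q p' q' : Fin (inst S N hN b).n} (h : p ≠ q)
    (hp : p ≠ d) (hq : q ≠ d) (h' : p' ≠ q') (hp' : p' ≠ d) (hq' : q' ≠ d) :
    (inst S N hN b).toDSR.Prefers d {p, q} {p', q'} ↔
      rank S N b (decode S N d) (decode S N p) (decode S N q) <
        rank S N b (decode S N d) (decode S N p') (decode S N q') := by
  rw [(inst S N hN b).prefers_iff h hp hq h' hp' hq', rank_decode, rank_decode]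

theorem isStable_of_stable (hN : 0 < N) {M : Finset (Finset (Fin (inst S N hN b).n))}
    (hM : (inst S N hN b).toDSR.IsMatching M) (hst : ∀ T, ¬ (inst S N hN b).toDSR.Blocks M T) :
    IsStable S N b fun u v w => ∃ a₁ a₂ a₃ : Fin (inst S N hN b).n, decode S N a₁ = u ∧
      decode S N a₂ = v ∧ decode S N a₃ = w ∧ {a₁, a₂, a₃} ∈ M := by
  refine ⟨?_, ?_, ?_, ?_, ?_⟩
  · rintro _ _ _ ⟨a₁, a₂, a₃, rfl, -, -, -⟩
    exact valid_decode a₁.2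
  · rintro _ _ _ ⟨a₁, a₂, a₃, rfl, rfl, rfl, h⟩
    refine ⟨a₂, a₃, a₁, rfl, rfl, rfl, ?_⟩
    rwa [show ({a₂, a₃, a₁} : Finset (Fin (inst S N hN b).n)) = {a₁, a₂, a₃} by
      ext; simp; tauto]
  · rintro _ _ _ ⟨a₁, a₂, a₃, rfl, rfl, rfl, h⟩
    refine ⟨a₁, a₃, a₂, rfl, rfl, rfl, ?_⟩
    rwa [Finset.pair_comm]
  · rintro _ _ _ _ _ ⟨a₁, a₂, a₃, rfl, rfl, rfl, h⟩ ⟨a₁', a₂', a₃', e, rfl, rfl, h'⟩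
    obtain rfl : a₁' = a₁ := Fin.ext (decode_injective e)
    have hT : ({a₁', a₂, a₃} : Finset (Fin (inst S N hN b).n)) = {a₁', a₂', a₃'} := by
      by_contra hne
      exact (Finset.disjoint_left.1 (hM.2 _ h _ h' hne)) (Finset.mem_insert_self a₁' _)
        (Finset.mem_insert_self _ _)
    have hc : ({a₁', a₂', a₃'} : Finset (Fin (inst S N hN b).n)).card = 3 := hM.1 _ h'
    obtain ⟨h₁, h₂, h₃⟩ := ne_of_card_eq_three hc
    have m₂ : a₂' ∈ ({a₁', a₂, a₃} : Finset (Fin (inst S N hN b).n)) := hT ▸ by simp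
    have m₃ : a₃' ∈ ({a₁', a₂, a₃} : Finset (Fin (inst S N hN b).n)) := hT ▸ by simp
    simp only [Finset.mem_insert, Finset.mem_singleton] at m₂ m₃
    rcases m₂ with m₂ | rfl | rfl
    · exact absurd m₂.symm h₁
    · rcases m₃ with m₃ | m₃ | rfl
      · exact absurd m₃.symm h₂
      · exact absurd m₃.symm h₃
      · exact .inl ⟨rfl, rfl⟩
    · rcases m₃ with m₃ | rfl | m₃
      · exact absurd m₃.symm h₂
      · exact .inr ⟨rfl, rfl⟩
      · exact absurd m₃.symm h₃
  · intro u v w hu hv hw huv hvw huw hm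
    by_contra hcon
    push Not at hcon
    have ex : ∀ {u : Agent}, Valid S N u → ∃ x : Fin (inst S N hN b).n, decode S N x = u :=
      fun hu => ⟨num hu, decode_encode hu⟩
    obtain ⟨x, rfl⟩ := ex hu
    obtain ⟨y, rfl⟩ := ex hv
    obtain ⟨z, rfl⟩ := ex hw
    have hxy : x ≠ y := fun h => huv (h ▸ rfl)
    have hyz : y ≠ z := fun h => hvw (h ▸ rfl)
    have hxz : x ≠ z := fun h => huw (h ▸ rfl)
    -- An agent that is not content is unmatched or strictly prefers the other two agents: the two
    -- alternatives in `Blocks`.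
    have key : ∀ {x y z : Fin (inst S N hN b).n} {s : Finset (Fin (inst S N hN b).n)},
        s = {y, z} → x ≠ y → y ≠ z → x ≠ z →
        ¬ Content S N b (fun u v w => ∃ a₁ a₂ a₃ : Fin (inst S N hN b).n, decode S N a₁ = u ∧
          decode S N a₂ = v ∧ decode S N a₃ = w ∧ {a₁, a₂, a₃} ∈ M) (decode S N x)
          (decode S N y) (decode S N z) →
        (∀ T ∈ M, x ∉ T) ∨ ∃ T ∈ M, x ∈ T ∧
          (inst S N hN b).toDSR.Prefers x s (T.erase x) := by
      rintro x y z _ rfl hxy hyz hxz h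
      by_contra! h'
      obtain ⟨⟨T, hT, hmem⟩, h₂⟩ := h'
      obtain ⟨p, q, hpq, hp, hq, e₁, e₂⟩ := exists_erase_eq_pair (hM.1 T hT) hmem
      have h₃ := h₂ T hT hmem
      rw [e₁] at h₃
      refine h ⟨_, _, ⟨x, p, q, rfl, rfl, rfl, e₂ ▸ hT⟩, ?_⟩
      exact not_lt.1 ((prefers_inst_iff hyz hxy.symm hxz.symm hpq hp hq).not.1 h₃)
    obtain ⟨e₁, e₂, e₃⟩ := erase_triple hxy hxz hyz
    refine hst {x, y, z} ⟨Finset.card_eq_three.2 ⟨x, y, z, hxy, hxz, hyz, rfl⟩, fun a ha => ?_⟩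
    rcases Finset.mem_insert.1 ha with rfl | ha
    · exact key e₁ hxy hyz hxz hcon.1
    rcases Finset.mem_insert.1 ha with rfl | ha
    · exact key e₂ hyz hxz.symm hxy.symm hcon.2.1
    obtain rfl := Finset.mem_singleton.1 ha
    exact key e₃ hxz.symm hxy hyz.symm hcon.2.2

/-- The matching for a selection. -/
def matching (hN : 0 < N) (sel : ℕ → ℕ) : Finset (Finset (Fin (inst S N hN b).n)) :=
  Finset.univ.image fun a : Fin (inst S N hN b).n =>
    Finset.univ.filter fun a' : Fin (inst S N hN b).n =>
    label sel (decode S N a'.1) = label sel (decode S N a.1)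

theorem exists_filter_label_eq (hN : 0 < N) {sel : ℕ → ℕ} (hs : Selection S N b sel)
    (a : Fin (inst S N hN b).n) : ∃ p q : Fin (inst S N hN b).n, p ≠ q ∧ p ≠ a ∧ q ≠ a ∧
      decode S N p = (mates sel (decode S N a)).1 ∧ decode S N q = (mates sel (decode S N a)).2 ∧
      (Finset.univ.filter fun a' : Fin (inst S N hN b).n =>
        label sel (decode S N a'.1) = label sel (decode S N a.1)) = {a, p, q} := by
  have ha := valid_decode a.2
  obtain ⟨h₁, h₂, h₃, h₄, h₅⟩ := valid_mates hs ha
  have dn : ∀ {u : Agent} (hu : Valid S N u), decode S N (num (hN := hN) (b := b) hu) = u :=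
    fun hu => decode_encode hu
  have eq_iff : ∀ {a₁ a₂ : Fin (inst S N hN b).n}, a₁ = a₂ ↔ decode S N a₁ = decode S N a₂ :=
    ⟨fun h => h ▸ rfl, fun h => Fin.ext (decode_injective h)⟩
  refine ⟨num h₁, num h₂, ?_, ?_, ?_, dn h₁, dn h₂, ?_⟩
  · rw [Ne, eq_iff, dn, dn]
    exact h₅
  · rw [Ne, eq_iff, dn]
    exact h₃.symm
  · rw [Ne, eq_iff, dn]
    exact h₄.symm
  · ext a'
    rw [Finset.mem_filter, Finset.mem_insert, Finset.mem_insert, Finset.mem_singleton,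
      eq_iff (a₁ := a') (a₂ := a), eq_iff (a₁ := a') (a₂ := num h₁),
      eq_iff (a₁ := a') (a₂ := num h₂), dn, dn, label_eq_iff ha (valid_decode a'.2)]
    simp

theorem isMatching_matching (hN : 0 < N) {sel : ℕ → ℕ} (hs : Selection S N b sel) :
    (inst S N hN b).toDSR.IsMatching (matching (b := b) hN sel) := by
  constructor
  · intro T hT
    obtain ⟨a, -, rfl⟩ := Finset.mem_image.1 hT
    obtain ⟨p, q, h₁, h₂, h₃, -, -, e⟩ := exists_filter_label_eq hN hs a
    rw [e]
    exact Finset.card_eq_three.2 ⟨_, _, _, h₂.symm, h₃.symm, h₁, rfl⟩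
  · intro T hT U hU hne
    obtain ⟨a, -, rfl⟩ := Finset.mem_image.1 hT
    obtain ⟨a', -, rfl⟩ := Finset.mem_image.1 hU
    refine Finset.disjoint_left.2 fun d hd hd' => hne ?_
    have h₁ := (Finset.mem_filter.1 hd).2
    have h₂ := (Finset.mem_filter.1 hd').2
    rw [← h₁, ← h₂]

theorem wants_of_blocks {hN : 0 < N} {sel : ℕ → ℕ} (hs : Selection S N b sel)
    {T : Finset (Fin (inst S N hN b).n)}
    (hT : (inst S N hN b).toDSR.Blocks (matching (b := b) hN sel) T)
    {a p q : Fin (inst S N hN b).n} (ha : a ∈ T) (h₁ : p ≠ q) (h₂ : p ≠ a) (h₃ : q ≠ a)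
    (e : T.erase a = {p, q}) :
    Wants S N b sel (decode S N a) (decode S N p) (decode S N q) := by
  obtain ⟨p', q', g₁, g₂, g₃, g₄, g₅, e'⟩ := exists_filter_label_eq hN hs a
  have hmem : ∀ U : Finset (Fin (inst S N hN b).n), U ∈ matching (b := b) hN sel → a ∈ U →
      U.erase a = {p', q'} := by
    intro U hU haU
    have : U = {a, p', q'} := by
      rw [← e']
      obtain ⟨d, -, rfl⟩ := Finset.mem_image.1 hU
      rw [(Finset.mem_filter.1 haU).2]
    rw [this, (erase_triple g₂.symm g₃.symm g₁).1]
  have hin : ({a, p', q'} : Finset (Fin (inst S N hN b).n)) ∈ matching (b := b) hN sel :=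
    Finset.mem_image.2 ⟨a, Finset.mem_univ a, e'⟩
  rcases hT.2 a ha with h | ⟨U, hU, haU, h⟩
  · exact absurd (Finset.mem_insert_self a _) (h _ hin)
  · have h' : (inst S N hN b).toDSR.Prefers a {p, q} {p', q'} := hmem U hU haU ▸ e ▸ h
    have := (prefers_inst_iff h₁ h₂ h₃ g₁ g₂ g₃).1 h'
    rwa [g₄, g₅] at this

theorem not_blocks_matching (hN : 0 < N) {sel : ℕ → ℕ} (hs : Selection S N b sel)
    (T : Finset (Fin (inst S N hN b).n)) :
    ¬ (inst S N hN b).toDSR.Blocks (matching (b := b) hN sel) T := by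
  intro hT
  obtain ⟨x, y, z, hxy, hxz, hyz, rfl⟩ := Finset.card_eq_three.1 hT.1
  obtain ⟨e₁, e₂, e₃⟩ := erase_triple hxy hxz hyz
  exact Blocking.elim hs ⟨valid_decode x.2, valid_decode y.2, valid_decode z.2,
    wants_of_blocks hs hT (Finset.mem_insert_self _ _)
      hyz hxy.symm hxz.symm e₁,
    wants_of_blocks hs hT (Finset.mem_insert_of_mem (Finset.mem_insert_self _ _))
      hxz.symm hyz.symm hxy e₂,
    wants_of_blocks hs hT
      (Finset.mem_insert_of_mem (Finset.mem_insert_of_mem (Finset.mem_singleton_self _)))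
      hxy hxz hyz e₃⟩

theorem hasStableMatching_iff (hN : 0 < N) :
    (inst S N hN b).toDSRPoset.HasStableMatching ↔ ∃ sel, Selection S N b sel := by
  constructor
  · rintro ⟨M, hM, hst⟩
    exact (isStable_of_stable hN hM hst).exists_selection
  · rintro ⟨sel, hs⟩
    exact ⟨_, isMatching_matching hN hs, not_blocks_matching hN hs⟩

end Gadget

end Roommates

namespace Roommates

namespace Gadget

/-! ## Cliques as selections -/

section Clique

variable (k n : ℕ) (adj : ℕ → ℕ → Bool)

/-- The bound on the system `ρ` that encodes the vertex `d`. -/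
def level (d ρ : ℕ) : ℕ :=
  if ρ % 2 = 0 then d * (n + 1) + d else (n + 1) * (n + 1) - 1 - (d * (n + 1) + d)

/-- The choice `c` in the slot with the number `τ` is admissible: it encodes a pair of adjacent
vertices, or of equal ones for the slots on the diagonal. -/
def Admissible (τ c : ℕ) : Prop :=
  c / (n + 1) < n ∧ c % (n + 1) < n ∧
    if τ / k = τ % k then c / (n + 1) = c % (n + 1) else adj (c / (n + 1)) (c % (n + 1)) = true

instance (τ c : ℕ) : Decidable (Admissible k n adj τ c) := by
  unfold Admissible
  infer_instance

/-- The bound on the system `ρ` that the choice `c` in the system `π` imposes.  The systems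
`2 * τ` and `2 * τ + 1` belong to the slot `τ = p * k + q`, which holds the `p`-th and the `q`-th
vertex of a clique. -/
def demand (π c ρ : ℕ) : ℕ :=
  if π % 2 = 1 then 0
  else if Admissible k n adj (π / 2) c then
    if ρ / 2 = π / 2 / k * k + π / 2 / k then level n (c / (n + 1)) ρ
    else if ρ / 2 = π / 2 % k * k + π / 2 % k then level n (c % (n + 1)) ρ
    else 0
  else if ρ = π + 1 then (n + 1) * (n + 1) else 0

variable {k n adj}

/-! ### Two-digit numerals and selections -/

theorem mul_add_lt_mul {m i j u : ℕ} (hi : i < m) (hj : j < u) : i * u + j < m * u :=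
  calc i * u + j < (i + 1) * u := by rw [Nat.succ_mul]; omega
    _ ≤ m * u := Nat.mul_le_mul_right _ hi

theorem mul_add_div_of_lt {u i j : ℕ} (hj : j < u) : (i * u + j) / u = i := by
  rw [Nat.mul_comm, Nat.mul_add_div (by omega), Nat.div_eq_of_lt hj, Nat.add_zero]

theorem mul_add_mod_of_lt {u i j : ℕ} (hj : j < u) : (i * u + j) % u = j := by
  rw [Nat.mul_comm, Nat.mul_add_mod, Nat.mod_eq_of_lt hj]

/-- An inadmissible choice demands level `N` of the partner system, which does not exist. -/
theorem admissible_of_selection {sel : ℕ → ℕ}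
    (hs : Selection (k * k) ((n + 1) * (n + 1)) (demand k n adj) sel) {τ : ℕ} (hτ : τ < k * k) :
    Admissible k n adj τ (sel (2 * τ)) := by
  by_contra h
  have h₁ := hs.2.2 (2 * τ) (by omega) (2 * τ + 1) (by omega) (by omega)
  have h₂ := hs.1 (2 * τ + 1) (by omega)
  rw [demand, if_neg (by omega), if_neg (by rwa [Nat.mul_div_cancel_left _ (by norm_num)]),
    if_pos rfl] at h₁
  omega

/-- The two lower bounds add up to `N - 1`, the largest sum allowed, so both hold with equality. -/
theorem eq_of_level_le {sel : ℕ → ℕ} {τ d : ℕ} (hd : d < n)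
    (h : sel (2 * τ) + sel (2 * τ + 1) < (n + 1) * (n + 1))
    (h₁ : level n d (2 * τ) ≤ sel (2 * τ)) (h₂ : level n d (2 * τ + 1) ≤ sel (2 * τ + 1)) :
    sel (2 * τ) / (n + 1) = d := by
  have := mul_add_lt_mul (m := n + 1) (u := n + 1) (i := d) (j := d) (by omega) (by omega)
  rw [level, if_pos (by omega)] at h₁
  rw [level, if_neg (by omega)] at h₂
  rw [show sel (2 * τ) = d * (n + 1) + d by omega, mul_add_div_of_lt (by omega)]

/-- Vertices are read off the diagonal slots. The slot `p * k + q` forces its two digits upon the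
diagonal slots of `p` and `q`, and its admissibility is the adjacency of the two. Conversely, even
systems take the numeral of the pair and odd systems its complement to `N - 1`. -/
theorem exists_selection_iff :
    (∃ sel, Selection (k * k) ((n + 1) * (n + 1)) (demand k n adj) sel) ↔
      ∃ v : ℕ → ℕ, (∀ p < k, v p < n) ∧
        ∀ p < k, ∀ q < k, p ≠ q → adj (v p) (v q) = true := by
  constructor
  · rintro ⟨sel, hs⟩
    refine ⟨fun p => sel (2 * (p * k + p)) / (n + 1), fun p hp =>
      (admissible_of_selection hs (mul_add_lt_mul hp hp)).1, fun p hp q hq hpq => ?_⟩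
    have hτ := mul_add_lt_mul hp hq
    have ha := admissible_of_selection hs hτ
    have hpp := mul_add_lt_mul hp hp
    have hqq := mul_add_lt_mul hq hq
    have e₁ := mul_add_div_of_lt (i := p) hq
    have e₂ := mul_add_mod_of_lt (i := p) hq
    -- Bounds act only on systems other than the imposing one, and the first matching case of
    -- `demand` applies; hence the three slots must be distinct.
    have n₁ : p * k + p ≠ p * k + q := by omega
    have n₂ : q * k + q ≠ p * k + q := fun h => hpq (by
      have := congrArg (· / k) h
      simpa only [mul_add_div_of_lt hq, e₁] using this.symm)
    have n₃ : q * k + q ≠ p * k + p := fun h => hpq (by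
      have := congrArg (· / k) h
      simpa only [mul_add_div_of_lt hq, mul_add_div_of_lt hp] using this.symm)
    have g₁ : ∀ ρ, ρ / 2 = p * k + p →
        level n (sel (2 * (p * k + q)) / (n + 1)) ρ ≤ sel ρ := by
      intro ρ hρ
      have := hs.2.2 (2 * (p * k + q)) (by omega) ρ (by omega) (by omega)
      rwa [demand, if_neg (by omega), Nat.mul_div_cancel_left _ (by norm_num), if_pos ha, e₁,
        if_pos hρ] at this
    have g₂ : ∀ ρ, ρ / 2 = q * k + q →
        level n (sel (2 * (p * k + q)) % (n + 1)) ρ ≤ sel ρ := by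
      intro ρ hρ
      have := hs.2.2 (2 * (p * k + q)) (by omega) ρ (by omega) (by omega)
      rwa [demand, if_neg (by omega), Nat.mul_div_cancel_left _ (by norm_num), if_pos ha, e₁, e₂,
        if_neg (by omega), if_pos hρ] at this
    have f₁ := eq_of_level_le ha.1 (hs.2.1 _ hpp) (g₁ _ (by omega)) (g₁ _ (by omega))
    have f₂ := eq_of_level_le ha.2.1 (hs.2.1 _ hqq) (g₂ _ (by omega)) (g₂ _ (by omega))
    have h := ha.2.2
    rw [e₁, e₂, if_neg hpq] at h
    simpa only [f₁, f₂] using h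
  · rintro ⟨v, hv, hadj⟩
    let c : ℕ → ℕ := fun τ => v (τ / k) * (n + 1) + v (τ % k)
    let sel : ℕ → ℕ := fun π =>
      if π % 2 = 0 then c (π / 2) else (n + 1) * (n + 1) - 1 - c (π / 2)
    have hdiv : ∀ τ < k * k, τ / k < k ∧ τ % k < k := fun τ hτ =>
      ⟨Nat.div_lt_of_lt_mul hτ, Nat.mod_lt _ (Nat.pos_of_ne_zero fun h => by simp [h] at hτ)⟩
    have hc : ∀ τ < k * k, c τ < (n + 1) * (n + 1) := fun τ hτ =>
      mul_add_lt_mul (Nat.lt_succ_of_lt (hv _ (hdiv τ hτ).1))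
        (Nat.lt_succ_of_lt (hv _ (hdiv τ hτ).2))
    have hsel : ∀ p < k, ∀ ρ, ρ / 2 = p * k + p → sel ρ = level n (v p) ρ := by
      intro p hp ρ hρ
      simp only [sel, c, level, hρ, mul_add_div_of_lt hp, mul_add_mod_of_lt hp]
    refine ⟨sel, fun π hπ => ?_, fun τ hτ => ?_, fun π hπ ρ hρ hne => ?_⟩
    · have := hc (π / 2) (by omega)
      simp only [sel]
      split_ifs <;> omega
    · have := hc τ hτ
      simp only [sel, Nat.mul_div_cancel_left τ (show 0 < 2 by norm_num),
        show (2 * τ + 1) / 2 = τ by omega, show (2 * τ) % 2 = 0 by omega,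
        show (2 * τ + 1) % 2 ≠ 0 by omega, if_true, if_false]
      omega
    · by_cases hodd : π % 2 = 1
      · rw [demand, if_pos hodd]
        exact Nat.zero_le _
      have hd := hdiv (π / 2) (by omega)
      have e : sel π = c (π / 2) := if_pos (by omega)
      have e₁ : c (π / 2) / (n + 1) = v (π / 2 / k) :=
        mul_add_div_of_lt (Nat.lt_succ_of_lt (hv _ hd.2))
      have e₂ : c (π / 2) % (n + 1) = v (π / 2 % k) :=
        mul_add_mod_of_lt (Nat.lt_succ_of_lt (hv _ hd.2))
      have ha : Admissible k n adj (π / 2) (c (π / 2)) := by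
        rw [Admissible, e₁, e₂]
        refine ⟨hv _ hd.1, hv _ hd.2, ?_⟩
        split_ifs with h
        · rw [h]
        · exact hadj _ hd.1 _ hd.2 h
      rw [demand, if_neg hodd, e, if_pos ha, e₁, e₂]
      split_ifs with h₁ h₂
      · exact (hsel _ hd.1 _ h₁).ge
      · exact (hsel _ hd.2 _ h₂).ge
      · exact Nat.zero_le _

end Clique

end Gadget

end Roommates

/-! ## The encoding determines the preferences -/

namespace Parameterized

theorem encNat_append_inj {m m' : ℕ} {l l' : List (Fin 2)}
    (h : encNat m ++ l = encNat m' ++ l') : m = m' ∧ l = l' := by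
  induction m generalizing m' with
  | zero =>
    cases m' with
    | zero => exact ⟨rfl, by simpa [encNat] using h⟩
    | succ m' => simp [encNat, List.replicate_succ] at h
  | succ m ih =>
    cases m' with
    | zero => simp [encNat, List.replicate_succ] at h
    | succ m' =>
      have := ih (m' := m') (by simpa [encNat, List.replicate_succ] using h)
      exact ⟨by rw [this.1], this.2⟩

theorem flatMap_encNat_injective :
    Function.Injective fun l : List ℕ => l.flatMap encNat := by
  intro l l' h
  simp only at h
  induction l generalizing l' with
  | nil =>
    cases l' with
    | nil => rfl
    | cons m l' => simp [encNat] at h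
  | cons m l ih =>
    cases l' with
    | nil => simp [encNat] at h
    | cons m' l' =>
      obtain ⟨rfl, h'⟩ := encNat_append_inj (by simpa only [List.flatMap_cons] using h)
      rw [ih h']

theorem length_encRel {n : ℕ} (r : Fin n → Fin n → Prop) : (encRel r).length = n * n := by
  simp [encRel, List.length_flatMap]

end Parameterized

namespace Roommates

open Parameterized

/-- Blocks of matching lengths can be cut apart without separators. -/
theorem eq_of_flatMap_eq_flatMap {ι κ : Type*} {f g : ι → List κ} {l : List ι}
    (hlen : ∀ a ∈ l, (f a).length = (g a).length) (h : l.flatMap f = l.flatMap g) :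
    ∀ a ∈ l, f a = g a := by
  induction l with
  | nil => simp
  | cons a l ih =>
    rw [List.flatMap_cons, List.flatMap_cons] at h
    obtain ⟨h₁, h₂⟩ := List.append_inj h (hlen a List.mem_cons_self)
    intro b hb
    rcases List.mem_cons.1 hb with rfl | hb
    · exact h₁
    · exact ih (fun a ha => hlen a (List.mem_cons_of_mem _ ha)) h₂ b hb

theorem eq_of_flatMap_eq_of_length {ι κ : Type*} {f : ι → List κ} (hf : Function.Injective f)
    {m : ℕ} {l l' : List ι} (hl : ∀ a ∈ l, (f a).length = m) (hl' : ∀ a ∈ l', (f a).length = m)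
    (hlen : l.length = l'.length) (h : l.flatMap f = l'.flatMap f) : l = l' := by
  induction l generalizing l' with
  | nil => exact (List.length_eq_zero_iff.1 hlen.symm).symm
  | cons a l ih =>
    cases l' with
    | nil => simp at hlen
    | cons a' l' =>
      rw [List.flatMap_cons, List.flatMap_cons] at h
      obtain ⟨h₁, h₂⟩ := List.append_inj h
        ((hl a List.mem_cons_self).trans (hl' a' List.mem_cons_self).symm)
      rw [hf h₁, ih (fun a ha => hl a (List.mem_cons_of_mem _ ha))
        (fun a ha => hl' a (List.mem_cons_of_mem _ ha)) (by simpa using hlen) h₂]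

/-- The elements of a set of agents in increasing order. -/
def sortedVals {n : ℕ} (t : Finset (Fin n)) : List ℕ := (t.sort (· ≤ ·)).map Fin.val

theorem sortedVals_injective {n : ℕ} : Function.Injective (sortedVals (n := n)) := by
  intro t u h
  have h' := List.map_injective_iff.2 Fin.val_injective h
  rw [← Finset.sort_toFinset (r := (· ≤ ·)) t, h', Finset.sort_toFinset]

theorem length_sortedVals {n : ℕ} (t : Finset (Fin n)) : (sortedVals t).length = t.card := by
  simp [sortedVals]

namespace DSRPoset

variable {d : ℕ}

theorem enc_eq (I : DSRPoset d) : I.enc = encNat I.n ++ (encRel I.ge ++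
    ((List.finRange I.n).flatMap fun a => (I.pref a).flatMap sortedVals).flatMap encNat) := by
  rw [enc, List.append_assoc, List.flatMap_assoc]
  congr 2
  refine List.flatMap_congr fun a _ => ?_
  rw [List.flatMap_assoc]
  refine List.flatMap_congr fun t _ => ?_
  simp [sortedVals, List.flatMap_map, List.flatMap_assoc]

theorem length_pref_eq {n : ℕ} {l l' : List (Finset (Fin n))} (hl : l.Nodup) (hl' : l'.Nodup)
    (h : ∀ t, t ∈ l ↔ t ∈ l') : l.length = l'.length :=
  ((List.perm_ext_iff_of_nodup hl hl').2 h).length_eq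

/-- Instances with the same encoding have the same preferences. -/
theorem hasStableMatching_of_enc_eq {I J : DSRPoset d} (h : I.enc = J.enc)
    (hI : I.HasStableMatching) : J.HasStableMatching := by
  rw [enc_eq, enc_eq] at h
  obtain ⟨hn, h⟩ := encNat_append_inj h
  obtain ⟨⟨n, pref, hnd, hmem⟩, ge, h₁, h₂, h₃, h₄⟩ := I
  obtain ⟨⟨n', pref', hnd', hmem'⟩, ge', h₁', h₂', h₃', h₄'⟩ := J
  simp only at hn
  subst hn
  -- The matrix of the poset is discarded, as stability depends on the preferences alone.
  obtain ⟨-, h⟩ := List.append_inj h (by rw [length_encRel, length_encRel])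
  have h := flatMap_encNat_injective h
  have hlen : ∀ a, (pref a).length = (pref' a).length := fun a =>
    length_pref_eq (hnd a) (hnd' a) fun t => by rw [hmem, hmem']
  have hc : ∀ a, ∀ t ∈ pref a, (sortedVals t).length = d - 1 := fun a t ht => by
    have := (hmem a t).1 ht
    rw [length_sortedVals]
    omega
  have hc' : ∀ a, ∀ t ∈ pref' a, (sortedVals t).length = d - 1 := fun a t ht => by
    have := (hmem' a t).1 ht
    rw [length_sortedVals]
    omega
  have hsum : ∀ (l : List (Finset (Fin n))), (∀ t ∈ l, (sortedVals t).length = d - 1) →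
      (l.flatMap sortedVals).length = l.length * (d - 1) := fun l hl => by
    rw [List.length_flatMap, List.map_congr_left hl]
    simp
  have hpref : pref = pref' := funext fun a =>
    eq_of_flatMap_eq_of_length sortedVals_injective (hc a) (hc' a) (hlen a)
      (eq_of_flatMap_eq_flatMap (fun a _ => by rw [hsum _ (hc a), hsum _ (hc' a), hlen]) h a
        (List.mem_finRange a))
  subst hpref
  exact hI

end DSRPoset

end Roommates

namespace Roommates

namespace Gadget

open While

/-! ## The reduction as a program -/

section PolyTime

variable {α : Type} [Enc α]

theorem polyTime_code {J : α → KeyInstance} (hn : PolyTime fun x => (J x).n)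
    (hb : PolyTime fun x => (J x).bound)
    (hk : PolyTime fun x : α × ℕ × ℕ × ℕ => (J x.1).key x.2.1 x.2.2.1 x.2.2.2)
    (hc : PolyTime fun x : α × ℕ => (J x.1).chain x.2) : PolyTime fun x => (J x).code := by
  unfold KeyInstance.code
  refine ((PolyTime.append ((hn.replicate (.const 1)).append (.const [0])) ?_).append ?_)
  · refine hn.range.flatMap ((hn.comp PolyTime.id.fst).range.map ?_)
    refine .ite (.and (.eq ?_ ?_) (.le PolyTime.id.fst.snd PolyTime.id.snd)) (.const 1) (.const 0)
    · exact hc.comp PolyTime.id.fst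
    · exact hc.comp (PolyTime.id.fst.fst.pair PolyTime.id.snd)
  · refine hn.range.flatMap ((hb.comp PolyTime.id.fst).range.flatMap
      ((hn.comp PolyTime.id.fst.fst).range.flatMap
        ((hn.comp PolyTime.id.fst.fst.fst).range.flatMap ?_)))
    have ha : PolyTime fun x : (((α × ℕ) × ℕ) × ℕ) × ℕ => x.1.1.1.2 := PolyTime.id.fst.fst.fst.snd
    have hv : PolyTime fun x : (((α × ℕ) × ℕ) × ℕ) × ℕ => x.1.1.2 := PolyTime.id.fst.fst.snd
    have hb : PolyTime fun x : (((α × ℕ) × ℕ) × ℕ) × ℕ => x.1.2 := PolyTime.id.fst.snd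
    have hc : PolyTime fun x : (((α × ℕ) × ℕ) × ℕ) × ℕ => x.2 := PolyTime.id.snd
    refine .ite (.and (.lt hb hc) (.and (.not (.eq hb ha)) (.and (.not (.eq hc ha))
      (.eq ?_ hv)))) ?_ (.const _)
    · exact hk.comp (PolyTime.id.fst.fst.fst.fst.pair (ha.pair (hb.pair hc)))
    · exact ((hb.replicate (.const 1)).append (.const _)).append
        ((hc.replicate (.const 1)).append (.const _))

theorem polyTime_bad {N : α → ℕ} (hN : PolyTime N) : PolyTime fun x => bad (N x) :=
  ((PolyTime.const 3).mul hN).add (.const 5)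

theorem polyTime_gadgetKey {N κ κ₁ κ₂ : α → ℕ} (hN : PolyTime N) (hκ : PolyTime κ)
    (hκ₁ : PolyTime κ₁) (hκ₂ : PolyTime κ₂) :
    PolyTime fun x => gadgetKey (N x) (κ x) (κ₁ x) (κ₂ x) := by
  unfold gadgetKey
  have hbad := polyTime_bad hN
  repeat' first
    | assumption
    | exact PolyTime.const _
    | apply PolyTime.ite
    | apply PolyDec.and
    | apply PolyDec.eq

theorem polyTime_orderedKey {N : α → ℕ} {b : α → ℕ → ℕ → ℕ → ℕ} {u p q : α → Agent}
    (hN : PolyTime N) (hb : PolyTime fun x : α × ℕ × ℕ × ℕ => b x.1 x.2.1 x.2.2.1 x.2.2.2)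
    (hu : PolyTime u) (hp : PolyTime p) (hq : PolyTime q) :
    PolyTime fun x => orderedKey (N x) (b x) (u x) (p x) (q x) := by
  have hbad := polyTime_bad hN
  have hg := polyTime_gadgetKey hN hu.fst hp.fst hq.fst
  have hdem : PolyTime fun x => b x (u x).2.1 (p x).2.2 (q x).2.1 :=
    hb.comp (PolyTime.id.pair (hu.snd.fst.pair (hp.snd.snd.pair hq.snd.fst)))
  have hu₀ := hu.fst
  have hu₁ := hu.snd.fst
  have hu₂ := hu.snd.snd
  have hp₀ := hp.fst
  have hp₁ := hp.snd.fst
  have hp₂ := hp.snd.snd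
  have hq₀ := hq.fst
  have hq₁ := hq.snd.fst
  have hq₂ := hq.snd.snd
  unfold orderedKey
  repeat' first
    | assumption
    | exact PolyTime.const _
    | apply PolyTime.ite
    | apply PolyDec.and
    | apply PolyDec.not
    | apply PolyDec.eq
    | apply PolyDec.lt
    | apply PolyDec.le
    | apply PolyTime.add
    | apply PolyTime.mul
    | apply PolyTime.div

theorem polyTime_key {N : α → ℕ} {b : α → ℕ → ℕ → ℕ → ℕ} {u p q : α → Agent}
    (hN : PolyTime N) (hb : PolyTime fun x : α × ℕ × ℕ × ℕ => b x.1 x.2.1 x.2.2.1 x.2.2.2)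
    (hu : PolyTime u) (hp : PolyTime p) (hq : PolyTime q) :
    PolyTime fun x => key (N x) (b x) (u x) (p x) (q x) :=
  (polyTime_orderedKey hN hb hu hp hq).min (polyTime_orderedKey hN hb hu hq hp)

theorem polyTime_decode {S N a : α → ℕ} (hS : PolyTime S) (hN : PolyTime N) (ha : PolyTime a) :
    PolyTime fun x => decode (S x) (N x) (a x) := by
  unfold decode
  repeat' first
    | assumption
    | exact PolyTime.const _
    | apply PolyTime.ite
    | apply PolyTime.pair
    | apply PolyDec.lt
    | apply PolyTime.add
    | apply PolyTime.mul
    | apply PolyTime.div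
    | apply PolyTime.mod
    | apply PolyTime.sub

theorem polyTime_chain {S N a : α → ℕ} (hS : PolyTime S) (hN : PolyTime N) (ha : PolyTime a) :
    PolyTime fun x => chain (S x) (N x) (a x) :=
  .ite (.lt ha (((PolyTime.const 6).mul hS).mul hN)) (ha.div hN)
    (((PolyTime.const 6).mul hS).add (ha.sub (((PolyTime.const 6).mul hS).mul hN)))

theorem polyTime_code_inst {S N : α → ℕ} {hN₀ : ∀ x, 0 < N x} {b : α → ℕ → ℕ → ℕ → ℕ}
    (hS : PolyTime S) (hN : PolyTime N)
    (hb : PolyTime fun x : α × ℕ × ℕ × ℕ => b x.1 x.2.1 x.2.2.1 x.2.2.2) :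
    PolyTime fun x => (inst (S x) (N x) (hN₀ x) (b x)).code := by
  have h₁ : PolyTime fun x => 6 * S x * N x + 6 * S x :=
    (((PolyTime.const 6).mul hS).mul hN).add ((PolyTime.const 6).mul hS)
  have hS' : PolyTime fun x : α × ℕ × ℕ × ℕ => S x.1 := hS.comp PolyTime.id.fst
  have hN' : PolyTime fun x : α × ℕ × ℕ × ℕ => N x.1 := hN.comp PolyTime.id.fst
  have hb' : PolyTime fun x : (α × ℕ × ℕ × ℕ) × ℕ × ℕ × ℕ => b x.1.1 x.2.1 x.2.2.1 x.2.2.2 :=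
    hb.comp (PolyTime.id.fst.fst.pair PolyTime.id.snd)
  have h₂ : PolyTime fun x : α × ℕ × ℕ × ℕ => key (N x.1) (b x.1) (decode (S x.1) (N x.1) x.2.1)
      (decode (S x.1) (N x.1) x.2.2.1) (decode (S x.1) (N x.1) x.2.2.2) :=
    polyTime_key (b := fun x : α × ℕ × ℕ × ℕ => b x.1) hN' hb'
      (polyTime_decode hS' hN' PolyTime.id.snd.fst)
      (polyTime_decode hS' hN' PolyTime.id.snd.snd.fst)
      (polyTime_decode hS' hN' PolyTime.id.snd.snd.snd)
  have h₃ : PolyTime fun x : α × ℕ => chain (S x.1) (N x.1) x.2 :=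
    polyTime_chain (hS.comp PolyTime.id.fst) (hN.comp PolyTime.id.fst) PolyTime.id.snd
  exact polyTime_code h₁ (polyTime_bad hN).succ h₂ h₃

theorem polyTime_level {n d ρ : α → ℕ} (hn : PolyTime n) (hd : PolyTime d) (hρ : PolyTime ρ) :
    PolyTime fun x => level (n x) (d x) (ρ x) :=
  .ite (.eq (hρ.mod (.const 2)) (.const 0)) ((hd.mul hn.succ).add hd)
    (((hn.succ.mul hn.succ).sub (.const 1)).sub ((hd.mul hn.succ).add hd))

theorem polyDec_admissible {k n τ c : α → ℕ} {adj : α → ℕ → ℕ → Bool} (hk : PolyTime k)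
    (hn : PolyTime n) (hadj : PolyTime fun x : α × ℕ × ℕ => adj x.1 x.2.1 x.2.2) (hτ : PolyTime τ)
    (hc : PolyTime c) : PolyDec fun x => Admissible (k x) (n x) (adj x) (τ x) (c x) := by
  have h₁ := hc.div hn.succ
  have h₂ := hc.mod hn.succ
  have h₃ : PolyDec fun x => τ x / k x = τ x % k x := .eq (hτ.div hk) (hτ.mod hk)
  have h₄ : PolyDec fun x => adj x (c x / (n x + 1)) (c x % (n x + 1)) = true :=
    ⟨_, hadj.comp (PolyTime.id.pair (h₁.pair h₂)), fun _ => Iff.rfl⟩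
  refine (PolyDec.lt h₁ hn).and ((PolyDec.lt h₂ hn).and ?_)
  refine ((h₃.and (PolyDec.eq h₁ h₂).not).not.and (h₃.not.and h₄.not).not).congr fun x => ?_
  split_ifs with h <;> simp [h]

theorem polyTime_demand {k n π c ρ : α → ℕ} {adj : α → ℕ → ℕ → Bool} (hk : PolyTime k)
    (hn : PolyTime n) (hadj : PolyTime fun x : α × ℕ × ℕ => adj x.1 x.2.1 x.2.2) (hπ : PolyTime π)
    (hc : PolyTime c) (hρ : PolyTime ρ) :
    PolyTime fun x => demand (k x) (n x) (adj x) (π x) (c x) (ρ x) := by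
  have h₁ := hπ.div (PolyTime.const 2)
  have h₂ := h₁.div hk
  have h₃ := h₁.mod hk
  have h₄ := hρ.div (PolyTime.const 2)
  refine .ite (.eq (hπ.mod (.const 2)) (.const 1)) (.const 0)
    (.ite (polyDec_admissible hk hn hadj h₁ hc) (.ite (.eq h₄ ((h₂.mul hk).add h₂)) ?_
      (.ite (.eq h₄ ((h₃.mul hk).add h₃)) ?_ (.const 0)))
      (.ite (.eq hρ hπ.succ) (hn.succ.mul hn.succ) (.const 0)))
  · exact polyTime_level hn (hc.div hn.succ) hρ
  · exact polyTime_level hn (hc.mod hn.succ) hρ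

end PolyTime

/-- The number of vertices of the graph that is represented by a string of the given length. -/
def vertexCount (m : ℕ) : ℕ :=
  ((List.range m).filter fun i => (i + 1) * (i + 1) + (i + 1) + 1 ≤ m).length

/-- Adjacency in the graph with `n` vertices that is represented by `w`. -/
def adjacent (w : List ℕ) (n u v : ℕ) : Bool :=
  if w.getD (n + 1 + (u * n + v)) 0 = 1 ∧ w.getD (n + 1 + (v * n + u)) 0 = 1 ∧ u ≠ v then true
  else false

/-- The representation of a graph, in terms of lists of natural numbers. -/
def graphCode (n : ℕ) (adj : ℕ → ℕ → Bool) : List ℕ :=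
  (List.replicate n 1 ++ [0]) ++
    (List.range n).flatMap fun u => (List.range n).map fun v => if adj u v then 1 else 0

/-- The instance for the search of a clique with `k` vertices. -/
def cliqueInst (k n : ℕ) (adj : ℕ → ℕ → Bool) : KeyInstance :=
  inst (k * k) ((n + 1) * (n + 1)) (Nat.mul_pos n.succ_pos n.succ_pos) (demand k n adj)

/-- The reduction from `Clique`.  Strings that do not represent a graph are mapped to the empty
string, which does not represent an instance. -/
def reduction (x : List ℕ × ℕ) : List ℕ × ℕ :=
  if x.1 = graphCode (vertexCount x.1.length) (adjacent x.1 (vertexCount x.1.length)) then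
    ((cliqueInst x.2 (vertexCount x.1.length) (adjacent x.1 (vertexCount x.1.length))).code,
      12 * (x.2 * x.2))
  else ([], 0)

theorem polyTime_vertexCount {α : Type} [Enc α] {m : α → ℕ} (hm : PolyTime m) :
    PolyTime fun x => vertexCount (m x) := by
  have hi : PolyTime fun x : α × ℕ => x.2 + 1 := PolyTime.id.snd.succ
  exact (hm.range.filter (p := fun a i => (i + 1) * (i + 1) + (i + 1) + 1 ≤ m a)
    (PolyDec.le ((hi.mul hi).add hi).succ (hm.comp PolyTime.id.fst))).length

theorem polyTime_adjacent {α : Type} [Enc α] {w : α → List ℕ} {n u v : α → ℕ} (hw : PolyTime w)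
    (hn : PolyTime n) (hu : PolyTime u) (hv : PolyTime v) :
    PolyTime fun x => adjacent (w x) (n x) (u x) (v x) :=
  .ite (.and (.eq (hw.getD_zero (hn.succ.add ((hu.mul hn).add hv))) (.const 1))
    (.and (.eq (hw.getD_zero (hn.succ.add ((hv.mul hn).add hu))) (.const 1)) (.not (.eq hu hv))))
    (.const true) (.const false)

theorem polyTime_graphCode {α : Type} [Enc α] {n : α → ℕ} {adj : α → ℕ → ℕ → Bool}
    (hn : PolyTime n) (hadj : PolyTime fun x : α × ℕ × ℕ => adj x.1 x.2.1 x.2.2) :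
    PolyTime fun x => graphCode (n x) (adj x) :=
  ((hn.replicate (.const 1)).append (.const [0])).append (hn.range.flatMap
    ((hn.comp PolyTime.id.fst).range.map (PolyTime.cond (hadj.comp (PolyTime.id.fst.fst.pair
      (PolyTime.id.fst.snd.pair PolyTime.id.snd))) (.const 1) (.const 0))))

theorem polyTime_reduction : PolyTime reduction := by
  have hn : PolyTime fun x : List ℕ × ℕ => vertexCount x.1.length :=
    polyTime_vertexCount PolyTime.id.fst.length
  have hadj : PolyTime fun x : (List ℕ × ℕ) × ℕ × ℕ =>
      adjacent x.1.1 (vertexCount x.1.1.length) x.2.1 x.2.2 :=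
    polyTime_adjacent PolyTime.id.fst.fst (hn.comp PolyTime.id.fst) PolyTime.id.snd.fst
      PolyTime.id.snd.snd
  refine .ite (.list_eq PolyTime.id.fst (polyTime_graphCode hn hadj))
    (.pair (polyTime_code_inst (PolyTime.id.snd.mul PolyTime.id.snd) (hn.succ.mul hn.succ) ?_)
      ((PolyTime.const 12).mul (PolyTime.id.snd.mul PolyTime.id.snd))) (.const _)
  exact polyTime_demand (α := (List ℕ × ℕ) × ℕ × ℕ × ℕ)
    (adj := fun x => adjacent x.1.1 (vertexCount x.1.1.length)) PolyTime.id.fst.snd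
    (hn.comp PolyTime.id.fst) (hadj.comp (PolyTime.id.fst.fst.pair PolyTime.id.snd))
    PolyTime.id.snd.fst PolyTime.id.snd.snd.fst PolyTime.id.snd.snd.snd

end Gadget

end Roommates

namespace Roommates

namespace Gadget

/-! ## Correctness of the reduction -/

/-- The length `n * n + n + 1` of a graph's encoding is strictly increasing in `n`, so counting the
positive sizes that fit recovers `n`. -/
theorem vertexCount_eq (n : ℕ) : vertexCount (n + 1 + n * n) = n := by
  have h : ∀ i, (i + 1) * (i + 1) + (i + 1) + 1 ≤ n + 1 + n * n ↔ i < n := by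
    intro i
    constructor
    · intro h
      by_contra h'
      have := Nat.mul_self_le_mul_self (show n ≤ i by omega)
      nlinarith
    · intro h
      have := Nat.mul_self_le_mul_self (show i + 1 ≤ n by omega)
      omega
  have h' : ((List.range (n + 1 + n * n)).filter fun i => i < n) = List.range n := by
    rw [Nat.add_assoc, List.range_add, List.filter_append, List.filter_eq_self.2,
      List.filter_eq_nil_iff.2, List.append_nil]
    · simp
    · simp
  simp only [vertexCount, h, h', List.length_range]

theorem length_flatMap_map_range {κ : Type*} (m n : ℕ) (f : ℕ → ℕ → κ) :
    ((List.range m).flatMap fun u => (List.range n).map (f u)).length = m * n := by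
  simp [List.length_flatMap]

theorem getD_flatMap_map_range {m n u v : ℕ} (f : ℕ → ℕ → ℕ) (hu : u < m) (hv : v < n) :
    ((List.range m).flatMap fun u => (List.range n).map (f u)).getD (u * n + v) 0 = f u v := by
  induction m with
  | zero => omega
  | succ m ih =>
    rw [List.range_succ, List.flatMap_append, List.flatMap_singleton]
    rcases Nat.lt_succ_iff_lt_or_eq.1 hu with h | rfl
    · rw [List.getD_append _ _ _ _ (by
        rw [length_flatMap_map_range]; exact mul_add_lt_mul h hv), ih h]
    · rw [List.getD_append_right _ _ _ _ (by rw [length_flatMap_map_range]; omega),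
        length_flatMap_map_range, Nat.add_sub_cancel_left]
      simp [hv]

theorem getD_graphCode {n u v : ℕ} (adj : ℕ → ℕ → Bool) (hu : u < n) (hv : v < n) :
    (graphCode n adj).getD (n + 1 + (u * n + v)) 0 = if adj u v then 1 else 0 := by
  have hl : (List.replicate n 1 ++ [0]).length = n + 1 := by simp
  rw [graphCode, List.getD_append_right _ _ _ _ (by omega), hl, Nat.add_sub_cancel_left,
    getD_flatMap_map_range _ hu hv]

theorem length_graphCode (n : ℕ) (adj : ℕ → ℕ → Bool) :
    (graphCode n adj).length = n + 1 + n * n := by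
  rw [graphCode, List.length_append, length_flatMap_map_range]
  simp

theorem map_val_encGraph {n : ℕ} (G : SimpleGraph (Fin n)) {adj : ℕ → ℕ → Bool}
    (h : ∀ u v : Fin n, adj u v = true ↔ G.Adj u v) :
    (Parameterized.encGraph G).map Fin.val = graphCode n adj := by
  rw [Parameterized.encGraph, graphCode, List.map_append, KeyInstance.map_val_encNat,
    KeyInstance.range_flatMap, Parameterized.encRel, List.map_flatMap]
  congr 1
  refine List.flatMap_congr fun u _ => ?_
  rw [KeyInstance.range_map, List.map_map]
  refine List.map_congr_left fun v _ => ?_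
  by_cases hG : G.Adj u v
  · simp [hG, (h u v).2 hG]
  · simp [hG, (h u v).not.2 hG]

theorem adjacent_iff {w : List ℕ} {n u v : ℕ} : adjacent w n u v = true ↔
    w.getD (n + 1 + (u * n + v)) 0 = 1 ∧ w.getD (n + 1 + (v * n + u)) 0 = 1 ∧ u ≠ v := by
  unfold adjacent
  split_ifs with h
  · exact iff_of_true rfl h
  · exact iff_of_false (fun h => h) h

/-- The graph that is represented by `w`. -/
def graph (w : List ℕ) (n : ℕ) : SimpleGraph (Fin n) where
  Adj u v := adjacent w n u v = true
  symm := ⟨fun _ _ h => adjacent_iff.2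
    ⟨(adjacent_iff.1 h).2.1, (adjacent_iff.1 h).1, (adjacent_iff.1 h).2.2.symm⟩⟩
  loopless := ⟨fun _ h => (adjacent_iff.1 h).2.2 rfl⟩

theorem adjacent_encGraph {n : ℕ} (G : SimpleGraph (Fin n)) (u v : Fin n) :
    adjacent ((Parameterized.encGraph G).map Fin.val) n u v = true ↔ G.Adj u v := by
  classical
  let adj : ℕ → ℕ → Bool := fun u v => decide (∃ (hu : u < n) (hv : v < n), G.Adj ⟨u, hu⟩ ⟨v, hv⟩)
  have hadj : ∀ u v : Fin n, adj u v = true ↔ G.Adj u v := fun u v => by simp [adj]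
  rw [adjacent_iff, map_val_encGraph G hadj, getD_graphCode _ u.2 v.2, getD_graphCode _ v.2 u.2]
  simp only [hadj]
  constructor
  · rintro ⟨h, -, -⟩
    by_contra h'
    simp [h'] at h
  · intro h
    simp [h, h.symm, Fin.val_ne_of_ne h.ne]

theorem exists_isNClique_iff {n k : ℕ} (G : SimpleGraph (Fin n)) {adj : ℕ → ℕ → Bool}
    (h : ∀ u v : Fin n, adj u v = true ↔ G.Adj u v) : (∃ s, G.IsNClique k s) ↔
      ∃ v : ℕ → ℕ, (∀ p < k, v p < n) ∧
        ∀ p < k, ∀ q < k, p ≠ q → adj (v p) (v q) = true := by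
  constructor
  · rintro ⟨s, hs⟩
    let e := s.equivFinOfCardEq hs.card_eq
    refine ⟨fun p => if hp : p < k then (e.symm ⟨p, hp⟩).1.1 else 0, fun p hp => ?_,
      fun p hp q hq hpq => ?_⟩
    · simp only [dif_pos hp]
      exact (e.symm ⟨p, hp⟩).1.2
    · simp only [dif_pos hp, dif_pos hq, h]
      refine hs.isClique (e.symm _).2 (e.symm _).2 fun h' => hpq ?_
      simpa using e.symm.injective (Subtype.ext h')
  · rintro ⟨v, hv, hadj⟩
    let f : Fin k → Fin n := fun p => ⟨v p, hv p p.2⟩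
    have hf : ∀ p q, p ≠ q → G.Adj (f p) (f q) := fun p q hpq =>
      (h _ _).1 (hadj p p.2 q q.2 (Fin.val_ne_of_ne hpq))
    have hinj : Function.Injective f := fun p q e => by
      by_contra hpq
      exact (hf p q hpq).ne e
    refine ⟨Finset.univ.image f, ⟨?_, by simp [Finset.card_image_of_injective _ hinj]⟩⟩
    intro a ha a' ha' hne
    obtain ⟨p, -, rfl⟩ := Finset.mem_image.1 (Finset.mem_coe.1 ha)
    obtain ⟨q, -, rfl⟩ := Finset.mem_image.1 (Finset.mem_coe.1 ha')
    exact hf p q fun e => hne (by rw [e])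

theorem cliqueInst_hasStableMatching_iff (k n : ℕ) (adj : ℕ → ℕ → Bool) :
    (cliqueInst k n adj).toDSRPoset.HasStableMatching ↔ ∃ v : ℕ → ℕ, (∀ p < k, v p < n) ∧
      ∀ p < k, ∀ q < k, p ≠ q → adj (v p) (v q) = true :=
  (hasStableMatching_iff _).trans exists_selection_iff

/-- `adjacent` symmetrizes the matrix and ignores the diagonal, so it always yields a graph; a
string is valid exactly if encoding this graph returns the string. -/
theorem mem_clique_iff (w : List (Fin 2)) (k : ℕ) : (w, k) ∈ Parameterized.Clique ↔
    w.map Fin.val = graphCode (vertexCount (w.map Fin.val).length)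
      (adjacent (w.map Fin.val) (vertexCount (w.map Fin.val).length)) ∧
    ∃ v : ℕ → ℕ, (∀ p < k, v p < vertexCount (w.map Fin.val).length) ∧
      ∀ p < k, ∀ q < k, p ≠ q →
        adjacent (w.map Fin.val) (vertexCount (w.map Fin.val).length) (v p) (v q) = true := by
  constructor
  · rintro ⟨n, G, rfl, hG⟩
    have h₁ := adjacent_encGraph G
    have h₂ := map_val_encGraph G h₁
    have h₃ : vertexCount ((Parameterized.encGraph G).map Fin.val).length = n := by
      rw [h₂, length_graphCode, vertexCount_eq]
    simp only [h₃]
    exact ⟨h₂, (exists_isNClique_iff G h₁).1 hG⟩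
  · rintro ⟨h₁, h₂⟩
    refine ⟨_, graph (w.map Fin.val) (vertexCount (w.map Fin.val).length), ?_,
      (exists_isNClique_iff _ fun _ _ => Iff.rfl).2 h₂⟩
    refine List.map_injective_iff.2 Fin.val_injective ?_
    rw [map_val_encGraph _ fun _ _ => Iff.rfl]
    exact h₁

/-- Even the encoding of zero agents contains the final `0` of the number of agents. -/
theorem not_mem_of_nil (k : ℕ) : ([], k) ∉ dsrPosetByWidth 3 := by
  rintro ⟨I, h, -⟩
  simp [DSRPoset.enc, Parameterized.encNat] at h

theorem reduction_spec (w : List (Fin 2)) (k : ℕ) : ∃ (w' : List (Fin 2)) (k' : ℕ),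
    reduction (w.map Fin.val, k) = (w'.map Fin.val, k') ∧ k' ≤ 12 * (k * k) ∧
      ((w, k) ∈ Parameterized.Clique ↔ (w', k') ∈ dsrPosetByWidth 3) := by
  by_cases h : w.map Fin.val = graphCode (vertexCount (w.map Fin.val).length)
    (adjacent (w.map Fin.val) (vertexCount (w.map Fin.val).length))
  · refine ⟨(cliqueInst k (vertexCount (w.map Fin.val).length)
      (adjacent (w.map Fin.val) (vertexCount (w.map Fin.val).length))).toDSRPoset.enc,
      12 * (k * k), ?_, le_rfl, ?_⟩
    · rw [KeyInstance.map_val_enc]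
      exact if_pos h
    · rw [mem_clique_iff, and_iff_right h, ← cliqueInst_hasStableMatching_iff]
      constructor
      · exact fun h => ⟨_, rfl, (width_inst _).symm, h⟩
      -- The witness may differ from the constructed instance; only the strings are known to agree.
      · rintro ⟨I, h, -, hI⟩
        exact DSRPoset.hasStableMatching_of_enc_eq h.symm hI
  · refine ⟨[], 0, if_neg h, Nat.zero_le _, ?_⟩
    rw [mem_clique_iff]
    exact iff_of_false (fun h' => h h'.1) (not_mem_of_nil 0)

end Gadget

end Roommates

namespace While

/-! ## Composition with an arbitrary reduction -/

/-- The height of a tree.  In contrast to its size, it grows by a constant in each step. -/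
def Tree.height : Tree → ℕ
  | .nil => 0
  | .cons x y => max x.height y.height + 1

theorem Tree.height_hd_le (x : Tree) : x.hd.height ≤ x.height := by
  cases x with
  | nil => exact le_rfl
  | cons x y => exact (le_max_left _ _).trans (Nat.le_succ _)

theorem Tree.height_tl_le (x : Tree) : x.tl.height ≤ x.height := by
  cases x with
  | nil => exact le_rfl
  | cons x y => exact (le_max_right _ _).trans (Nat.le_succ _)

theorem Tree.height_ofNat (n : ℕ) : (Tree.ofNat n).height = n := by
  induction n with
  | zero => rfl
  | succ n ih => simp [Tree.ofNat, Tree.height, ih]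

theorem Tree.length_le_height_ofList (l : List Tree) : l.length ≤ (Tree.ofList l).height := by
  induction l with
  | nil => exact le_rfl
  | cons x l ih =>
    simp only [Tree.ofList, Tree.height, List.length_cons]
    omega

theorem Tree.height_ofList_le {l : List Tree} {B : ℕ} (h : ∀ x ∈ l, x.height ≤ B) :
    (Tree.ofList l).height ≤ l.length + B := by
  induction l with
  | nil => exact Nat.zero_le _
  | cons x l ih =>
    have h₁ := ih fun y hy => h y (List.mem_cons_of_mem _ hy)
    have h₂ := h x List.mem_cons_self
    simp only [Tree.ofList, Tree.height, List.length_cons]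
    omega

theorem Expr.height_eval_le {σ : Store} {B : ℕ} (h : ∀ i, (σ i).height ≤ B) (e : Expr) :
    (e.eval σ).height ≤ B + e.cost := by
  induction e with
  | var x => exact (h x).trans (Nat.le_add_right _ _)
  | nil => exact Nat.zero_le _
  | cons e f he hf =>
    simp only [eval, cost, Tree.height]
    omega
  | hd e he =>
    have := Tree.height_hd_le (e.eval σ)
    simp only [eval, cost]
    omega
  | tl e he =>
    have := Tree.height_tl_le (e.eval σ)
    simp only [eval, cost]
    omega

/-- Since a string's length and a unary parameter are at most the height of their tree, this
converts the time of an arbitrary reduction into a bound on its output. -/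
theorem Runs.height_le {c : Cmd} {σ τ : Store} {t : ℕ} (h : Runs c σ τ t) {B : ℕ}
    (hB : ∀ i, (σ i).height ≤ B) (i : ℕ) : (τ i).height ≤ B + t := by
  induction h generalizing B i with
  | assign x e σ =>
    have := Expr.height_eval_le hB e
    by_cases hi : i = x
    · subst hi
      rw [Function.update_self]
      omega
    · rw [Function.update_of_ne hi]
      exact (hB i).trans (Nat.le_add_right _ _)
  | seq _ _ ih₁ ih₂ => exact (ih₂ (ih₁ hB) i).trans (by omega)
  | ite_true _ _ ih => exact (ih hB i).trans (by omega)
  | ite_false _ _ ih => exact (ih hB i).trans (by omega)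
  | loop_done _ => exact (hB i).trans (Nat.le_add_right _ _)
  | loop_step _ _ _ ih₁ ih₂ => exact (ih₂ (ih₁ hB) i).trans (by omega)

end While

namespace Parameterized

open While

/-! ### Output size of a reduction, and composition -/

theorem toTree_eq_enc {s : ℕ} (w : List (Fin s)) (k : ℕ) :
    toTree w k = Enc.enc (w.map Fin.val, k) := by
  have : (do let a ← w; pure a.1) = w.map Fin.val := by simp [← List.map_eq_flatMap]
  rw [toTree, this]
  rfl

theorem height_toTree {s : ℕ} (w : List (Fin s)) (k : ℕ) : (toTree w k).height =
    max (While.Tree.ofList ((w.map Fin.val).map .ofNat)).height k + 1 := by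
  rw [toTree_eq_enc]
  conv_rhs => rw [← While.Tree.height_ofNat k]
  rfl

theorem height_toTree_le {s : ℕ} (w : List (Fin s)) (k : ℕ) :
    (toTree w k).height ≤ w.length + s + k + 1 := by
  have := While.Tree.height_ofList_le (l := (w.map Fin.val).map .ofNat) (B := s) (by
    intro x hx
    rw [List.map_map] at hx
    obtain ⟨a, -, rfl⟩ := List.mem_map.1 hx
    rw [Function.comp_apply, While.Tree.height_ofNat]
    exact a.2.le)
  rw [List.length_map, List.length_map] at this
  rw [height_toTree]
  omega

theorem length_le_height_toTree {s : ℕ} (w : List (Fin s)) (k : ℕ) :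
    w.length ≤ (toTree w k).height ∧ k ≤ (toTree w k).height := by
  have := While.Tree.length_le_height_ofList ((w.map Fin.val).map .ofNat)
  rw [List.length_map, List.length_map] at this
  rw [height_toTree]
  omega

/-- A binary letter has size at most `3`, so the string contributes `4 * B + 1`, the parameter `2 *
B + 1` and the pairing `1`. -/
theorem len_le {w : List (Fin 2)} {k B : ℕ} (hw : w.length ≤ B) (hk : k ≤ B) :
    len (w.map Fin.val, k) ≤ 6 * B + 3 := by
  have h := len_le_of_forall (l := w.map Fin.val) (B := 3) (by
    intro a ha
    obtain ⟨b, -, rfl⟩ := List.mem_map.1 ha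
    rw [len_nat]
    omega)
  rw [List.length_map] at h
  rw [len_prod, len_nat]
  simp only
  omega

theorem primrec_pow (c : ℕ) : Primrec fun n : ℕ => n ^ c := by
  induction c with
  | zero => exact (Primrec.const 1).of_eq fun n => (pow_zero n).symm
  | succ c ih => exact (Primrec.nat_mul.comp ih Primrec.id).of_eq fun n => (pow_succ n c).symm

/-- A parameterized reduction followed by a map that is computable in polynomial time. -/
theorem Reduces.trans_polyTime {s : ℕ} {L : Lang s} {L' L'' : Lang 2} (h : Reduces L L')
    {φ : List ℕ × ℕ → List ℕ × ℕ} (hφ : PolyTime φ) {γ : ℕ → ℕ} (hγ : Primrec γ)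
    (hmono : Monotone γ)
    (hspec : ∀ (w : List (Fin 2)) (k : ℕ), ∃ (w' : List (Fin 2)) (k' : ℕ),
      φ (w.map Fin.val, k) = (w'.map Fin.val, k') ∧ k' ≤ γ k ∧ ((w, k) ∈ L' ↔ (w', k') ∈ L'')) :
    Reduces L L'' := by
  obtain ⟨p, f, g, c, hf, hg, hp⟩ := h
  obtain ⟨-, F, T, ⟨m, hm⟩, hF⟩ := hφ
  -- The three summands pay for the sequencing, the first run and the second run. The `11` is `6 +
  -- 5`, from `6 * B + 3` in `len_le` and the `2` in `PolyBounded`.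
  refine ⟨.seq p (F 0), fun k => f k + 1 + (11 * (1 + s + f k)) ^ m, fun k => γ (g k),
    c + (c + 1) * m, ?_, hγ.to_comp.comp hg, fun w k => ?_⟩
  · have h₁ : Primrec fun y : ℕ => y + 1 + (11 * (1 + s + y)) ^ m :=
      Primrec.nat_add.comp Primrec.succ ((primrec_pow m).comp (Primrec.nat_mul.comp
        (Primrec.const 11) (Primrec.nat_add.comp (Primrec.const (1 + s)) Primrec.id)))
    exact h₁.to_comp.comp hf
  · obtain ⟨w₁, k₁, ⟨τ, t, h₁, h₂, h₃⟩, hk, hL⟩ := hp w k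
    obtain ⟨w₂, k₂, e, hk₂, hL'⟩ := hspec w₁ k₁
    obtain ⟨ρ, u, g₁, g₂, -, g₄⟩ := hF 0 τ (w₁.map Fin.val, k₁) (by rw [h₂, toTree_eq_enc])
    refine ⟨w₂, k₂, ⟨ρ, _, .seq h₁ g₁, by rw [g₂, e, toTree_eq_enc], ?_⟩,
      hk₂.trans (hmono hk), hL.trans hL'⟩
    have hh := h₁.height_le (B := w.length + s + k + 1) (fun i => by
      unfold initStore
      split_ifs
      · exact height_toTree_le w k
      · exact Nat.zero_le _) 0
    rw [h₂] at hh
    have hl := length_le_height_toTree w₁ k₁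
    have hlen := len_le (hl.1.trans hh) (hl.2.trans hh)
    have hX : 1 ≤ w.length + k + 1 := by omega
    have hsX : w.length + s + k + 1 ≤ w.length + k + 1 + s := by omega
    generalize w.length + k + 1 = X at *
    have hXc : 1 ≤ X ^ c := Nat.one_le_pow _ _ hX
    have hXc' : 1 ≤ X ^ (c + 1) := Nat.one_le_pow _ _ hX
    have hXle : X ≤ X ^ (c + 1) := Nat.le_self_pow (by omega) X
    have hXcle : X ^ c ≤ X ^ (c + 1) := Nat.pow_le_pow_right hX (by omega)
    have hA : len (w₁.map Fin.val, k₁) + 2 ≤ 11 * (1 + s + f k) * X ^ (c + 1) := by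
      have e₁ : f k * X ^ c ≤ f k * X ^ (c + 1) := Nat.mul_le_mul_left _ hXcle
      have e₂ : s ≤ s * X ^ (c + 1) := Nat.le_mul_of_pos_right _ hXc'
      calc len (w₁.map Fin.val, k₁) + 2 ≤ 11 * (X ^ (c + 1) + s * X ^ (c + 1) +
            f k * X ^ (c + 1)) := by omega
        _ = _ := by ring
    have hu : u ≤ (11 * (1 + s + f k)) ^ m * X ^ ((c + 1) * m) := by
      refine (g₄.trans (hm _)).trans ((Nat.pow_le_pow_left hA m).trans ?_)
      rw [mul_pow, pow_mul]
    have hC : X ^ c ≤ X ^ (c + (c + 1) * m) := Nat.pow_le_pow_right hX (by omega)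
    have hC' : X ^ ((c + 1) * m) ≤ X ^ (c + (c + 1) * m) := Nat.pow_le_pow_right hX (by omega)
    have hC₁ : 1 ≤ X ^ (c + (c + 1) * m) := Nat.one_le_pow _ _ hX
    calc 1 + t + u ≤ X ^ (c + (c + 1) * m) + f k * X ^ (c + (c + 1) * m) +
          (11 * (1 + s + f k)) ^ m * X ^ (c + (c + 1) * m) :=
        Nat.add_le_add (Nat.add_le_add hC₁ (h₃.trans (Nat.mul_le_mul_left _ hC)))
          (hu.trans (Nat.mul_le_mul_left _ hC'))
      _ = _ := by ring

end Parameterized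

/-- `3`-DSR-Poset is `W[1]`-hard when parameterized by the width of the master poset. -/
theorem mainTheorem4 : Parameterized.W1Hard (Roommates.dsrPosetByWidth 3) := by
  intro r L' hL'
  refine Parameterized.Reduces.trans_polyTime hL' Roommates.Gadget.polyTime_reduction
    (γ := fun k => 12 * (k * k))
    (Primrec.nat_mul.comp (Primrec.const 12) (Primrec.nat_mul.comp Primrec.id Primrec.id))
    (fun k k' h => Nat.mul_le_mul_left _ (Nat.mul_le_mul h h)) Roommates.Gadget.reduction_spec
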